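/- Work over $\mathbb C[[\hbar]]$, write $q=e^{\hbar}$ and $[n]=\frac{e^{n\hbar}-e^{-n\hbar}}{e^{\hbar}-e^{-\hbar}}$; all tensor products are completed in the $\hbar$-adic topology, and algebras given by generators and relations are topologically generated (complete free algebra modulo the closed ideal of the relations). For $p\in\mathbb N$ let $U_\hbar\mathfrak{gl}_p$ be the Drinfeld--Jimbo quantum group, generated by $E_i,F_i$ $(1\le i\le p-1)$ and $D_i$ $(1\le i\le p)$ with $H_i=D_i-D_{i+1}$ and relations $[D_i,D_j]=0$, $[D_i,E_j]=(\delta_{i,j}-\delta_{i,j+1})E_j$, $[D_i,F_j]=-(\delta_{i,j}-\delta_{i,j+1})F_j$, $[E_i,F_j]=\delta_{ij}\frac{e^{\hbar H_i}-e^{-\hbar H_i}}{e^{\hbar}-e^{-\hbar}}$ and the $q$-Serre relations of type $A_{p-1}$. It has coproduct $\Delta(D_i)=D_i\otimes1+1\otimes D_i$, $\Delta(E_i)=E_i\otimes e^{\hbar H_i}+1\otimes E_i$, $\Delta(F_i)=F_i\otimes1+e^{-\hbar H_i}\otimes F_i$ and counit $\varepsilon(E_i)=\varepsilon(F_i)=\varepsilon(D_i)=0$.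 Let $t_{ij}$ be the matrix coefficients of its vector representation on $\mathbb C^p[[\hbar]]$, in which $D_i=E_{ii}$, $E_i=E_{i,i+1}$, $F_i=E_{i+1,i}$. For $k,n\in\mathbb N$ let $S_\hbar(k,n)$ be the algebra generated by $X_{ij}$, $1\le i\le k$, $1\le j\le n$, with relations $$X_{ij}X_{ab}=\begin{cases}X_{ab}X_{ij}& a>i,\ b<j\ \text{ or }\ a<i,\ b>j\\ e^{-\hbar}X_{ab}X_{ij}& a>i,\ b=j\ \text{ or }\ a=i,\ b>j\\ X_{ab}X_{ij}-(e^{\hbar}-e^{-\hbar})X_{aj}X_{ib}& a>i,\ b>j,\end{cases}$$ graded by $\deg X_{ij}=1$, with homogeneous components $S^d_\hbar(k,n)$, $d\in\mathbb N$. Let $\Delta_{kln}:S_\hbar(k,n)\to S_\hbar(k,l)\otimes S_\hbar(l,n)$ be the algebra homomorphism $X_{ij}\mapsto\sum_{l'}X_{il'}\otimes X_{l'j}$, let $S_\hbar(p,p)$ have coproduct $\Delta_{ppp}$ and counit $X_{ij}\mapsto\delta_{ij}$, let $\tau(X_{ij})=X_{ji}$ be the transposition of $S_\hbar(k,k)$,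 and for a matrix $m$ of natural numbers let $X^m=X_{11}^{m_{11}}\cdots X_{k1}^{m_{k1}}\cdots X_{1n}^{m_{1n}}\cdots X_{kn}^{m_{kn}}$. Let $c_j:S_\hbar(k,1)\to S_\hbar(k,n)$, $X_{i1}\mapsto X_{ij}$, and $r_i:S_\hbar(1,n)\to S_\hbar(k,n)$, $X_{1j}\mapsto X_{ij}$. **Theorem.** All the structure maps above exist, and for every $p$ the assignment $X_{ij}\mapsto t_{ij}$ extends to a bialgebra morphism $\kappa_p$ from $S_\hbar(p,p)$ to the dual of $U_\hbar\mathfrak{gl}_p$; write $\langle\cdot,\cdot\rangle$ for the resulting pairing. For all $k,n\in\mathbb N$: 1. The formulas $x\,f=\langle x\otimes1,(\tau\otimes1)\Delta_{kkn}(f)\rangle$ for $x\in U_\hbar\mathfrak{gl}_k$ and $y\,f=\langle1\otimes y,\Delta_{knn}(f)\rangle$ for $y\in U_\hbar\mathfrak{gl}_n$ define an action of $U_\hbar\mathfrak{gl}_k\otimes U_\hbar\mathfrak{gl}_n$ on $S_\hbar(k,n)$ which makes it a left module algebra, and every homogeneous component $S^d_\hbar(k,n)$ is invariant. 2. The maps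 $\Phi(p_1\otimes\cdots\otimes p_n)=c_1(p_1)\cdots c_n(p_n)$ and $\Psi(q_1\otimes\cdots\otimes q_k)=r_1(q_1)\cdots r_k(q_k)$ are isomorphisms $$\Phi:S_\hbar(k,1)^{\otimes n}\to S_\hbar(k,n),\qquad\Psi:S_\hbar(1,n)^{\otimes k}\to S_\hbar(k,n)$$ of $\mathbb N$-graded $U_\hbar\mathfrak{gl}_k$-modules and $\mathbb N$-graded $U_\hbar\mathfrak{gl}_n$-modules respectively, where the tensor powers are modules through the iterated coproduct. 3. For every $m\in M_{k,n}(\mathbb N)$, with $(\varepsilon_{ab})_{cd}=\delta_{ac}\delta_{bd}$ (terms with coefficient $[0]=0$ being omitted), the generators $D^{(k)}_i,E^{(k)}_i,F^{(k)}_i$ of $U_\hbar\mathfrak{gl}_k$ and $D^{(n)}_j,E^{(n)}_j,F^{(n)}_j$ of $U_\hbar\mathfrak{gl}_n$ act by $$D^{(k)}_iX^m=\sum_{j=1}^n m_{ij}X^m,$$ $$E^{(k)}_iX^m=\sum_{j=1}^n[m_{i+1,j}]\prod_{j'=j+1}^n e^{\hbar(m_{ij'}-m_{i+1,j'})}X^{m+\varepsilon_{ij}-\varepsilon_{i+1,j}},$$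 $$F^{(k)}_iX^m=\sum_{j=1}^n[m_{ij}]\prod_{j'=1}^{j-1}e^{-\hbar(m_{ij'}-m_{i+1,j'})}X^{m-\varepsilon_{ij}+\varepsilon_{i+1,j}},$$ $$D^{(n)}_jX^m=\sum_{i=1}^k m_{ij}X^m,$$ $$E^{(n)}_jX^m=\sum_{i=1}^k[m_{i,j+1}]\prod_{i'=i+1}^k e^{\hbar(m_{i'j}-m_{i',j+1})}X^{m+\varepsilon_{ij}-\varepsilon_{i,j+1}},$$ $$F^{(n)}_jX^m=\sum_{i=1}^k[m_{ij}]\prod_{i'=1}^{i-1}e^{-\hbar(m_{i'j}-m_{i',j+1})}X^{m-\varepsilon_{ij}+\varepsilon_{i,j+1}}.$$ -/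

import Mathlib

open scoped TensorProduct

noncomputable section

namespace QHowe

/-! ## The base ring `ℂ⟦ħ⟧` and formal exponentials -/

/-- The base ring `ℂ⟦ħ⟧`. -/
abbrev Rh : Type := PowerSeries ℂ

/-- The formal parameter `ħ`. -/
abbrev hbar : Rh := PowerSeries.X

/-- The ideal `(ħ)`, which defines the `ħ`-adic topology on every `ℂ⟦ħ⟧`-module. -/
abbrev hI : Ideal Rh := Ideal.span {PowerSeries.X}

section Series

variable {A : Type} [Ring A] [Algebra ℂ A]

/-- `e^{ħ a} = ∑ᵣ ħ^r a^r / r!` as a power series in `ħ` with coefficients in `A`. -/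
def expH (a : A) : PowerSeries A :=
  PowerSeries.mk fun r => ((r.factorial : ℂ)⁻¹) • a ^ r

/-- `(e^{ħ a} - e^{-ħ a}) / ħ`. -/
def shH (a : A) : PowerSeries A :=
  PowerSeries.mk fun r => PowerSeries.coeff (r + 1) (expH a - expH (-a))

/-- The series `[a] = (e^{ħ a} - e^{-ħ a}) / (e^{ħ} - e^{-ħ})`.  Both the numerator and the
denominator are divided by `ħ`, after which the denominator is invertible in `ℂ⟦ħ⟧`. -/
def qBracket (a : A) : PowerSeries A :=
  PowerSeries.map (algebraMap ℂ A) (shH (1 : ℂ))⁻¹ * shH a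

theorem X_mul_shH (a : A) : PowerSeries.X * shH a = expH a - expH (-a) := by
  ext r
  cases r with
  | zero => simp [expH]
  | succ r => rw [PowerSeries.coeff_succ_X_mul]; simp [shH]

end Series

theorem constantCoeff_shH_one : PowerSeries.constantCoeff (shH (1 : ℂ)) = 2 := by
  rw [← PowerSeries.coeff_zero_eq_constantCoeff_apply]
  simp [shH, expH]; norm_num

/-- The defining property of `[a]` for a complex number `a`. -/
theorem qBracket_spec (a : ℂ) :
    (expH (1 : ℂ) - expH (-1 : ℂ)) * qBracket a = expH a - expH (-a) := by
  have h : shH (1 : ℂ) * (shH (1 : ℂ))⁻¹ = 1 :=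
    PowerSeries.mul_inv_cancel _ (by rw [constantCoeff_shH_one]; norm_num)
  rw [← X_mul_shH, ← X_mul_shH, qBracket]
  simp only [Algebra.algebraMap_self, PowerSeries.map_id, id_eq]
  linear_combination (PowerSeries.X * shH a) * h

/-- The `q`-integer `[n]` in `ℂ⟦ħ⟧`. -/
def qInt (n : ℕ) : Rh := qBracket (n : ℂ)

/-- The `q`-factorial `[n]! = [n][n-1]⋯[1]`. -/
def qFactorial (n : ℕ) : Rh := ∏ r ∈ Finset.range n, qInt (r + 1)

/-- The `q`-binomial coefficient `[n]! / ([m]! [n-m]!)` (the denominator has non-zero constant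
term, hence is invertible in `ℂ⟦ħ⟧`). -/
def qBinom (n m : ℕ) : Rh := qFactorial n * (qFactorial m * qFactorial (n - m))⁻¹

theorem mem_hI_pow_smul_top {M : Type} [AddCommGroup M] [Module Rh M] (n : ℕ) (x : M) :
    x ∈ (hI ^ n • ⊤ : Submodule Rh M) ↔ ∃ z, x = hbar ^ n • z := by
  rw [Ideal.span_singleton_pow, Submodule.ideal_span_singleton_smul,
    Submodule.mem_smul_pointwise_iff_exists]
  simp [eq_comm]

/-! ## Algebras topologically generated by generators and relations -/

/-- The `ħ`-adic completion of the free `ℂ⟦ħ⟧`-algebra on `ι`, realised as formal power series in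
`ħ` with coefficients in the free `ℂ`-algebra on `ι`. -/
def FreeSeries (ι : Type) : Type := PowerSeries (FreeAlgebra ℂ ι)

instance (ι : Type) : Ring (FreeSeries ι) :=
  inferInstanceAs (Ring (PowerSeries (FreeAlgebra ℂ ι)))

instance (ι : Type) : Algebra Rh (FreeSeries ι) :=
  RingHom.toAlgebra' (S := PowerSeries (FreeAlgebra ℂ ι))
    (PowerSeries.map (algebraMap ℂ (FreeAlgebra ℂ ι))) (by
      intro c x
      ext r
      rw [PowerSeries.coeff_mul, PowerSeries.coeff_mul,
        ← Finset.Nat.sum_antidiagonal_swap]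
      refine Finset.sum_congr rfl fun p _ => ?_
      simp only [PowerSeries.coeff_map, Prod.fst_swap, Prod.snd_swap]
      exact Algebra.commutes _ _)

/-- View a power series with coefficients in the free algebra as an element of `FreeSeries`. -/
def FreeSeries.ofSeries {ι : Type} (f : PowerSeries (FreeAlgebra ℂ ι)) : FreeSeries ι := f

/-- The generators of the completed free algebra. -/
def FreeSeries.gen {ι : Type} (i : ι) : FreeSeries ι :=
  FreeSeries.ofSeries (PowerSeries.C (FreeAlgebra.ι ℂ i))

/-- A two-sided ideal which is closed in the `ħ`-adic topology. -/
def IsHClosed {ι : Type} (I : TwoSidedIdeal (FreeSeries ι)) : Prop :=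
  ∀ x : FreeSeries ι, (∀ n : ℕ, ∃ z : FreeSeries ι, x - hbar ^ n • z ∈ I) → x ∈ I

/-- The closed two-sided ideal generated by a set of relators. -/
def closedIdeal {ι : Type} (rels : Set (FreeSeries ι)) : TwoSidedIdeal (FreeSeries ι) :=
  sInf {I | rels ⊆ (I : Set (FreeSeries ι)) ∧ IsHClosed I}

theorem isHClosed_closedIdeal {ι : Type} (rels : Set (FreeSeries ι)) :
    IsHClosed (closedIdeal rels) := by
  intro x hx
  refine (TwoSidedIdeal.mem_sInf _).2 fun I hI => ?_
  refine hI.2 x fun n => ?_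
  obtain ⟨z, hz⟩ := hx n
  exact ⟨z, (TwoSidedIdeal.mem_sInf _).1 hz I hI⟩

theorem subset_closedIdeal {ι : Type} (rels : Set (FreeSeries ι)) {x : FreeSeries ι}
    (hx : x ∈ rels) : x ∈ closedIdeal rels :=
  (TwoSidedIdeal.mem_sInf _).2 fun _ hI => hI.1 hx

theorem FreeSeries.coeff_smul {ι : Type} (n r : ℕ) (z : FreeSeries ι) :
    PowerSeries.coeff (R := FreeAlgebra ℂ ι) r (hbar ^ n • z : FreeSeries ι) =
      if n ≤ r then PowerSeries.coeff (R := FreeAlgebra ℂ ι) (r - n) z else 0 := by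
  rw [Algebra.smul_def]
  change PowerSeries.coeff r (PowerSeries.map (algebraMap ℂ (FreeAlgebra ℂ ι)) (PowerSeries.X ^ n) *
    (show PowerSeries (FreeAlgebra ℂ ι) from z)) = _
  rw [map_pow, PowerSeries.map_X, PowerSeries.coeff_X_pow_mul']

/-- The `ℂ⟦ħ⟧`-algebra topologically generated by `ι` with relators `rels`: the quotient of the
completed free algebra by the closed two-sided ideal generated by the relators. -/
def PresAlg {ι : Type} (rels : Set (FreeSeries ι)) : Type :=
  (closedIdeal rels).ringCon.Quotient

namespace PresAlg

variable {ι ι' : Type} (rels : Set (FreeSeries ι)) (rels' : Set (FreeSeries ι'))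

instance : Ring (PresAlg rels) :=
  inferInstanceAs (Ring (closedIdeal rels).ringCon.Quotient)

instance : Algebra Rh (PresAlg rels) :=
  inferInstanceAs (Algebra Rh (closedIdeal rels).ringCon.Quotient)

/-- The quotient map. -/
def mk : FreeSeries ι →ₐ[Rh] PresAlg rels :=
  { (closedIdeal rels).ringCon.mk' with commutes' := fun _ => rfl }

/-- The class of a generator. -/
def gen (i : ι) : PresAlg rels := mk rels (FreeSeries.gen i)

theorem mk_surjective : Function.Surjective (mk rels) :=
  RingCon.mk'_surjective _

theorem mk_eq_zero_iff (x : FreeSeries ι) : mk rels x = 0 ↔ x ∈ closedIdeal rels := by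
  rw [TwoSidedIdeal.mem_iff]
  exact (RingCon.eq _)


/-- Presented algebras are `ħ`-adically separated and complete. -/
instance : IsAdicComplete hI (PresAlg rels) where
  haus' x hx := by
    obtain ⟨a, rfl⟩ := mk_surjective rels x
    rw [mk_eq_zero_iff]
    refine isHClosed_closedIdeal rels a fun n => ?_
    obtain ⟨z, hz⟩ := (mem_hI_pow_smul_top n _).mp (SModEq.zero.mp (hx n))
    obtain ⟨b, rfl⟩ := mk_surjective rels z
    refine ⟨b, ?_⟩
    rw [← mk_eq_zero_iff, map_sub, map_smul, hz, sub_self]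
  prec' f hf := by
    have h1 : ∀ n, ∃ w : FreeSeries ι, f (n + 1) - f n = hbar ^ n • mk rels w := by
      intro n
      obtain ⟨z, hz⟩ := (mem_hI_pow_smul_top n _).mp
        (SModEq.sub_mem.mp (hf (Nat.le_succ n)).symm)
      obtain ⟨b, rfl⟩ := mk_surjective rels z
      exact ⟨b, hz⟩
    choose w hw using h1
    obtain ⟨a0, ha0⟩ := mk_surjective rels (f 0)
    have h2 : ∀ N, f N = mk rels (a0 + ∑ n ∈ Finset.range N, hbar ^ n • w n) := by
      intro N
      induction N with
      | zero => simp [ha0]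
      | succ N ih =>
        rw [Finset.sum_range_succ, ← add_assoc, map_add, ← ih, map_smul, ← hw N]
        abel
    let T : ℕ → FreeSeries ι := fun N => FreeSeries.ofSeries (PowerSeries.mk fun r =>
      ∑ n ∈ Finset.range (r + 1), PowerSeries.coeff (R := FreeAlgebra ℂ ι) (r - n) (w (N + n)))
    have h3 : ∀ N, T 0 = ∑ n ∈ Finset.range N, hbar ^ n • w n + hbar ^ N • T N := by
      intro N
      refine PowerSeries.ext (R := FreeAlgebra ℂ ι) fun r => ?_
      refine Eq.trans ?_ (map_add (PowerSeries.coeff (R := FreeAlgebra ℂ ι) r) _ _).symm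
      rw [show PowerSeries.coeff (R := FreeAlgebra ℂ ι) r
          (∑ n ∈ Finset.range N, hbar ^ n • w n : FreeSeries ι) =
          ∑ n ∈ Finset.range N, PowerSeries.coeff (R := FreeAlgebra ℂ ι) r
            (hbar ^ n • w n : FreeSeries ι) from
            map_sum (PowerSeries.coeff (R := FreeAlgebra ℂ ι) r) _ _]
      simp only [FreeSeries.coeff_smul]
      have hT : ∀ N r, PowerSeries.coeff (R := FreeAlgebra ℂ ι) r (T N) =
        ∑ n ∈ Finset.range (r + 1),
          PowerSeries.coeff (R := FreeAlgebra ℂ ι) (r - n) (w (N + n)) :=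
        fun N r => PowerSeries.coeff_mk _ _
      rw [hT, hT]
      simp only [zero_add]
      rw [← Finset.sum_filter]
      split_ifs with hNr
      · rw [show r + 1 = N + (r - N + 1) by omega, Finset.sum_range_add]
        congr 1
        · refine Finset.sum_congr ?_ fun _ _ => rfl
          ext n; simp only [Finset.mem_range, Finset.mem_filter]; omega
        · refine Finset.sum_congr rfl fun n _ => ?_
          rw [Nat.sub_sub]
      · rw [add_zero]
        refine Finset.sum_congr ?_ fun _ _ => rfl
        ext n; simp only [Finset.mem_range, Finset.mem_filter]; omega
    refine ⟨mk rels (a0 + T 0), fun N => ?_⟩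
    rw [SModEq.sub_mem, h2 N, h3 N, mem_hI_pow_smul_top]
    refine ⟨mk rels (-T N), ?_⟩
    rw [← map_sub, ← map_smul]
    congr 1
    rw [smul_neg]
    abel

variable {rels rels'}

/-- Two algebra homomorphisms from a presented algebra to a separated algebra which agree on the
generators are equal: a homomorphism "given on the generators" is unambiguous. -/
theorem algHom_ext {B : Type} [Ring B] [Algebra Rh B] [IsHausdorff hI B]
    {f g : PresAlg rels →ₐ[Rh] B} (h : ∀ i, f (gen rels i) = g (gen rels i)) : f = g := by
  have hC : ∀ a : FreeAlgebra ℂ ι,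
      f (mk rels (FreeSeries.ofSeries (PowerSeries.C a))) =
        g (mk rels (FreeSeries.ofSeries (PowerSeries.C a))) := by
    intro a
    induction a using FreeAlgebra.induction with
    | grade0 c =>
      have hc : FreeSeries.ofSeries (PowerSeries.C (algebraMap ℂ (FreeAlgebra ℂ ι) c)) =
          algebraMap Rh (FreeSeries ι) (PowerSeries.C c) :=
        (PowerSeries.map_C (algebraMap ℂ (FreeAlgebra ℂ ι)) c).symm
      rw [hc, AlgHom.commutes, AlgHom.commutes, AlgHom.commutes]
    | grade1 i => exact h i
    | mul a b ha hb =>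
      have : FreeSeries.ofSeries (PowerSeries.C (a * b)) =
          FreeSeries.ofSeries (PowerSeries.C a) * FreeSeries.ofSeries (PowerSeries.C b) :=
        map_mul (PowerSeries.C (R := FreeAlgebra ℂ ι)) a b
      rw [this, map_mul, map_mul, map_mul, ha, hb]
    | add a b ha hb =>
      have : FreeSeries.ofSeries (PowerSeries.C (a + b)) =
          FreeSeries.ofSeries (PowerSeries.C a) + FreeSeries.ofSeries (PowerSeries.C b) :=
        map_add (PowerSeries.C (R := FreeAlgebra ℂ ι)) a b
      rw [this, map_add, map_add, map_add, ha, hb]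
  have hs : ∀ (n : ℕ) (a : FreeSeries ι), ∃ z : B,
      f (mk rels a) - g (mk rels a) = hbar ^ n • z := by
    intro n
    induction n with
    | zero => intro a; exact ⟨_, by rw [pow_zero, one_smul]⟩
    | succ n ih =>
      intro a
      let a' : FreeSeries ι := FreeSeries.ofSeries (PowerSeries.mk fun r =>
        PowerSeries.coeff (R := FreeAlgebra ℂ ι) (r + 1) a)
      have ha : a = hbar ^ 1 • a' + FreeSeries.ofSeries (PowerSeries.C
          (PowerSeries.coeff (R := FreeAlgebra ℂ ι) 0 a)) := by
        refine PowerSeries.ext (R := FreeAlgebra ℂ ι) fun r => ?_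
        refine Eq.trans ?_ (map_add (PowerSeries.coeff (R := FreeAlgebra ℂ ι) r) _ _).symm
        rw [FreeSeries.coeff_smul]
        have e1 : ∀ r, PowerSeries.coeff (R := FreeAlgebra ℂ ι) r a' =
          PowerSeries.coeff (R := FreeAlgebra ℂ ι) (r + 1) a := fun r => PowerSeries.coeff_mk _ _
        have e2 : ∀ (r : ℕ) (c : FreeAlgebra ℂ ι), PowerSeries.coeff (R := FreeAlgebra ℂ ι) r
          (FreeSeries.ofSeries (PowerSeries.C c)) = if r = 0 then c else 0 :=
          fun r c => PowerSeries.coeff_C r c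
        rw [e1, e2]
        cases r with
        | zero => simp
        | succ r => simp
      obtain ⟨z, hz⟩ := ih a'
      refine ⟨z, ?_⟩
      rw [ha, map_add, map_add, map_add, hC, map_smul, map_smul, map_smul,
        add_sub_add_right_eq_sub, ← smul_sub, hz, smul_smul, ← pow_add, add_comm 1 n]
  refine AlgHom.ext fun x => ?_
  obtain ⟨a, rfl⟩ := mk_surjective rels x
  refine sub_eq_zero.mp (IsHausdorff.haus (I := hI) inferInstance _ fun n => ?_)
  rw [SModEq.zero, mem_hI_pow_smul_top]
  exact hs n a

/-- The algebra homomorphism of completed free algebras induced by a map of generators. -/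
def _root_.QHowe.FreeSeries.map (f : ι → ι') : FreeSeries ι →ₐ[Rh] FreeSeries ι' :=
  { (PowerSeries.map (FreeAlgebra.lift ℂ fun i => FreeAlgebra.ι ℂ (f i)).toRingHom :
      PowerSeries (FreeAlgebra ℂ ι) →+* PowerSeries (FreeAlgebra ℂ ι')) with
    commutes' := fun c => by
      refine PowerSeries.ext (R := FreeAlgebra ℂ ι') fun r => ?_
      exact AlgHom.commutes (FreeAlgebra.lift ℂ fun i => FreeAlgebra.ι ℂ (f i)) _ }

theorem _root_.QHowe.FreeSeries.map_gen (f : ι → ι') (i : ι) :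
    FreeSeries.map f (FreeSeries.gen i) = FreeSeries.gen (f i) := by
  refine (PowerSeries.map_C _ _).trans ?_
  exact congrArg PowerSeries.C (FreeAlgebra.lift_ι_apply _ _)

/-- The algebra homomorphism of presented algebras induced by a map of generators which sends
relators to consequences of relators. -/
def map (f : ι → ι') (h : ∀ r ∈ rels, mk rels' (FreeSeries.map f r) = 0) :
    PresAlg rels →ₐ[Rh] PresAlg rels' :=
  { (closedIdeal rels).ringCon.lift ((mk rels').comp (FreeSeries.map f)).toRingHom (by
      have key : closedIdeal rels ≤
          TwoSidedIdeal.ker ((mk rels').comp (FreeSeries.map f)) := by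
        refine sInf_le ⟨fun r hr => (TwoSidedIdeal.mem_ker _).mpr (h r hr), fun x hx => ?_⟩
        rw [TwoSidedIdeal.mem_ker]
        refine IsHausdorff.haus (I := hI) inferInstance _ fun n => ?_
        rw [SModEq.zero, mem_hI_pow_smul_top]
        obtain ⟨z, hz⟩ := hx n
        refine ⟨(mk rels').comp (FreeSeries.map f) z, ?_⟩
        rw [TwoSidedIdeal.mem_ker, map_sub, sub_eq_zero] at hz
        rw [hz, map_smul]
      intro x y hxy
      exact TwoSidedIdeal.ringCon_le_iff.mp key hxy) with
    commutes' := fun c => ((mk rels').comp (FreeSeries.map f)).commutes c }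

theorem map_gen (f : ι → ι') (h : ∀ r ∈ rels, mk rels' (FreeSeries.map f r) = 0) (i : ι) :
    map f h (gen rels i) = gen rels' (f i) :=
  congrArg (mk rels') (FreeSeries.map_gen f i)

end PresAlg

/-! ## Completions of modules -/

section Completion

theorem hI_fg : (hI : Ideal Rh).FG := ⟨{PowerSeries.X}, by simp⟩

instance (M : Type) [AddCommGroup M] [Module Rh M] :
    IsAdicComplete hI (AdicCompletion hI M) :=
  AdicCompletion.isAdicComplete hI_fg

variable {M N : Type} [AddCommGroup M] [Module Rh M] [AddCommGroup N] [Module Rh N]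

/-- The completion of a linear map, as a `ℂ⟦ħ⟧`-linear function of the map. -/
def mapC : (M →ₗ[Rh] N) →ₗ[Rh] (AdicCompletion hI M →ₗ[Rh] AdicCompletion hI N) where
  toFun f := (AdicCompletion.map hI f).restrictScalars Rh
  map_add' f g := by
    refine LinearMap.ext fun x => AdicCompletion.ext fun n => ?_
    obtain ⟨m, hm⟩ := Submodule.Quotient.mk_surjective _ (x.val n)
    change LinearMap.reduceModIdeal (hI ^ n) (f + g) (x.val n) =
      LinearMap.reduceModIdeal (hI ^ n) f (x.val n) + LinearMap.reduceModIdeal (hI ^ n) g (x.val n)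
    rw [← hm]
    rfl
  map_smul' c f := by
    refine LinearMap.ext fun x => AdicCompletion.ext fun n => ?_
    obtain ⟨m, hm⟩ := Submodule.Quotient.mk_surjective _ (x.val n)
    change LinearMap.reduceModIdeal (hI ^ n) (c • f) (x.val n) =
      c • LinearMap.reduceModIdeal (hI ^ n) f (x.val n)
    rw [← hm]
    rfl

/-- The unique extension of a linear map `M → N` into a complete module to the completion of
`M`. -/
def extendC [IsAdicComplete hI N] (f : M →ₗ[Rh] N) : AdicCompletion hI M →ₗ[Rh] N :=
  (AdicCompletion.ofLinearEquiv hI N).symm.toLinearMap ∘ₗ mapC f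

theorem extendC_of [IsAdicComplete hI N] (f : M →ₗ[Rh] N) (x : M) :
    extendC f (AdicCompletion.of hI M x) = f x := by
  change (AdicCompletion.ofLinearEquiv hI N).symm
    (AdicCompletion.map hI f (AdicCompletion.of hI M x)) = f x
  rw [AdicCompletion.map_of, AdicCompletion.ofLinearEquiv_symm_of]

end Completion

/-! ## Completed tensor products of algebras -/

section CompletionAlgebra

variable (A : Type) [Ring A] [Algebra Rh A]

/-- Multiplication on `A / ħ^n A`. -/
def mulMod (n : ℕ) : (A ⧸ (hI ^ n • ⊤ : Submodule Rh A)) →ₗ[Rh]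
    (A ⧸ (hI ^ n • ⊤ : Submodule Rh A)) →ₗ[Rh] (A ⧸ (hI ^ n • ⊤ : Submodule Rh A)) :=
  Submodule.liftQ _
    { toFun := fun a => Submodule.mapQ _ _ (LinearMap.mulLeft Rh a) (by
        intro b hb
        obtain ⟨z, rfl⟩ := (mem_hI_pow_smul_top n b).mp hb
        exact (mem_hI_pow_smul_top n _).mpr ⟨a * z, by simp⟩)
      map_add' := fun a b => by ext c; simp [add_mul]
      map_smul' := fun a b => by ext c; simp }
    (by
      intro b hb
      obtain ⟨z, rfl⟩ := (mem_hI_pow_smul_top n b).mp hb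
      rw [LinearMap.mem_ker]
      ext c
      simp only [LinearMap.coe_mk, AddHom.coe_mk, LinearMap.coe_comp, Function.comp_apply,
        Submodule.mkQ_apply, Submodule.mapQ_apply, LinearMap.mulLeft_apply, LinearMap.zero_apply]
      rw [Submodule.Quotient.mk_eq_zero]
      exact (mem_hI_pow_smul_top n _).mpr ⟨z * c, by simp⟩)

theorem mulMod_mk (n : ℕ) (a b : A) :
    mulMod A n (Submodule.Quotient.mk a) (Submodule.Quotient.mk b) =
      Submodule.Quotient.mk (a * b) := rfl

theorem transitionMap_mk {m n : ℕ} (hmn : m ≤ n) (a : A) :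
    AdicCompletion.transitionMap hI A hmn (Submodule.Quotient.mk a) =
      Submodule.Quotient.mk a := by
  exact Submodule.factor_mk _ a

variable {A}

/-- Multiplication on the completion, computed modulo every power of `ħ`. -/
def mulC (x y : AdicCompletion hI A) : AdicCompletion hI A :=
  ⟨fun n => mulMod A n (x.val n) (y.val n), by
    intro m n hmn
    obtain ⟨a, ha⟩ := Submodule.Quotient.mk_surjective _ (x.val n)
    obtain ⟨b, hb⟩ := Submodule.Quotient.mk_surjective _ (y.val n)
    change AdicCompletion.transitionMap hI A hmn (mulMod A n (x.val n) (y.val n)) =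
      mulMod A m (x.val m) (y.val m)
    have hx : AdicCompletion.transitionMap hI A hmn (x.val n) = x.val m :=
      AdicCompletion.transitionMap_comp_eval_apply hI A hmn x
    have hy : AdicCompletion.transitionMap hI A hmn (y.val n) = y.val m :=
      AdicCompletion.transitionMap_comp_eval_apply hI A hmn y
    rw [← hx, ← hy, ← ha, ← hb, mulMod_mk, transitionMap_mk, transitionMap_mk, transitionMap_mk,
      mulMod_mk]⟩

theorem mulC_of_of (a b : A) :
    mulC (AdicCompletion.of hI A a) (AdicCompletion.of hI A b) =
      AdicCompletion.of hI A (a * b) :=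
  AdicCompletion.ext fun n => mulMod_mk A n a b

theorem exists_rep (x : AdicCompletion hI A) (n : ℕ) :
    ∃ a : A, x.val n = Submodule.Quotient.mk a :=
  (Submodule.Quotient.mk_surjective _ (x.val n)).imp fun _ h => h.symm

/-- The ring structure on the `ħ`-adic completion of a `ℂ⟦ħ⟧`-algebra. -/
abbrev ringC : Ring (AdicCompletion hI A) :=
  { (inferInstance : AddCommGroup (AdicCompletion hI A)) with
    mul := mulC
    one := AdicCompletion.of hI A 1
    mul_assoc := fun x y z => AdicCompletion.ext fun n => by
      obtain ⟨a, ha⟩ := exists_rep x n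
      obtain ⟨b, hb⟩ := exists_rep y n
      obtain ⟨c, hc⟩ := exists_rep z n
      change mulMod A n (mulMod A n (x.val n) (y.val n)) (z.val n) =
        mulMod A n (x.val n) (mulMod A n (y.val n) (z.val n))
      rw [ha, hb, hc, mulMod_mk, mulMod_mk, mulMod_mk, mulMod_mk, mul_assoc]
    one_mul := fun x => AdicCompletion.ext fun n => by
      obtain ⟨a, ha⟩ := exists_rep x n
      change mulMod A n (Submodule.Quotient.mk 1) (x.val n) = x.val n
      rw [ha, mulMod_mk, one_mul]
    mul_one := fun x => AdicCompletion.ext fun n => by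
      obtain ⟨a, ha⟩ := exists_rep x n
      change mulMod A n (x.val n) (Submodule.Quotient.mk 1) = x.val n
      rw [ha, mulMod_mk, mul_one]
    zero_mul := fun x => AdicCompletion.ext fun n => by
      change mulMod A n 0 (x.val n) = 0
      simp
    mul_zero := fun x => AdicCompletion.ext fun n => by
      change mulMod A n (x.val n) 0 = 0
      simp
    left_distrib := fun x y z => AdicCompletion.ext fun n => by
      change mulMod A n (x.val n) (y.val n + z.val n) =
        mulMod A n (x.val n) (y.val n) + mulMod A n (x.val n) (z.val n)
      simp
    right_distrib := fun x y z => AdicCompletion.ext fun n => by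
      change mulMod A n (x.val n + y.val n) (z.val n) =
        mulMod A n (x.val n) (z.val n) + mulMod A n (y.val n) (z.val n)
      simp }

attribute [local instance] ringC in
/-- The algebra structure on the `ħ`-adic completion of a `ℂ⟦ħ⟧`-algebra. -/
abbrev algebraC : Algebra Rh (AdicCompletion hI A) :=
  { smul := fun c x => c • x
    algebraMap :=
      { toFun := fun c => AdicCompletion.of hI A (algebraMap Rh A c)
        map_one' := congrArg (AdicCompletion.of hI A) (map_one (algebraMap Rh A))
        map_zero' := by simp
        map_mul' := fun c d => by
          rw [map_mul]
          exact (mulC_of_of _ _).symm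
        map_add' := fun c d => by rw [map_add, map_add] }
    commutes' := fun c x => AdicCompletion.ext fun n => by
      obtain ⟨a, ha⟩ := exists_rep x n
      change mulMod A n (Submodule.Quotient.mk (algebraMap Rh A c)) (x.val n) =
        mulMod A n (x.val n) (Submodule.Quotient.mk (algebraMap Rh A c))
      rw [ha, mulMod_mk, mulMod_mk, Algebra.commutes]
    smul_def' := fun c x => AdicCompletion.ext fun n => by
      obtain ⟨a, ha⟩ := exists_rep x n
      change c • x.val n = mulMod A n (Submodule.Quotient.mk (algebraMap Rh A c)) (x.val n)
      rw [ha, mulMod_mk, ← Algebra.smul_def, Submodule.Quotient.mk_smul] }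

variable {B : Type} [Ring B] [Algebra Rh B]

variable (A B) in
/-- The completed tensor product of two `ℂ⟦ħ⟧`-algebras. -/
def CTensor : Type := AdicCompletion hI (A ⊗[Rh] B)

attribute [local instance] ringC algebraC in
instance : Ring (CTensor A B) := inferInstanceAs (Ring (AdicCompletion hI (A ⊗[Rh] B)))

attribute [local instance] ringC algebraC in
instance : Algebra Rh (CTensor A B) :=
  inferInstanceAs (Algebra Rh (AdicCompletion hI (A ⊗[Rh] B)))

variable (A B) in
/-- The module underlying the completed tensor product of algebras is the completion of the
algebraic tensor product. -/
def CTensor.equiv : CTensor A B ≃ₗ[Rh] AdicCompletion hI (A ⊗[Rh] B) :=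
  { Equiv.refl _ with
    map_add' := fun _ _ => rfl
    map_smul' := fun _ _ => rfl }

instance : IsAdicComplete hI (CTensor A B) :=
  AdicCompletion.isAdicComplete (M := A ⊗[Rh] B) hI_fg

/-- The decomposable element `a ⊗ b` of the completed tensor product. -/
def ctmul (a : A) (b : B) : CTensor A B :=
  (CTensor.equiv A B).symm (AdicCompletion.of hI (A ⊗[Rh] B) (a ⊗ₜ[Rh] b))

theorem ctmul_mul_ctmul (a a' : A) (b b' : B) :
    ctmul a b * ctmul a' b' = ctmul (a * a') (b * b') :=
  (mulC_of_of _ _).trans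
    (congrArg (AdicCompletion.of hI (A ⊗[Rh] B)) (Algebra.TensorProduct.tmul_mul_tmul a a' b b'))

theorem ctmul_one_one : (ctmul (1 : A) (1 : B)) = 1 := rfl

variable (A B) in
/-- The algebra homomorphism `a ↦ a ⊗ 1`. -/
def inclL : A →ₐ[Rh] CTensor A B :=
  AlgHom.ofLinearMap
    ((CTensor.equiv A B).symm.toLinearMap ∘ₗ AdicCompletion.of hI (A ⊗[Rh] B) ∘ₗ
      ((TensorProduct.mk Rh A B).flip 1)) rfl
    (fun x y => by
      change ctmul (x * y) (1 : B) = ctmul x 1 * ctmul y 1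
      rw [ctmul_mul_ctmul, one_mul])

variable (A B) in
/-- The algebra homomorphism `b ↦ 1 ⊗ b`. -/
def inclR : B →ₐ[Rh] CTensor A B :=
  AlgHom.ofLinearMap
    ((CTensor.equiv A B).symm.toLinearMap ∘ₗ AdicCompletion.of hI (A ⊗[Rh] B) ∘ₗ
      (TensorProduct.mk Rh A B 1)) rfl
    (fun x y => by
      change ctmul (1 : A) (x * y) = ctmul 1 x * ctmul 1 y
      rw [ctmul_mul_ctmul, one_mul])

/-- The completion `f ⊗ g` of the tensor product of two linear maps. -/
def mapTensor {A' B' : Type} [Ring A'] [Algebra Rh A'] [Ring B'] [Algebra Rh B']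
    (f : A →ₗ[Rh] A') (g : B →ₗ[Rh] B') : CTensor A B →ₗ[Rh] CTensor A' B' :=
  (CTensor.equiv A' B').symm.toLinearMap ∘ₗ mapC (TensorProduct.map f g) ∘ₗ
    (CTensor.equiv A B).toLinearMap

/-- For linear maps `f : A → M`, `g : B → N` and a bilinear map `μ : M × N → P` into a complete
module, the linear map on the completed tensor product with `a ⊗ b ↦ μ (f a) (g b)`. -/
def evalTensor {M N P : Type} [AddCommGroup M] [Module Rh M] [AddCommGroup N] [Module Rh N]
    [AddCommGroup P] [Module Rh P] [IsAdicComplete hI P] (μ : M →ₗ[Rh] N →ₗ[Rh] P)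
    (f : A →ₗ[Rh] M) (g : B →ₗ[Rh] N) : CTensor A B →ₗ[Rh] P :=
  extendC (TensorProduct.lift (μ.compl₁₂ f g)) ∘ₗ (CTensor.equiv A B).toLinearMap

theorem evalTensor_ctmul {M N P : Type} [AddCommGroup M] [Module Rh M] [AddCommGroup N]
    [Module Rh N] [AddCommGroup P] [Module Rh P] [IsAdicComplete hI P]
    (μ : M →ₗ[Rh] N →ₗ[Rh] P) (f : A →ₗ[Rh] M) (g : B →ₗ[Rh] N) (a : A) (b : B) :
    evalTensor μ f g (ctmul a b) = μ (f a) (g b) :=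
  (extendC_of _ _).trans (by simp)

end CompletionAlgebra

/-! ## Completed tensor powers -/

section TensorPowers

variable (M : Type) [AddCommGroup M] [Module Rh M]

/-- The completed `a`-th tensor power of a module. -/
abbrev TPow (a : ℕ) : Type := AdicCompletion hI (TensorPower Rh a M)

variable {M}

/-- The decomposable element `v 0 ⊗ ⋯ ⊗ v (a - 1)` of the completed tensor power. -/
def tpure {a : ℕ} (v : Fin a → M) : TPow M a :=
  AdicCompletion.of hI (TensorPower Rh a M) (PiTensorProduct.tprod Rh v)

variable (M) in
/-- The canonical bilinear map `(t, v) ↦ t ⊗ v` from `M^{⊗ a} × M` to `M^{⊗ (a + 1)}`, on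
completed tensor powers. -/
def snocC (a : ℕ) : TPow M a →ₗ[Rh] M →ₗ[Rh] TPow M (a + 1) :=
  (mapC ∘ₗ (((TensorProduct.mk Rh (TensorPower Rh a M) (TensorPower Rh 1 M)).compr₂
    (TensorPower.mulEquiv (R := Rh) (M := M) (n := a) (m := 1)).toLinearMap).flip ∘ₗ
      (PiTensorProduct.subsingletonEquiv (R := Rh) (s := fun _ : Fin 1 => M)
        (0 : Fin 1)).symm.toLinearMap)).flip

theorem snocC_tpure {a : ℕ} (v : Fin a → M) (w : M) :
    snocC M a (tpure v) w = tpure (Fin.snoc (α := fun _ => M) v w) := by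
  have h : TensorPower.mulEquiv (R := Rh) (M := M) (n := a) (m := 1)
      (PiTensorProduct.tprod Rh v ⊗ₜ[Rh] (PiTensorProduct.subsingletonEquiv (R := Rh)
        (s := fun _ : Fin 1 => M) (0 : Fin 1)).symm w) =
      PiTensorProduct.tprod Rh (Fin.snoc (α := fun _ => M) v w) := by
    have hs : (Fin.snoc (α := fun _ => M) v w : Fin (a + 1) → M) =
        Fin.append v fun _ : Fin 1 => w :=
      (Fin.append_right_eq_snoc v fun _ : Fin 1 => w).symm
    rw [PiTensorProduct.subsingletonEquiv_symm_apply', hs]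
    exact TensorPower.tprod_mul_tprod Rh v fun _ : Fin 1 => w
  refine Eq.trans (AdicCompletion.map_of hI _ _) ?_
  exact congrArg (AdicCompletion.of hI (TensorPower Rh (a + 1) M)) h

end TensorPowers

/-! ## Bialgebras in the completed sense, and their module algebras -/

section Bialgebras

variable {A B S : Type} [Ring A] [Algebra Rh A] [Ring B] [Algebra Rh B] [Ring S] [Algebra Rh S]

/-- The coproduct `a ⊗ b ↦ ∑ (a₁ ⊗ b₁) ⊗ (a₂ ⊗ b₂)` on the completed tensor product of two
algebras with coproducts. -/
def tensorComul (ΔA : A →ₐ[Rh] CTensor A A) (ΔB : B →ₐ[Rh] CTensor B B) :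
    CTensor A B →ₗ[Rh] CTensor (CTensor A B) (CTensor A B) :=
  evalTensor (LinearMap.mul Rh (CTensor (CTensor A B) (CTensor A B)))
    (mapTensor (inclL A B).toLinearMap (inclL A B).toLinearMap ∘ₗ ΔA.toLinearMap)
    (mapTensor (inclR A B).toLinearMap (inclR A B).toLinearMap ∘ₗ ΔB.toLinearMap)

/-- The counit `a ⊗ b ↦ ε(a) ε(b)` on the completed tensor product. -/
def tensorCounit (εA : A →ₐ[Rh] Rh) (εB : B →ₐ[Rh] Rh) : CTensor A B →ₗ[Rh] Rh :=
  evalTensor (LinearMap.mul Rh Rh) εA.toLinearMap εB.toLinearMap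

/-- An action of `A` on the complete algebra `S` makes it a (left) module algebra:
`x (p q) = ∑ (x₁ p) (x₂ q)` and `x 1 = ε(x) 1`. -/
structure IsModuleAlgebra [IsAdicComplete hI S] (Δ : A →ₗ[Rh] CTensor A A) (ε : A →ₗ[Rh] Rh)
    (act : A →ₐ[Rh] Module.End Rh S) : Prop where
  act_mul : ∀ (x : A) (p q : S), act x (p * q) =
    evalTensor (LinearMap.mul Rh S) (act.toLinearMap.flip p) (act.toLinearMap.flip q) (Δ x)
  act_one : ∀ x : A, act x 1 = ε x • 1

/-- `act a` is the action of `A` on the completed tensor power `M^{⊗ a}` obtained from an action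
`β` of `A` on `M` by iterating the coproduct:  `x (t ⊗ v) = ∑ (x₁ t) ⊗ (x₂ v)`, while `A` acts on
`M^{⊗ 0}` through the counit. -/
structure IsTensorPowerAction {M : Type} [AddCommGroup M] [Module Rh M]
    (Δ : A →ₐ[Rh] CTensor A A) (ε : A →ₐ[Rh] Rh) (β : A →ₐ[Rh] Module.End Rh M)
    (act : ∀ a : ℕ, A →ₐ[Rh] Module.End Rh (TPow M a)) : Prop where
  zero : ∀ (x : A) (t : TPow M 0), act 0 x t = ε x • t
  succ : ∀ (a : ℕ) (x : A) (t : TPow M a) (v : M), act (a + 1) x (snocC M a t v) =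
    evalTensor (snocC M a) ((act a).toLinearMap.flip t) (β.toLinearMap.flip v) (Δ x)

end Bialgebras

/-! ## The quantum group `U_ħ gl_p` -/

/-- The generators `E_i, F_i` (`i = 1, …, p - 1`) and `D_i` (`i = 1, …, p`) of `U_ħ gl_p`. -/
inductive GlGen (p : ℕ) : Type
  | E (i : Fin (p - 1))
  | F (i : Fin (p - 1))
  | D (i : Fin p)

/-- The index `i`, for a node `i` of the Dynkin diagram. -/
def lo {p : ℕ} (i : Fin (p - 1)) : Fin p := ⟨i, by omega⟩

/-- The index `i + 1`, for a node `i` of the Dynkin diagram. -/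
def up {p : ℕ} (i : Fin (p - 1)) : Fin p := ⟨i + 1, by omega⟩

/-- The Cartan matrix of type `A_{p-1}`. -/
def cartan {p : ℕ} (i j : Fin (p - 1)) : ℤ :=
  if i = j then 2 else if (i : ℕ) + 1 = j ∨ (j : ℕ) + 1 = i then -1 else 0

/-- `H_i = D_i - D_{i+1}` in the free algebra. -/
def freeH {p : ℕ} (i : Fin (p - 1)) : FreeAlgebra ℂ (GlGen p) :=
  FreeAlgebra.ι ℂ (GlGen.D (lo i)) - FreeAlgebra.ι ℂ (GlGen.D (up i))

/-- `∑_{r=0}^{N} (-1)^r [N choose r] x^r y x^{N-r}`. -/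
def qSerre {p : ℕ} (N : ℕ) (x y : FreeSeries (GlGen p)) : FreeSeries (GlGen p) :=
  ∑ r ∈ Finset.range (N + 1), ((-1) ^ r * qBinom N r) • (x ^ r * y * x ^ (N - r))

/-- The defining relators of `U_ħ gl_p`. -/
inductive GlRel (p : ℕ) : FreeSeries (GlGen p) → Prop
  | DD (i j : Fin p) :
      GlRel p (FreeSeries.gen (.D i) * FreeSeries.gen (.D j) - FreeSeries.gen (.D j) * FreeSeries.gen (.D i))
  | DE (i : Fin p) (j : Fin (p - 1)) :
      GlRel p (FreeSeries.gen (.D i) * FreeSeries.gen (.E j) - FreeSeries.gen (.E j) * FreeSeries.gen (.D i) -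
        (((if i = lo j then 1 else 0) - (if i = up j then 1 else 0) : Rh)) • FreeSeries.gen (.E j))
  | DF (i : Fin p) (j : Fin (p - 1)) :
      GlRel p (FreeSeries.gen (.D i) * FreeSeries.gen (.F j) - FreeSeries.gen (.F j) * FreeSeries.gen (.D i) +
        (((if i = lo j then 1 else 0) - (if i = up j then 1 else 0) : Rh)) • FreeSeries.gen (.F j))
  | EF (i j : Fin (p - 1)) :
      GlRel p (FreeSeries.gen (.E i) * FreeSeries.gen (.F j) - FreeSeries.gen (.F j) * FreeSeries.gen (.E i) -
        if i = j then FreeSeries.ofSeries (qBracket (freeH i)) else 0)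
  | EE (i j : Fin (p - 1)) (h : i ≠ j) :
      GlRel p (qSerre (1 - cartan i j).toNat (FreeSeries.gen (.E i)) (FreeSeries.gen (.E j)))
  | FF (i j : Fin (p - 1)) (h : i ≠ j) :
      GlRel p (qSerre (1 - cartan i j).toNat (FreeSeries.gen (.F i)) (FreeSeries.gen (.F j)))

/-- The Drinfeld-Jimbo quantum group `U_ħ gl_p`. -/
abbrev Uh (p : ℕ) : Type := PresAlg {x | GlRel p x}

namespace Uh

variable {p : ℕ}

/-- The generator `E_i`. -/
def E (i : Fin (p - 1)) : Uh p := PresAlg.gen _ (GlGen.E i)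

/-- The generator `F_i`. -/
def F (i : Fin (p - 1)) : Uh p := PresAlg.gen _ (GlGen.F i)

/-- The generator `D_i`. -/
def D (i : Fin p) : Uh p := PresAlg.gen _ (GlGen.D i)

/-- `e^{ħ H_i}`. -/
def K (i : Fin (p - 1)) : Uh p := PresAlg.mk _ (FreeSeries.ofSeries (expH (freeH i)))

/-- `e^{-ħ H_i}`. -/
def Kinv (i : Fin (p - 1)) : Uh p := PresAlg.mk _ (FreeSeries.ofSeries (expH (-freeH i)))

end Uh

/-- `Δ` is the coproduct of `U_ħ gl_p`. -/
structure IsCoproduct {p : ℕ} (Δ : Uh p →ₐ[Rh] CTensor (Uh p) (Uh p)) : Prop where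
  D : ∀ i, Δ (Uh.D i) = ctmul (Uh.D i) 1 + ctmul 1 (Uh.D i)
  E : ∀ i, Δ (Uh.E i) = ctmul (Uh.E i) (Uh.K i) + ctmul 1 (Uh.E i)
  F : ∀ i, Δ (Uh.F i) = ctmul (Uh.F i) 1 + ctmul (Uh.Kinv i) (Uh.F i)

/-- `ε` is the counit of `U_ħ gl_p`. -/
structure IsCounit {p : ℕ} (ε : Uh p →ₐ[Rh] Rh) : Prop where
  D : ∀ i, ε (Uh.D i) = 0
  E : ∀ i, ε (Uh.E i) = 0
  F : ∀ i, ε (Uh.F i) = 0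

/-- `ρ` is the vector representation of `U_ħ gl_p` on `ℂ^p⟦ħ⟧`. -/
structure IsVectorRep {p : ℕ} (ρ : Uh p →ₐ[Rh] Matrix (Fin p) (Fin p) Rh) : Prop where
  D : ∀ i, ρ (Uh.D i) = Matrix.single i i 1
  E : ∀ i, ρ (Uh.E i) = Matrix.single (lo i) (up i) 1
  F : ∀ i, ρ (Uh.F i) = Matrix.single (up i) (lo i) 1

/-! ## Functions on quantum matrix space -/

/-- The defining relators of the algebra of functions on quantum `k × n` matrices. -/
inductive MatRel (k n : ℕ) : FreeSeries (Fin k × Fin n) → Prop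
  | comm (i a : Fin k) (j b : Fin n) (h : (i < a ∧ b < j) ∨ (a < i ∧ j < b)) :
      MatRel k n (FreeSeries.gen (i, j) * FreeSeries.gen (a, b) - FreeSeries.gen (a, b) * FreeSeries.gen (i, j))
  | qcomm (i a : Fin k) (j b : Fin n) (h : (i < a ∧ b = j) ∨ (a = i ∧ j < b)) :
      MatRel k n (FreeSeries.gen (i, j) * FreeSeries.gen (a, b) - (expH (-1 : ℂ) : Rh) • (FreeSeries.gen (a, b) * FreeSeries.gen (i, j)))
  | cross (i a : Fin k) (j b : Fin n) (h : i < a ∧ j < b) :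
      MatRel k n (FreeSeries.gen (i, j) * FreeSeries.gen (a, b) - (FreeSeries.gen (a, b) * FreeSeries.gen (i, j) -
        (expH (1 : ℂ) - expH (-1 : ℂ) : Rh) • (FreeSeries.gen (a, j) * FreeSeries.gen (i, b))))

/-- The algebra of functions on quantum `k × n` matrix space. -/
abbrev Sh (k n : ℕ) : Type := PresAlg {x | MatRel k n x}

namespace Sh

variable {k n : ℕ}

/-- The generator `X_{ij}`. -/
def X (i : Fin k) (j : Fin n) : Sh k n := PresAlg.gen _ (i, j)

variable (k n) in
/-- The homogeneous component of degree `d`: the span of the products of `d` generators. -/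
def homog (d : ℕ) : Submodule Rh (Sh k n) :=
  Submodule.span Rh (Set.range fun e : Fin k × Fin n => X e.1 e.2) ^ d

/-- The monomial `X^m`, the product of the `X_{ij}^{m_{ij}}` taken column by column. -/
def monomial (m : Matrix (Fin k) (Fin n) ℕ) : Sh k n :=
  (List.ofFn fun j => (List.ofFn fun i => X i j ^ m i j).prod).prod

theorem rel {r : FreeSeries (Fin k × Fin n)} (h : MatRel k n r) :
    PresAlg.mk {x | MatRel k n x} r = 0 :=
  (PresAlg.mk_eq_zero_iff _ _).mpr (subset_closedIdeal _ h)

/-- The transposition `X_{ij} ↦ X_{ji}`. -/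
def transpose (k n : ℕ) : Sh k n →ₐ[Rh] Sh n k :=
  PresAlg.map Prod.swap (by
    intro r hr
    cases hr with
    | comm i a j b h =>
      have := rel (MatRel.comm j b i a (by tauto))
      simpa [FreeSeries.map_gen] using this
    | qcomm i a j b h =>
      have := rel (MatRel.qcomm j b i a (by tauto))
      simpa [FreeSeries.map_gen] using this
    | cross i a j b h =>
      have h1 := rel (MatRel.cross j b i a h.symm)
      have h2 := rel (MatRel.comm j b a i (Or.inl h.symm))
      simp only [map_sub, map_mul, map_smul, FreeSeries.map_gen, Prod.swap_prod_mk] at h1 h2 ⊢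
      rw [sub_eq_zero] at h2
      rw [h2]
      exact h1)

/-- The inclusion `X_{i1} ↦ X_{ij}` of the `j`-th column. -/
def col (k : ℕ) {n : ℕ} (j : Fin n) : Sh k 1 →ₐ[Rh] Sh k n :=
  PresAlg.map (fun e => (e.1, j)) (by
    intro r hr
    cases hr with
    | comm i a j' b h => exact absurd h (by omega)
    | qcomm i a j' b h =>
      have := rel (MatRel.qcomm i a j j (Or.inl ⟨by omega, rfl⟩))
      simpa [FreeSeries.map_gen] using this
    | cross i a j' b h => exact absurd h (by omega))

/-- The inclusion `X_{1j} ↦ X_{ij}` of the `i`-th row. -/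
def row {k : ℕ} (n : ℕ) (i : Fin k) : Sh 1 n →ₐ[Rh] Sh k n :=
  PresAlg.map (fun e => (i, e.2)) (by
    intro r hr
    cases hr with
    | comm i' a j b h => exact absurd h (by omega)
    | qcomm i' a j b h =>
      have := rel (MatRel.qcomm i i j b (Or.inr ⟨rfl, by omega⟩))
      simpa [FreeSeries.map_gen] using this
    | cross i' a j b h => exact absurd h (by omega))

/-- The map `Φ : p₁ ⊗ ⋯ ⊗ pₙ ↦ c₁(p₁) ⋯ cₙ(pₙ)`. -/
def Phi (k n : ℕ) : TPow (Sh k 1) n →ₗ[Rh] Sh k n :=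
  extendC (PiTensorProduct.lift ((MultilinearMap.mkPiAlgebraFin Rh n (Sh k n)).compLinearMap
    fun j => (col k j).toLinearMap))

/-- The map `Ψ : q₁ ⊗ ⋯ ⊗ q_k ↦ r₁(q₁) ⋯ r_k(q_k)`. -/
def Psi (k n : ℕ) : TPow (Sh 1 n) k →ₗ[Rh] Sh k n :=
  extendC (PiTensorProduct.lift ((MultilinearMap.mkPiAlgebraFin Rh k (Sh k n)).compLinearMap
    fun i => (row n i).toLinearMap))

/-- The homogeneous component of degree `d` of the completed tensor power `Sh(k,n)^{⊗ a}`. -/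
def tensorHomog (k n a d : ℕ) : Submodule Rh (TPow (Sh k n) a) :=
  Submodule.span Rh {t | ∃ (e : Fin a → ℕ) (v : Fin a → Sh k n),
    ∑ j, e j = d ∧ (∀ j, v j ∈ homog k n (e j)) ∧ t = tpure v}

end Sh

/-- `δ` is the algebra homomorphism `Δ_{kln} : X_{ij} ↦ ∑_{l'} X_{il'} ⊗ X_{l'j}`. -/
def IsMatCoproduct {k l n : ℕ} (δ : Sh k n →ₐ[Rh] CTensor (Sh k l) (Sh l n)) : Prop :=
  ∀ i j, δ (Sh.X i j) = ∑ a : Fin l, ctmul (Sh.X i a) (Sh.X a j)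

/-- `η` is the counit `X_{ij} ↦ δ_{ij}` of `Sh(p,p)`. -/
def IsMatCounit {p : ℕ} (η : Sh p p →ₐ[Rh] Rh) : Prop :=
  ∀ i j, η (Sh.X i j) = if i = j then 1 else 0

/-- `κ : Sh(p,p) → (U_ħ gl_p)^*` is the bialgebra morphism sending `X_{ij}` to the matrix
coefficient `t_{ij}` of the vector representation `ρ`.  Here `(Δ, ε)` and `(δ, η)` are the coproduct
and counit of `U_ħ gl_p` and of `Sh(p,p)`; the product on the dual is the one dual to `Δ`. -/
structure IsKappa {p : ℕ} (Δ : Uh p →ₐ[Rh] CTensor (Uh p) (Uh p)) (ε : Uh p →ₐ[Rh] Rh)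
    (ρ : Uh p →ₐ[Rh] Matrix (Fin p) (Fin p) Rh) (δ : Sh p p →ₐ[Rh] CTensor (Sh p p) (Sh p p))
    (η : Sh p p →ₐ[Rh] Rh) (κ : Sh p p →ₗ[Rh] Module.Dual Rh (Uh p)) : Prop where
  gen : ∀ (i j : Fin p) (x : Uh p), κ (Sh.X i j) x = ρ x i j
  mul : ∀ (f g : Sh p p) (x : Uh p),
    κ (f * g) x = evalTensor (LinearMap.mul Rh Rh) (κ f) (κ g) (Δ x)
  one : ∀ x : Uh p, κ 1 x = ε x
  comul : ∀ (f : Sh p p) (x y : Uh p),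
    κ f (x * y) = evalTensor (LinearMap.mul Rh Rh) (κ.flip x) (κ.flip y) (δ f)
  counit : ∀ f : Sh p p, κ f 1 = η f

/-- `⟨x ⊗ 1, (τ ⊗ 1) Δ_{kkn}(f)⟩`, for `x ∈ U_ħ gl_k` and `f ∈ Sh(k,n)`. -/
def leftPairing {k n : ℕ} (κ : Sh k k →ₗ[Rh] Module.Dual Rh (Uh k))
    (δ : Sh k n →ₐ[Rh] CTensor (Sh k k) (Sh k n)) (x : Uh k) (f : Sh k n) : Sh k n :=
  evalTensor (LinearMap.lsmul Rh (Sh k n))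
    (κ.flip x ∘ₗ (Sh.transpose k k).toLinearMap) LinearMap.id (δ f)

/-- `⟨1 ⊗ y, Δ_{knn}(f)⟩`, for `y ∈ U_ħ gl_n` and `f ∈ Sh(k,n)`. -/
def rightPairing {k n : ℕ} (κ : Sh n n →ₗ[Rh] Module.Dual Rh (Uh n))
    (δ : Sh k n →ₐ[Rh] CTensor (Sh k n) (Sh n n)) (y : Uh n) (f : Sh k n) : Sh k n :=
  evalTensor (LinearMap.lsmul Rh (Sh k n)).flip LinearMap.id (κ.flip y) (δ f)

end QHowe

end

open QHowe

/-!
The proof rests on a uniform description of homomorphisms out of the quantum matrix algebras, and on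
a basis of monomials for them.

**Homomorphisms.** The relations of `S_ħ(k,n)` say that the matrix `X` satisfies the `RTT` relations
`X₁ X₂ R = R X₁ X₂` (`RTT`, `RTT.of_relations`), so that an `RTT` matrix with entries in a complete
algebra defines a homomorphism (`Sh.lift`). Products of `RTT` matrices with mutually commuting
entries are `RTT` matrices (`RTT.mul`); this gives `Δ_{kln}`. The `R`-matrix intertwines the tensor
square of the vector representation of `U_ħ gl_p` (`vectorRep2_commute`), hence the matrix
coefficients `t_{ij}` form an `RTT` matrix in the convolution algebra `Hom(U_ħ gl_p, ℂ⟦ħ⟧)`, and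
`κ_p` exists. The coproduct of `U_ħ gl_p` respects the `q`-Serre relations by `serre_two_add`.

**Actions.** The action of `U_ħ gl_n` is a homomorphism `coactR` from `S_ħ(k,n)` to the convolution
algebra `Hom(U_ħ gl_n, S_ħ(k,n))`. Being multiplicative is the module algebra property, and the
associativity of the action and the compatibility of `κ` with the coproducts are then checked on
generators (`coactR_lin_mul`, `kappaDual_eq_counit_actR`). The action of `U_ħ gl_k` is the one of the
transposed matrix algebra (`leftPairing_eq`), and the two commute because they take place on the two
sides of `Δ_{kkn}` (`actL_actR`).

**Monomials.** Modulo `ħ` the algebra `S_ħ(k,n)` is commutative, so Nakayama's lemma shows that the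
monomials of degree `d` span the component of degree `d` (`homog_eq_span`), and a successive
approximation shows that all monomials span a dense subspace (`monomial_induction`). Their
independence is proved by induction on the number `n` of columns. In `S_ħ(k,n+1)` one has
`X_{i,n+1} f = ∑_c σ(f)_{ic} X_{c,n+1}` for a homomorphism `σ` from `S_ħ(k,n)` to matrices over
`S_ħ(k,n)`, which exists because the `L`-operator `Smat` is an `RTT` matrix. Conversely, the
operators `f ↦ σ(f)_{ic}` form an `RTT` matrix (`rtt_Lop`), so `σ` can be used to define a
representation `extRep` of `S_ħ(k,n+1)` on the space of functions `(Fin k → ℕ) → S_ħ(k,n)`, which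
stand for series `∑ φ(m) X_{n+1}^m`. Applying a monomial to the function that represents `1` yields
its exponents (`exists_coeff`).

**The maps `Φ` and `Ψ`.** `Φ` takes tensor products of monomials bijectively to monomials, so it is
bijective by density and independence. The tensor power action is obtained by transporting the
action along `Φ`: its defining recursion is the module algebra property
(`isTensorPowerAction_conj`). Everything about `Ψ` follows by transposition (`transpose_Psi`).

**Formulas.** The generators act by derivations and skew derivations, so their values on ordered
products are given by an iterated Leibniz rule (`skew_prod_right`, `skew_prod_left`). For the right
action it is applied to the monomials in their row-by-row form (`monomial_eq_row`), and the formulas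
for the left action follow by transposition (`transpose_monomial`).
-/

noncomputable section

namespace QHowe

/-! ### Complete modules and convergent series -/

section Tools

variable {M N P : Type} [AddCommGroup M] [Module Rh M] [AddCommGroup N] [Module Rh N]
  [AddCommGroup P] [Module Rh P]

theorem eq_zero_of_forall_hbar_pow [IsHausdorff hI N] {x : N}
    (h : ∀ n : ℕ, ∃ z : N, x = hbar ^ n • z) : x = 0 :=
  IsHausdorff.haus (I := hI) inferInstance x fun n =>
    SModEq.zero.mpr ((mem_hI_pow_smul_top n x).mpr (h n))

/-- In a separated module, a sequence with `D M = ħ D (M + 1)` vanishes.  All uniqueness statements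
about convergent series reduce to this. -/
theorem telescope_eq_zero [IsHausdorff hI N] (D : ℕ → N) (h : ∀ m, D m = hbar • D (m + 1)) :
    D 0 = 0 := by
  have : ∀ n, D 0 = hbar ^ n • D n := by
    intro n
    induction n with
    | zero => simp
    | succ n ih => rw [ih, h n, smul_smul, pow_succ]
  exact eq_zero_of_forall_hbar_pow fun n => ⟨_, this n⟩

theorem telescope_unique [IsHausdorff hI N] {w S T : ℕ → N} (hS : ∀ m, S m = w m + hbar • S (m + 1))
    (hT : ∀ m, T m = w m + hbar • T (m + 1)) (m : ℕ) : S m = T m := by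
  have := telescope_eq_zero (fun i => S (m + i) - T (m + i)) fun i => by
    rw [hS, hT, add_sub_add_left_eq_sub, smul_sub, add_assoc]
  simpa [sub_eq_zero] using this

theorem exists_telescope [IsAdicComplete hI N] (w : ℕ → N) :
    ∃ S : ℕ → N, ∀ m, S m = w m + hbar • S (m + 1) := by
  have key : ∀ m, ∃ L : N, ∀ n, ∃ z : N,
      L - ∑ i ∈ Finset.range n, hbar ^ i • w (m + i) = hbar ^ n • z := by
    intro m
    obtain ⟨L, hL⟩ := IsPrecomplete.prec' (I := hI) (M := N)
      (fun n => ∑ i ∈ Finset.range n, hbar ^ i • w (m + i)) (by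
        intro a b hab
        rw [SModEq.comm, SModEq.sub_mem, mem_hI_pow_smul_top]
        obtain ⟨c, rfl⟩ := Nat.exists_eq_add_of_le hab
        refine ⟨∑ i ∈ Finset.range c, hbar ^ i • w (m + (a + i)), ?_⟩
        rw [Finset.sum_range_add, add_sub_cancel_left, Finset.smul_sum]
        exact Finset.sum_congr rfl fun i _ => by rw [smul_smul, pow_add])
    refine ⟨L, fun n => ?_⟩
    have := hL n
    rw [SModEq.comm, SModEq.sub_mem, mem_hI_pow_smul_top] at this
    exact this
  choose S hS using key
  refine ⟨S, fun m => sub_eq_zero.mp (eq_zero_of_forall_hbar_pow fun n => ?_)⟩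
  obtain ⟨z, hz⟩ := hS m (n + 1)
  obtain ⟨z', hz'⟩ := hS (m + 1) n
  refine ⟨hbar • z - hbar • z', ?_⟩
  rw [sub_eq_iff_eq_add] at hz hz'
  rw [hz, hz', Finset.sum_range_succ', smul_add, Finset.smul_sum]
  have : ∀ i, hbar ^ (i + 1) • w (m + (i + 1)) = hbar • hbar ^ i • w (m + 1 + i) := fun i => by
    rw [smul_smul, pow_succ', add_comm i 1, add_assoc]
  rw [Finset.sum_congr rfl fun i _ => this i, pow_zero, one_smul, add_zero, smul_sub,
    smul_comm (hbar ^ n) hbar z, smul_comm (hbar ^ n) hbar z', pow_succ', mul_smul]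
  abel

/-- The sum `∑ᵣ ħ^r w_r` of a series in a complete module. -/
def hsum [IsAdicComplete hI N] : (ℕ → N) →ₗ[Rh] N where
  toFun w := (exists_telescope w).choose 0
  map_add' w v := telescope_unique (w := w + v) (exists_telescope (w + v)).choose_spec
    (T := fun m => (exists_telescope w).choose m + (exists_telescope v).choose m) (fun m => by
      nth_rw 1 [(exists_telescope w).choose_spec m, (exists_telescope v).choose_spec m]
      rw [smul_add, Pi.add_apply]; abel) 0
  map_smul' c w := telescope_unique (w := c • w) (exists_telescope (c • w)).choose_spec
    (T := fun m => c • (exists_telescope w).choose m) (fun m => by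
      nth_rw 1 [(exists_telescope w).choose_spec m]
      rw [smul_add, smul_comm c hbar, Pi.smul_apply]) 0

theorem hsum_eq_of_telescope [IsAdicComplete hI N] {w S : ℕ → N}
    (hS : ∀ m, S m = w m + hbar • S (m + 1)) : hsum w = S 0 :=
  telescope_unique (exists_telescope w).choose_spec hS 0

theorem hsum_succ [IsAdicComplete hI N] (w : ℕ → N) :
    hsum w = w 0 + hbar • hsum fun r => w (r + 1) := by
  have h := (exists_telescope w).choose_spec
  rw [hsum_eq_of_telescope h,
    hsum_eq_of_telescope (S := fun m => (exists_telescope w).choose (m + 1)) fun m => h (m + 1)]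
  exact h 0

theorem map_hsum [IsAdicComplete hI N] [IsAdicComplete hI P] (L : N →ₗ[Rh] P) (w : ℕ → N) :
    L (hsum w) = hsum fun r => L (w r) := by
  have h := (exists_telescope w).choose_spec
  rw [hsum_eq_of_telescope h]
  refine (hsum_eq_of_telescope (S := fun m => L ((exists_telescope w).choose m)) fun m => ?_).symm
  nth_rw 1 [h m]
  rw [map_add, map_smul]

/-- Completeness amounts to separatedness and the solvability of the telescoping recursions. -/
theorem isAdicComplete_of_telescope
    (h1 : ∀ x : N, (∀ n : ℕ, ∃ z : N, x = hbar ^ n • z) → x = 0)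
    (h2 : ∀ w : ℕ → N, ∃ S : ℕ → N, ∀ m, S m = w m + hbar • S (m + 1)) : IsAdicComplete hI N where
  haus' x hx := h1 x fun n => (mem_hI_pow_smul_top n x).mp (SModEq.zero.mp (hx n))
  prec' f hf := by
    have h : ∀ n, ∃ w : N, f (n + 1) - f n = hbar ^ n • w := fun n =>
      (mem_hI_pow_smul_top n _).mp (SModEq.sub_mem.mp (hf (Nat.le_succ n)).symm)
    choose w hw using h
    obtain ⟨S, hS⟩ := h2 w
    have : ∀ n, f 0 + S 0 - f n = hbar ^ n • S n := by
      intro n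
      induction n with
      | zero => simp
      | succ n ih =>
        rw [hS n, smul_add, ← hw, smul_smul, ← pow_succ] at ih
        rw [← sub_eq_iff_eq_add'.mpr ih]; abel
    exact ⟨f 0 + S 0, fun n => SModEq.symm (SModEq.sub_mem.mpr
      ((mem_hI_pow_smul_top n _).mpr ⟨_, this n⟩))⟩

instance isAdicComplete_linearMap [IsAdicComplete hI N] : IsAdicComplete hI (M →ₗ[Rh] N) := by
  refine isAdicComplete_of_telescope (fun f hf => LinearMap.ext fun x =>
    eq_zero_of_forall_hbar_pow fun n => ?_) fun w => ?_
  · obtain ⟨z, rfl⟩ := hf n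
    exact ⟨z x, rfl⟩
  · refine ⟨fun m => hsum ∘ₗ LinearMap.pi fun r => w (m + r), fun m => LinearMap.ext fun x => ?_⟩
    simp only [LinearMap.comp_apply, LinearMap.add_apply, LinearMap.smul_apply]
    rw [hsum_succ]
    simp only [LinearMap.pi_apply, add_zero, add_assoc, add_comm 1]
    rfl

instance isAdicComplete_pi {ι : Type} {F : ι → Type} [∀ i, AddCommGroup (F i)]
    [∀ i, Module Rh (F i)] [∀ i, IsAdicComplete hI (F i)] : IsAdicComplete hI (∀ i, F i) := by
  refine isAdicComplete_of_telescope (fun f hf => funext fun i =>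
    eq_zero_of_forall_hbar_pow fun n => ?_) fun w => ?_
  · obtain ⟨z, rfl⟩ := hf n
    exact ⟨z i, rfl⟩
  · choose S hS using fun i => exists_telescope fun m => w m i
    exact ⟨fun m i => S i m, fun m => funext fun i => hS i m⟩

instance isAdicComplete_matrix {m n : Type} [IsAdicComplete hI N] :
    IsAdicComplete hI (Matrix m n N) :=
  inferInstanceAs (IsAdicComplete hI (m → n → N))

/-- A linear map of complete modules which is surjective modulo `ħ` is surjective: preimages are
obtained by successive approximation. -/
theorem surjective_of_surjective_mod [IsAdicComplete hI M] [IsHausdorff hI N] (f : M →ₗ[Rh] N)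
    (h : ∀ y : N, ∃ x z, y = f x + hbar • z) : Function.Surjective f := by
  intro y
  choose g e hge using h
  let Y : ℕ → N := fun n => Nat.rec y (fun _ z => e z) n
  have hY : ∀ n, Y (n + 1) = e (Y n) := fun n => rfl
  obtain ⟨S, hS⟩ := exists_telescope fun n => g (Y n)
  refine ⟨S 0, sub_eq_zero.mp (telescope_eq_zero (fun n => f (S n) - Y n) fun n => ?_)⟩
  have h1 : f (S n) = f (g (Y n)) + hbar • f (S (n + 1)) := by rw [← map_smul, ← map_add, ← hS]
  have h2 : Y n = f (g (Y n)) + hbar • Y (n + 1) := by rw [hY]; exact hge (Y n)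
  refine (congrArg₂ (· - ·) h1 h2).trans ?_
  simp only [add_sub_add_left_eq_sub, smul_sub]

/-- A submodule which is closed in the `ħ`-adic topology. -/
def IsClosedSub (S : Submodule Rh N) : Prop :=
  ∀ x : N, (∀ n : ℕ, ∃ z : N, x - hbar ^ n • z ∈ S) → x ∈ S

theorem isClosedSub_eqLocus [IsHausdorff hI P] (f g : N →ₗ[Rh] P) :
    IsClosedSub (LinearMap.eqLocus f g) := by
  intro x hx
  rw [LinearMap.mem_eqLocus, ← sub_eq_zero]
  refine eq_zero_of_forall_hbar_pow fun n => ?_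
  obtain ⟨z, hz⟩ := hx n
  refine ⟨f z - g z, ?_⟩
  rw [LinearMap.mem_eqLocus, map_sub, map_sub, map_smul, map_smul] at hz
  rw [smul_sub]
  exact sub_eq_sub_iff_sub_eq_sub.mp hz

theorem IsClosedSub.comap {S : Submodule Rh P} (hS : IsClosedSub S) (f : N →ₗ[Rh] P) :
    IsClosedSub (S.comap f) := by
  intro x hx
  refine hS _ fun n => ?_
  obtain ⟨z, hz⟩ := hx n
  exact ⟨f z, by simpa using hz⟩

theorem isClosedSub_iInf {ι : Sort*} {S : ι → Submodule Rh N} (hS : ∀ i, IsClosedSub (S i)) :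
    IsClosedSub (⨅ i, S i) := by
  intro x hx
  rw [Submodule.mem_iInf]
  refine fun i => hS i x fun n => ?_
  obtain ⟨z, hz⟩ := hx n
  exact ⟨z, (Submodule.mem_iInf _).mp hz i⟩

theorem AdicCompletion.exists_sub_of_eq (x : AdicCompletion hI M) (n : ℕ) :
    ∃ (a : M) (z : AdicCompletion hI M), x = AdicCompletion.of hI M a + hbar ^ n • z := by
  obtain ⟨a, ha⟩ := Submodule.Quotient.mk_surjective _ (x.val n)
  have : x - AdicCompletion.of hI M a ∈ (AdicCompletion.eval hI M n).ker := by
    rw [LinearMap.mem_ker, map_sub, sub_eq_zero]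
    exact ha.symm
  rw [← AdicCompletion.pow_smul_top_eq_ker_eval hI_fg, mem_hI_pow_smul_top] at this
  obtain ⟨z, hz⟩ := this
  exact ⟨a, z, by rw [← hz]; abel⟩

end Tools

/-! ### Evaluating series with coefficients in a complete algebra -/

section Eval

variable {B C : Type} [Ring B] [Algebra Rh B] [IsAdicComplete hI B]
  [Ring C] [Algebra Rh C] [IsAdicComplete hI C]

/-- A complete `ℂ⟦ħ⟧`-algebra as a `ℂ`-algebra. -/
abbrev complexAlgebra (B : Type) [Ring B] [Algebra Rh B] : Algebra ℂ B :=
  Algebra.compHom B (PowerSeries.C (R := ℂ))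

/-- Evaluation at `ħ` is multiplicative: the defect `ev (F m * g) - ev (F m) * ev g`, where `F m` is
`f` shifted down by `m`, telescopes. -/
theorem hsum_coeff_mul (f g : PowerSeries B) :
    hsum (fun r => PowerSeries.coeff r (f * g)) =
      hsum (fun r => PowerSeries.coeff r f) * hsum (fun r => PowerSeries.coeff r g) := by
  let F : ℕ → PowerSeries B := fun m => PowerSeries.mk fun r => PowerSeries.coeff (m + r) f
  let ev : PowerSeries B → B := fun h => hsum fun r => PowerSeries.coeff r h
  have hF : ∀ m, F m = PowerSeries.C (PowerSeries.coeff m f) + PowerSeries.X * F (m + 1) := by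
    intro m
    ext r
    cases r with
    | zero => simp [F]
    | succ r =>
      rw [map_add, PowerSeries.coeff_succ_X_mul, PowerSeries.coeff_C]
      simp [F, add_assoc, add_comm 1 r]
  have hadd : ∀ a b, ev (a + b) = ev a + ev b := fun a b => by
    change hsum _ = hsum _ + hsum _
    rw [← map_add]; rfl
  have hX : ∀ h, ev (PowerSeries.X * h) = hbar • ev h := fun h => by
    change hsum _ = _
    rw [hsum_succ]
    simp [PowerSeries.coeff_succ_X_mul, ev]
  have hC : ∀ b h, ev (PowerSeries.C b * h) = b * ev h := fun b h => by
    change hsum _ = LinearMap.mulLeft Rh b (hsum _)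
    rw [map_hsum]
    simp
  have hC' : ∀ b, ev (PowerSeries.C b) = b := fun b => by
    change hsum _ = _
    rw [hsum_succ]
    have : (fun r => PowerSeries.coeff (r + 1) (PowerSeries.C b)) = (0 : ℕ → B) := by
      funext r; simp
    rw [this, map_zero, smul_zero, add_zero]; simp
  have := telescope_eq_zero (fun m => ev (F m * g) - ev (F m) * ev g) fun m => by
    nth_rw 1 2 [hF m]
    rw [add_mul, hadd, hadd, mul_assoc, hX, hX, hC, hC', add_mul, smul_mul_assoc,
      add_sub_add_left_eq_sub, smul_sub]
  rw [sub_eq_zero] at this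
  have h0 : F 0 = f := by ext r; simp [F]
  rwa [h0] at this

/-- The evaluation `∑ᵣ b_r X^r ↦ ∑ᵣ ħ^r b_r` of power series over a complete algebra. -/
def evH (B : Type) [Ring B] [Algebra Rh B] [IsAdicComplete hI B] : PowerSeries B →+* B where
  toFun f := hsum fun r => PowerSeries.coeff r f
  map_zero' := by
    have : (fun r => PowerSeries.coeff r (0 : PowerSeries B)) = (0 : ℕ → B) := by funext r; simp
    rw [this, map_zero]
  map_one' := by
    have : (fun r => PowerSeries.coeff (r + 1) (1 : PowerSeries B)) = (0 : ℕ → B) := by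
      funext r; simp [PowerSeries.coeff_one]
    rw [hsum_succ, this]; simp
  map_add' f g := by
    rw [← map_add]; rfl
  map_mul' := hsum_coeff_mul

theorem evH_apply (f : PowerSeries B) : evH B f = hsum fun r => PowerSeries.coeff r f := rfl

theorem evH_C (b : B) : evH B (PowerSeries.C b) = b := by
  have : (fun r => PowerSeries.coeff (r + 1) (PowerSeries.C b)) = (0 : ℕ → B) := by
    funext r; simp
  rw [evH_apply, hsum_succ, this]; simp

theorem hsum_C_coeff (c : Rh) :
    hsum (fun r => PowerSeries.C (PowerSeries.coeff r c) : ℕ → Rh) = c := by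
  rw [hsum_eq_of_telescope (S := fun m => PowerSeries.mk fun r => PowerSeries.coeff (m + r) c)]
  · ext r; simp
  · intro m
    ext r
    cases r with
    | zero => simp
    | succ r => simp [PowerSeries.coeff_succ_X_mul, add_assoc, add_comm 1 r]

/-- Evaluation of a series with scalar coefficients, through a linear map. -/
theorem map_evH_of_coeff {M : Type} [AddCommGroup M] [Module Rh M] [IsAdicComplete hI M]
    (L : B →ₗ[Rh] M) (f : PowerSeries B) (c : Rh) (v : M)
    (h : ∀ r, L (PowerSeries.coeff r f) = PowerSeries.C (PowerSeries.coeff r c) • v) :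
    L (evH B f) = c • v := by
  rw [evH_apply, map_hsum]
  simp only [h]
  rw [← LinearMap.toSpanSingleton_apply Rh M v c]
  nth_rw 2 [← hsum_C_coeff c]
  rw [map_hsum]
  rfl

attribute [local instance] complexAlgebra in
theorem evH_map_algebraMap (c : Rh) :
    evH B (PowerSeries.map (algebraMap ℂ B) c) = algebraMap Rh B c := by
  rw [Algebra.algebraMap_eq_smul_one]
  refine map_evH_of_coeff (LinearMap.id : B →ₗ[Rh] B) _ _ _ fun r => ?_
  rw [← Algebra.algebraMap_eq_smul_one]
  simp
  rfl

theorem map_evH (f : B →ₐ[Rh] C) (x : PowerSeries B) :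
    f (evH B x) = evH C (PowerSeries.map f.toRingHom x) := by
  change f.toLinearMap _ = _
  rw [evH_apply, evH_apply, map_hsum]
  simp

end Eval

/-! ### Homomorphisms out of presented algebras -/

section Lift

variable {ι : Type} {B : Type} [Ring B] [Algebra Rh B] [IsAdicComplete hI B]

attribute [local instance] complexAlgebra in
/-- The homomorphism from the completed free algebra given by the images of the generators. -/
def FreeSeries.lift (φ : ι → B) : FreeSeries ι →ₐ[Rh] B :=
  { ((evH B).comp (PowerSeries.map (FreeAlgebra.lift ℂ φ).toRingHom) :
      PowerSeries (FreeAlgebra ℂ ι) →+* B) with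
    commutes' := fun c => by
      rw [← evH_map_algebraMap (B := B)]
      change evH B (PowerSeries.map (FreeAlgebra.lift ℂ φ).toRingHom
        (PowerSeries.map (algebraMap ℂ (FreeAlgebra ℂ ι)) c)) = _
      congr 1
      ext r
      simp only [PowerSeries.coeff_map]
      exact (FreeAlgebra.lift ℂ φ).commutes _ }

attribute [local instance] complexAlgebra in
theorem FreeSeries.lift_ofSeries (φ : ι → B) (f : PowerSeries (FreeAlgebra ℂ ι)) :
    FreeSeries.lift φ (FreeSeries.ofSeries f) =
      evH B (PowerSeries.map (FreeAlgebra.lift ℂ φ).toRingHom f) := rfl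

theorem FreeSeries.lift_gen (φ : ι → B) (i : ι) : FreeSeries.lift φ (FreeSeries.gen i) = φ i := by
  let := complexAlgebra B
  rw [FreeSeries.gen, FreeSeries.lift_ofSeries, PowerSeries.map_C, evH_C]
  exact FreeAlgebra.lift_ι_apply _ _

variable {rels : Set (FreeSeries ι)}

/-- The homomorphism from a presented algebra to a complete algebra given by the images of the
generators, which have to satisfy the relations. -/
def PresAlg.lift (φ : ι → B) (h : ∀ r ∈ rels, FreeSeries.lift φ r = 0) : PresAlg rels →ₐ[Rh] B :=
  { (closedIdeal rels).ringCon.lift (FreeSeries.lift φ).toRingHom (by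
      have key : closedIdeal rels ≤ TwoSidedIdeal.ker (FreeSeries.lift φ) := by
        refine sInf_le ⟨fun r hr => (TwoSidedIdeal.mem_ker _).mpr (h r hr), fun x hx => ?_⟩
        rw [TwoSidedIdeal.mem_ker]
        refine eq_zero_of_forall_hbar_pow fun n => ?_
        obtain ⟨z, hz⟩ := hx n
        refine ⟨FreeSeries.lift φ z, ?_⟩
        rw [TwoSidedIdeal.mem_ker, map_sub, sub_eq_zero] at hz
        rw [hz, map_smul]
      intro x y hxy
      exact TwoSidedIdeal.ringCon_le_iff.mp key hxy) with
    commutes' := fun c => (FreeSeries.lift φ).commutes c }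

theorem PresAlg.lift_gen (φ : ι → B) (h : ∀ r ∈ rels, FreeSeries.lift φ r = 0) (i : ι) :
    PresAlg.lift φ h (PresAlg.gen rels i) = φ i :=
  FreeSeries.lift_gen φ i

theorem FreeSeries.map_id_apply (x : FreeSeries ι) : FreeSeries.map id x = x := by
  refine PowerSeries.ext (R := FreeAlgebra ℂ ι) fun r => ?_
  refine (PowerSeries.coeff_map _ _ _).trans ?_
  have : FreeAlgebra.lift ℂ (fun i : ι => FreeAlgebra.ι ℂ (id i)) = AlgHom.id ℂ _ := by
    ext i; simp
  exact congrArg (fun g : FreeAlgebra ℂ ι →ₐ[ℂ] FreeAlgebra ℂ ι =>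
    g (PowerSeries.coeff (R := FreeAlgebra ℂ ι) r x)) this

variable (rels) in
theorem PresAlg.mk_eq_lift (x : FreeSeries ι) :
    PresAlg.mk rels x = FreeSeries.lift (PresAlg.gen rels) x := by
  have h : PresAlg.map (rels := ∅) (rels' := rels) id (fun r hr => hr.elim) =
      PresAlg.lift (PresAlg.gen rels) (fun r hr => hr.elim) :=
    PresAlg.algHom_ext fun i => by rw [PresAlg.map_gen, PresAlg.lift_gen]; rfl
  have := congrArg (fun g : PresAlg (∅ : Set (FreeSeries ι)) →ₐ[Rh] PresAlg rels =>
    g (PresAlg.mk ∅ x)) h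
  refine Eq.trans ?_ this
  exact congrArg (PresAlg.mk rels) (FreeSeries.map_id_apply x).symm

/-- A closed subspace which contains `1` and is stable under left multiplication by the generators
is everything. -/
theorem PresAlg.induction (S : Submodule Rh (PresAlg rels)) (hS : IsClosedSub S) (h1 : 1 ∈ S)
    (hg : ∀ i, ∀ x ∈ S, PresAlg.gen rels i * x ∈ S) (x : PresAlg rels) : x ∈ S := by
  have hC : ∀ a : FreeAlgebra ℂ ι, ∀ y ∈ S,
      PresAlg.mk rels (FreeSeries.ofSeries (PowerSeries.C a)) * y ∈ S := by
    intro a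
    induction a using FreeAlgebra.induction with
    | grade0 c =>
      intro y hy
      have hc : FreeSeries.ofSeries (PowerSeries.C (algebraMap ℂ (FreeAlgebra ℂ ι) c)) =
          algebraMap Rh (FreeSeries ι) (PowerSeries.C c) :=
        (PowerSeries.map_C (algebraMap ℂ (FreeAlgebra ℂ ι)) c).symm
      rw [hc, AlgHom.commutes, ← Algebra.smul_def]
      exact S.smul_mem _ hy
    | grade1 i => exact fun y hy => hg i y hy
    | mul a b ha hb =>
      intro y hy
      have : FreeSeries.ofSeries (PowerSeries.C (a * b)) =
          FreeSeries.ofSeries (PowerSeries.C a) * FreeSeries.ofSeries (PowerSeries.C b) :=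
        map_mul (PowerSeries.C (R := FreeAlgebra ℂ ι)) a b
      rw [this, map_mul, mul_assoc]
      exact ha _ (hb _ hy)
    | add a b ha hb =>
      intro y hy
      have : FreeSeries.ofSeries (PowerSeries.C (a + b)) =
          FreeSeries.ofSeries (PowerSeries.C a) + FreeSeries.ofSeries (PowerSeries.C b) :=
        map_add (PowerSeries.C (R := FreeAlgebra ℂ ι)) a b
      rw [this, map_add, add_mul]
      exact S.add_mem (ha _ hy) (hb _ hy)
  have key : ∀ (n : ℕ) (a : FreeSeries ι),
      ∃ z, PresAlg.mk rels a - hbar ^ n • z ∈ S := by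
    intro n
    induction n with
    | zero => intro a; exact ⟨PresAlg.mk rels a, by simp⟩
    | succ n ih =>
      intro a
      let a' : FreeSeries ι := FreeSeries.ofSeries (PowerSeries.mk fun r =>
        PowerSeries.coeff (R := FreeAlgebra ℂ ι) (r + 1) a)
      have ha : a = hbar ^ 1 • a' + FreeSeries.ofSeries (PowerSeries.C
          (PowerSeries.coeff (R := FreeAlgebra ℂ ι) 0 a)) := by
        refine PowerSeries.ext (R := FreeAlgebra ℂ ι) fun r => ?_
        refine Eq.trans ?_ (map_add (PowerSeries.coeff (R := FreeAlgebra ℂ ι) r) _ _).symm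
        rw [FreeSeries.coeff_smul]
        have e1 : ∀ r, PowerSeries.coeff (R := FreeAlgebra ℂ ι) r a' =
          PowerSeries.coeff (R := FreeAlgebra ℂ ι) (r + 1) a := fun r => PowerSeries.coeff_mk _ _
        have e2 : ∀ (r : ℕ) (c : FreeAlgebra ℂ ι), PowerSeries.coeff (R := FreeAlgebra ℂ ι) r
          (FreeSeries.ofSeries (PowerSeries.C c)) = if r = 0 then c else 0 :=
          fun r c => PowerSeries.coeff_C r c
        rw [e1, e2]
        cases r with
        | zero => simp
        | succ r => simp
      obtain ⟨z, hz⟩ := ih a'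
      refine ⟨z, ?_⟩
      have hb := hC (PowerSeries.coeff (R := FreeAlgebra ℂ ι) 0 a) 1 h1
      rw [mul_one] at hb
      rw [ha, map_add, map_smul, pow_one, pow_succ', mul_smul, add_sub_right_comm, ← smul_sub]
      exact S.add_mem (S.smul_mem _ hz) hb
  obtain ⟨a, rfl⟩ := PresAlg.mk_surjective rels x
  exact hS _ fun n => key n a

end Lift

/-! ### Homomorphisms out of completed tensor products -/

section CTensor

variable {A B C : Type} [Ring A] [Algebra Rh A] [Ring B] [Algebra Rh B] [Ring C] [Algebra Rh C]
variable {M N P Q : Type} [AddCommGroup M] [Module Rh M] [AddCommGroup N] [Module Rh N]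
  [AddCommGroup P] [Module Rh P]

theorem CTensor.mem_of_ctmul_mem (S : Submodule Rh (CTensor A B)) (hS : IsClosedSub S)
    (h : ∀ a b, ctmul a b ∈ S) (z : CTensor A B) : z ∈ S := by
  refine hS z fun n => ?_
  obtain ⟨a, y, hy⟩ := AdicCompletion.exists_sub_of_eq (CTensor.equiv A B z) n
  refine ⟨(CTensor.equiv A B).symm y, ?_⟩
  have : z - hbar ^ n • (CTensor.equiv A B).symm y =
      (CTensor.equiv A B).symm (AdicCompletion.of hI (A ⊗[Rh] B) a) := by
    rw [← map_smul, sub_eq_iff_eq_add, ← map_add, ← hy, LinearEquiv.symm_apply_apply]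
  rw [this]
  clear this hy
  induction a with
  | zero => simp
  | tmul a b => exact h a b
  | add a b ha hb => rw [map_add, map_add]; exact S.add_mem ha hb

theorem CTensor.linearMap_ext [IsHausdorff hI P] {f g : CTensor A B →ₗ[Rh] P}
    (h : ∀ a b, f (ctmul a b) = g (ctmul a b)) : f = g :=
  LinearMap.ext fun z => CTensor.mem_of_ctmul_mem _ (isClosedSub_eqLocus f g) h z

theorem CTensor.apply_ext [IsHausdorff hI P] (f g : CTensor A B →ₗ[Rh] P)
    (h : ∀ a b, f (ctmul a b) = g (ctmul a b)) (z : CTensor A B) : f z = g z := by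
  rw [CTensor.linearMap_ext h]

theorem mapTensor_ctmul {A' B' : Type} [Ring A'] [Algebra Rh A'] [Ring B'] [Algebra Rh B']
    (f : A →ₗ[Rh] A') (g : B →ₗ[Rh] B') (a : A) (b : B) :
    mapTensor f g (ctmul a b) = ctmul (f a) (g b) :=
  congrArg (CTensor.equiv A' B').symm (AdicCompletion.map_of hI _ _)

theorem inclL_apply (a : A) : inclL A B a = ctmul a 1 := rfl

theorem inclR_apply (b : B) : inclR A B b = ctmul 1 b := rfl

theorem ctmul_add (a : A) (b b' : B) : ctmul a (b + b') = ctmul a b + ctmul a b' := by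
  unfold ctmul
  rw [TensorProduct.tmul_add, map_add, map_add]

theorem add_ctmul (a a' : A) (b : B) : ctmul (a + a') b = ctmul a b + ctmul a' b := by
  unfold ctmul
  rw [TensorProduct.add_tmul, map_add, map_add]

theorem ctmul_smul (c : Rh) (a : A) (b : B) : ctmul a (c • b) = c • ctmul a b := by
  unfold ctmul
  rw [TensorProduct.tmul_smul, map_smul, map_smul]

theorem smul_ctmul (c : Rh) (a : A) (b : B) : ctmul (c • a) b = c • ctmul a b := by
  unfold ctmul
  rw [← TensorProduct.smul_tmul', map_smul, map_smul]

/-- Two algebra homomorphisms with commuting images define one on the completed tensor product. -/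
def liftC [IsAdicComplete hI C] (f : A →ₐ[Rh] C) (g : B →ₐ[Rh] C)
    (h : ∀ a b, Commute (f a) (g b)) : CTensor A B →ₐ[Rh] C :=
  AlgHom.ofLinearMap (evalTensor (LinearMap.mul Rh C) f.toLinearMap g.toLinearMap)
    (by rw [← ctmul_one_one, evalTensor_ctmul]; simp)
    (fun x y => by
      set e := evalTensor (LinearMap.mul Rh C) f.toLinearMap g.toLinearMap
      refine CTensor.apply_ext (e ∘ₗ LinearMap.mulRight Rh y) (LinearMap.mulRight Rh (e y) ∘ₗ e)
        (fun a b => ?_) x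
      refine CTensor.apply_ext (e ∘ₗ LinearMap.mulLeft Rh (ctmul a b))
        (LinearMap.mulLeft Rh (e (ctmul a b)) ∘ₗ e) (fun a' b' => ?_) y
      simp only [LinearMap.comp_apply, LinearMap.mulLeft_apply, ctmul_mul_ctmul, e,
        evalTensor_ctmul, AlgHom.toLinearMap_apply, LinearMap.mul_apply', map_mul]
      rw [mul_assoc, mul_assoc, ← mul_assoc (f a'), (h a' b).eq, mul_assoc])

theorem liftC_ctmul [IsAdicComplete hI C] (f : A →ₐ[Rh] C) (g : B →ₐ[Rh] C)
    (h : ∀ a b, Commute (f a) (g b)) (a : A) (b : B) : liftC f g h (ctmul a b) = f a * g b :=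
  evalTensor_ctmul _ _ _ _ _

theorem commute_ctmul (a : A) (b : B) : Commute (ctmul a (1 : B)) (ctmul (1 : A) b) := by
  rw [Commute, SemiconjBy, ctmul_mul_ctmul, ctmul_mul_ctmul]; simp

end CTensor

/-! ### Exponentials and `q`-numbers in complete algebras -/

section Formal

variable {A A' : Type} [Ring A] [Algebra ℂ A] [Ring A'] [Algebra ℂ A']

theorem expH_add {a b : A} (h : Commute a b) : expH (a + b) = expH a * expH b := by
  ext r
  simp only [expH, PowerSeries.coeff_mul, PowerSeries.coeff_mk]
  rw [h.add_pow', Finset.smul_sum]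
  refine Finset.sum_congr rfl fun m hm => ?_
  rw [smul_mul_smul_comm, ← Nat.cast_smul_eq_nsmul ℂ, smul_smul]
  congr 1
  rw [Finset.HasAntidiagonal.mem_antidiagonal] at hm
  have h1 : ((m.1.factorial : ℂ)) ≠ 0 := Nat.cast_ne_zero.mpr (Nat.factorial_ne_zero _)
  have h2 : ((m.2.factorial : ℂ)) ≠ 0 := Nat.cast_ne_zero.mpr (Nat.factorial_ne_zero _)
  have h3 : ((r.factorial : ℂ)) ≠ 0 := Nat.cast_ne_zero.mpr (Nat.factorial_ne_zero _)
  have h4 : ((r.choose m.1 : ℂ)) * m.1.factorial * m.2.factorial = r.factorial := by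
    have := Nat.choose_mul_factorial_mul_factorial (n := r) (k := m.1) (by omega)
    rw [show r - m.1 = m.2 by omega] at this
    exact_mod_cast this
  field_simp
  rw [← h4]

theorem expH_zero : expH (0 : A) = 1 := by
  ext r
  cases r with
  | zero => simp [expH]
  | succ r => simp [expH, PowerSeries.coeff_one]

theorem map_expH (f : A →ₐ[ℂ] A') (a : A) : PowerSeries.map f.toRingHom (expH a) = expH (f a) := by
  ext r; simp [expH]

theorem map_qBracket (f : A →ₐ[ℂ] A') (a : A) :
    PowerSeries.map f.toRingHom (qBracket a) = qBracket (f a) := by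
  have h : PowerSeries.map f.toRingHom (shH a) = shH (f a) := by
    ext r; simp [shH, expH]
  rw [qBracket, map_mul, h, qBracket]
  congr 1
  ext r; simp

theorem map_algebraMap_commute (c : PowerSeries ℂ) (x : PowerSeries A) :
    Commute (PowerSeries.map (algebraMap ℂ A) c) x := by
  ext r
  rw [PowerSeries.coeff_mul, PowerSeries.coeff_mul, ← Finset.Nat.sum_antidiagonal_swap]
  refine Finset.sum_congr rfl fun p _ => ?_
  simp only [PowerSeries.coeff_map, Prod.fst_swap, Prod.snd_swap]
  exact Algebra.commutes _ _

theorem X_mul_cancel {A : Type} [Ring A] {x y : PowerSeries A}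
    (h : PowerSeries.X * x = PowerSeries.X * y) : x = y := by
  ext r
  rw [← PowerSeries.coeff_succ_X_mul, h, PowerSeries.coeff_succ_X_mul]

theorem shH_add {a b : A} (h : Commute a b) :
    shH (a + b) = shH a * expH b + expH (-a) * shH b := by
  apply X_mul_cancel
  rw [X_mul_shH, mul_add, ← mul_assoc, X_mul_shH, ← mul_assoc, (PowerSeries.commute_X _).symm.eq,
    mul_assoc, X_mul_shH, neg_add, expH_add h, expH_add h.neg_left.neg_right]
  noncomm_ring

theorem qBracket_add {a b : A} (h : Commute a b) :
    qBracket (a + b) = qBracket a * expH b + expH (-a) * qBracket b := by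
  rw [qBracket, shH_add h, qBracket, qBracket, mul_add, mul_assoc,
    ((map_algebraMap_commute _ (expH (-a))).symm.left_comm)]

end Formal

section Bexp

variable {B C : Type} [Ring B] [Algebra Rh B] [IsAdicComplete hI B]
  [Ring C] [Algebra Rh C] [IsAdicComplete hI C]

attribute [local instance] complexAlgebra in
/-- The exponential `e^{ħ a}` in a complete algebra. -/
def bexp (a : B) : B := evH B (expH a)

attribute [local instance] complexAlgebra in
/-- The element `[a] = (e^{ħ a} - e^{-ħ a}) / (e^ħ - e^{-ħ})` of a complete algebra. -/
def qbr (a : B) : B := evH B (qBracket a)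

/-- `q = e^ħ`. -/
abbrev qq : Rh := expH (1 : ℂ)

/-- `q⁻¹ = e^{-ħ}`. -/
abbrev qi : Rh := expH (-1 : ℂ)

theorem bexp_add {a b : B} (h : Commute a b) : bexp (a + b) = bexp a * bexp b := by
  let := complexAlgebra B
  rw [bexp, expH_add h, map_mul]; rfl

theorem bexp_zero : bexp (0 : B) = 1 := by
  let := complexAlgebra B
  rw [bexp, expH_zero, map_one]

theorem qbr_add {a b : B} (h : Commute a b) :
    qbr (a + b) = qbr a * bexp b + bexp (-a) * qbr b := by
  let := complexAlgebra B
  rw [qbr, qBracket_add h, map_add, map_mul, map_mul]; rfl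

/-- A homomorphism of `ℂ⟦ħ⟧`-algebras as a homomorphism of `ℂ`-algebras. -/
def complexHom {B C : Type} [Ring B] [Algebra Rh B] [Ring C] [Algebra Rh C] (f : B →ₐ[Rh] C) :
    @AlgHom ℂ B C _ _ _ (complexAlgebra B) (complexAlgebra C) :=
  letI := complexAlgebra B
  letI := complexAlgebra C
  { f.toRingHom with commutes' := fun c => f.commutes (PowerSeries.C c) }

theorem map_bexp (f : B →ₐ[Rh] C) (a : B) : f (bexp a) = bexp (f a) := by
  let := complexAlgebra B
  let := complexAlgebra C
  rw [bexp, map_evH, bexp]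
  exact congrArg _ (map_expH (complexHom f) a)

theorem map_qbr (f : B →ₐ[Rh] C) (a : B) : f (qbr a) = qbr (f a) := by
  let := complexAlgebra B
  let := complexAlgebra C
  rw [qbr, map_evH, qbr]
  exact congrArg _ (map_qBracket (complexHom f) a)

theorem bexp_algebraMap (c : ℂ) :
    bexp (algebraMap Rh B (PowerSeries.C c)) = algebraMap Rh B (expH c) := by
  let := complexAlgebra B
  rw [← evH_map_algebraMap (expH c)]
  exact congrArg _ (map_expH (Algebra.ofId ℂ B) c).symm

theorem qbr_algebraMap (c : ℂ) :
    qbr (algebraMap Rh B (PowerSeries.C c)) = algebraMap Rh B (qBracket c) := by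
  let := complexAlgebra B
  rw [← evH_map_algebraMap (qBracket c)]
  exact congrArg _ (map_qBracket (Algebra.ofId ℂ B) c).symm

/-- An exponential `q`-commutes with the eigenvectors of its exponent. -/
theorem bexp_mul_of_eigen {a e : B} (c : ℂ) (h : a * e = e * a + (PowerSeries.C c : Rh) • e) :
    bexp a * e = (expH c : Rh) • (e * bexp a) := by
  let := complexAlgebra B
  have h1 : SemiconjBy e (a + algebraMap Rh B (PowerSeries.C c)) a := by
    rw [SemiconjBy, h, mul_add, ← Algebra.commutes, ← Algebra.smul_def]
  have h2 : expH a * PowerSeries.C e =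
      PowerSeries.C e * expH (a + algebraMap Rh B (PowerSeries.C c)) := by
    ext r
    simp only [expH, PowerSeries.coeff_mul_C, PowerSeries.coeff_C_mul, PowerSeries.coeff_mk]
    rw [smul_mul_assoc, mul_smul_comm, (h1.pow_right r).eq]
  have h3 := congrArg (evH B) h2
  rw [map_mul, map_mul, evH_C] at h3
  change bexp a * e = e * bexp _ at h3
  rw [h3, bexp_add (Algebra.commutes _ _).symm, bexp_algebraMap, ← mul_assoc, ← Algebra.commutes,
    ← Algebra.smul_def]

theorem bexp_commute {a e : B} (h : Commute a e) : Commute (bexp a) e := by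
  have := bexp_mul_of_eigen (a := a) (e := e) 0 (by rw [map_zero, zero_smul, add_zero]; exact h)
  rw [expH_zero, one_smul] at this
  exact this

theorem FreeSeries.lift_expH {ι : Type} (φ : ι → B) (a : FreeAlgebra ℂ ι) (b : B)
    (h : FreeSeries.lift φ (FreeSeries.ofSeries (PowerSeries.C a)) = b) :
    FreeSeries.lift φ (FreeSeries.ofSeries (expH a)) = bexp b := by
  let := complexAlgebra B
  rw [FreeSeries.lift_ofSeries, PowerSeries.map_C, evH_C] at h
  rw [FreeSeries.lift_ofSeries, map_expH, ← h]; rfl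

theorem FreeSeries.lift_qBracket {ι : Type} (φ : ι → B) (a : FreeAlgebra ℂ ι) (b : B)
    (h : FreeSeries.lift φ (FreeSeries.ofSeries (PowerSeries.C a)) = b) :
    FreeSeries.lift φ (FreeSeries.ofSeries (qBracket a)) = qbr b := by
  let := complexAlgebra B
  rw [FreeSeries.lift_ofSeries, PowerSeries.map_C, evH_C] at h
  rw [FreeSeries.lift_ofSeries, map_qBracket, ← h]; rfl

end Bexp

section Scalars

theorem expH_add_complex (a b : ℂ) : (expH (a + b) : Rh) = expH a * expH b :=
  expH_add (Commute.all a b)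

theorem qq_mul_qi : qq * qi = 1 := by
  rw [← expH_add_complex, add_neg_cancel, expH_zero]

theorem qi_mul_qq : qi * qq = 1 := by rw [mul_comm, qq_mul_qi]

theorem qq_sub_qi : qq - qi = hbar * shH (1 : ℂ) := (X_mul_shH (1 : ℂ)).symm

theorem qq_sub_qi_ne_zero : qq - qi ≠ 0 := by
  rw [qq_sub_qi]
  refine mul_ne_zero PowerSeries.X_ne_zero fun h => ?_
  have := constantCoeff_shH_one
  rw [h] at this
  simp at this

theorem qBracket_eq_of_mul {a : ℂ} {x : Rh} (h : (qq - qi) * x = expH a - expH (-a)) :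
    qBracket a = x :=
  mul_left_cancel₀ qq_sub_qi_ne_zero ((qBracket_spec a).trans h.symm)

theorem qBracket_zero : (qBracket (0 : ℂ) : Rh) = 0 := qBracket_eq_of_mul (by simp)

theorem qBracket_one : (qBracket (1 : ℂ) : Rh) = 1 := qBracket_eq_of_mul (by simp)

theorem qBracket_neg_one : (qBracket (-1 : ℂ) : Rh) = -1 := qBracket_eq_of_mul (by simp)

theorem qBracket_two : (qBracket (2 : ℂ) : Rh) = qq + qi :=
  qBracket_eq_of_mul (by
    rw [show (2 : ℂ) = 1 + 1 by norm_num, neg_add, expH_add_complex, expH_add_complex]; ring)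

theorem qInt_one : qInt 1 = 1 := by rw [qInt, Nat.cast_one, qBracket_one]

theorem qInt_zero : qInt 0 = 0 := by rw [qInt, Nat.cast_zero, qBracket_zero]

theorem qBracket_add_one (a : ℂ) : (qBracket (a + 1) : Rh) = qBracket a * qq + expH (-a) := by
  refine qBracket_eq_of_mul ?_
  rw [mul_add, ← mul_assoc, qBracket_spec, neg_add, expH_add_complex, expH_add_complex]
  ring

theorem qInt_succ (n : ℕ) : qInt (n + 1) = qInt n * qq + expH (-(n : ℂ)) := by
  rw [qInt, Nat.cast_succ, qBracket_add_one]; rfl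

theorem qFactorial_zero : qFactorial 0 = 1 := rfl

theorem qFactorial_one : qFactorial 1 = 1 := by simp [qFactorial, qInt_one]

theorem qFactorial_two : qFactorial 2 = qq + qi := by
  simp [qFactorial, Finset.prod_range_succ, qInt, one_add_one_eq_two, qBracket_two, qBracket_one]

theorem inv_one_Rh : (1 : Rh)⁻¹ = 1 := by
  rw [PowerSeries.inv_eq_iff_mul_eq_one (by simp), mul_one]

theorem qFactorial_two_mul_inv : qFactorial 2 * (qFactorial 2)⁻¹ = 1 := by
  refine PowerSeries.mul_inv_cancel _ ?_
  rw [qFactorial_two]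
  rw [← PowerSeries.coeff_zero_eq_constantCoeff_apply]
  simp [expH]

theorem qBinom_one (r : ℕ) (hr : r < 2) : qBinom 1 r = 1 := by
  interval_cases r <;> simp [qBinom, qFactorial_zero, qFactorial_one]

theorem qBinom_two_zero : qBinom 2 0 = 1 := by
  rw [qBinom, qFactorial_zero, one_mul, Nat.sub_zero, qFactorial_two_mul_inv]

theorem qBinom_two_one : qBinom 2 1 = qq + qi := by
  rw [qBinom, qFactorial_one, one_mul, inv_one_Rh, mul_one, qFactorial_two]

theorem qBinom_two_two : qBinom 2 2 = 1 := by
  rw [qBinom, Nat.sub_self, qFactorial_zero, mul_one, qFactorial_two_mul_inv]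

end Scalars

/-! ### The quantum group: relations, coproduct, counit and vector representation -/

section Serre

variable {B C : Type} [Ring B] [Algebra Rh B] [Ring C] [Algebra Rh C]

/-- The left-hand side `∑ᵣ (-1)^r [N choose r] x^r y x^{N-r}` of the Serre relations. -/
def serre (N : ℕ) (x y : B) : B :=
  ∑ r ∈ Finset.range (N + 1), ((-1) ^ r * qBinom N r) • (x ^ r * y * x ^ (N - r))

theorem map_serre (f : B →ₐ[Rh] C) (N : ℕ) (x y : B) : f (serre N x y) = serre N (f x) (f y) := by
  simp [serre]

theorem serre_one (x y : B) : serre 1 x y = y * x - x * y := by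
  simp [serre, Finset.sum_range_succ, qBinom_one, sub_eq_add_neg]

theorem serre_two (x y : B) :
    serre 2 x y = y * x * x - (qq + qi) • (x * y * x) + x * x * y := by
  simp [serre, Finset.sum_range_succ, qBinom_two_zero, qBinom_two_one, qBinom_two_two,
    sub_eq_add_neg, pow_two, mul_assoc, -neg_add_rev]

theorem serre_two_add_aux {R B : Type} [CommRing R] [Ring B] [Algebra R B] {s t : R}
    (hts : t * s = 1) {a b c d : B}
    (hba : b * a = (s * s) • (a * b)) (hbc : b * c = t • (c * b)) (hda : d * a = t • (a * d)) :
    (c + d) * (a + b) * (a + b) - (t + s) • ((a + b) * (c + d) * (a + b)) +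
        (a + b) * (a + b) * (c + d) =
      (c * a * a - (t + s) • (a * c * a) + a * a * c) +
        (d * b * b - (t + s) • (b * d * b) + b * b * d) := by
  have h1 : d * a * a - (t + s) • (a * d * a) + a * a * d = 0 := by
    have e1 : a * d * a = t • (a * a * d) := by rw [mul_assoc, hda, mul_smul_comm, mul_assoc]
    have e2 : d * a * a = (t * t) • (a * a * d) := by rw [hda, smul_mul_assoc, e1, smul_smul]
    rw [e1, e2]
    match_scalars
    linear_combination -hts
  have h2 : c * b * b - (t + s) • (b * c * b) + b * b * c = 0 := by
    have e1 : b * c * b = t • (c * b * b) := by rw [hbc, smul_mul_assoc]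
    have e2 : b * b * c = (t * t) • (c * b * b) := by
      rw [mul_assoc, hbc, mul_smul_comm, ← mul_assoc, e1, smul_smul]
    rw [e1, e2]
    match_scalars
    linear_combination -hts
  have h3 : c * a * b + c * b * a - (t + s) • (a * c * b + b * c * a) + a * b * c + b * a * c =
      0 := by
    have e1 : c * b * a = (s * s) • (c * a * b) := by
      rw [mul_assoc, hba, mul_smul_comm, mul_assoc]
    have e2 : b * c * a = s • (c * a * b) := by
      rw [hbc, smul_mul_assoc, e1, smul_smul, ← mul_assoc, hts, one_mul]
    have e3 : a * b * c = t • (a * c * b) := by rw [mul_assoc, hbc, mul_smul_comm, mul_assoc]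
    have e4 : b * a * c = s • (a * c * b) := by
      rw [hba, smul_mul_assoc, e3, smul_smul, mul_assoc, mul_comm s t, hts, mul_one]
    rw [e1, e2, e3, e4]
    match_scalars
    · linear_combination -hts
    · ring
  have h4 : d * a * b + d * b * a - (t + s) • (a * d * b + b * d * a) + a * b * d + b * a * d =
      0 := by
    have e1 : d * a * b = t • (a * d * b) := by rw [hda, smul_mul_assoc]
    have e2 : b * a * d = (s * s) • (a * b * d) := by rw [hba, smul_mul_assoc]
    have e3 : d * b * a = s • (a * d * b) := by
      rw [mul_assoc, hba, mul_smul_comm, ← mul_assoc, e1, smul_smul, mul_assoc, mul_comm s t,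
        hts, mul_one]
    have e4 : b * d * a = s • (a * b * d) := by
      rw [mul_assoc, hda, mul_smul_comm, ← mul_assoc, e2, smul_smul, ← mul_assoc, hts, one_mul]
    rw [e1, e2, e3, e4]
    match_scalars
    · ring
    · linear_combination -hts
  have h5 := congrArg₂ (· + ·) (congrArg₂ (· + ·) h1 h2) (congrArg₂ (· + ·) h3 h4)
  simp only [add_zero] at h5
  rw [← sub_eq_zero]
  refine Eq.trans ?_ h5
  simp only [add_mul, mul_add, smul_add]
  abel

/-- The `q`-Serre expression is additive on pairs `(a, c)`, `(b, d)` whose mixed products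
`q`-commute.  Applied to the two summands of `Δ(E_i)` and `Δ(E_j)`, this makes the coproduct
compatible with the `q`-Serre relations. -/
theorem serre_two_add {s t : Rh} (hts : t * s = 1) (hq : qq + qi = t + s) {a b c d : B}
    (hba : b * a = (s * s) • (a * b)) (hbc : b * c = t • (c * b)) (hda : d * a = t • (a * d)) :
    serre 2 (a + b) (c + d) = serre 2 a c + serre 2 b d := by
  simp only [serre_two, hq]
  exact serre_two_add_aux hts hba hbc hda

end Serre

section Lift

variable {p : ℕ} {B : Type} [Ring B] [Algebra Rh B]

/-- Elements of an algebra which satisfy the defining relations of `U_ħ gl_p`. -/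
structure IsGlFamily [IsAdicComplete hI B] (E F : Fin (p - 1) → B) (D : Fin p → B) : Prop where
  DD : ∀ i j, D i * D j = D j * D i
  DE : ∀ i j, D i * E j - E j * D i =
    (((if i = lo j then 1 else 0) - (if i = up j then 1 else 0) : Rh)) • E j
  DF : ∀ i j, D i * F j - F j * D i =
    -((((if i = lo j then 1 else 0) - (if i = up j then 1 else 0) : Rh)) • F j)
  EF : ∀ i j, E i * F j - F j * E i = if i = j then qbr (D (lo i) - D (up i)) else 0
  EE : ∀ i j, i ≠ j → serre (1 - cartan i j).toNat (E i) (E j) = 0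
  FF : ∀ i j, i ≠ j → serre (1 - cartan i j).toNat (F i) (F j) = 0

/-- The images of the generators under the homomorphism with values `E`, `F`, `D`. -/
def glVal (E F : Fin (p - 1) → B) (D : Fin p → B) : GlGen p → B
  | .E i => E i
  | .F i => F i
  | .D i => D i

theorem ofSeries_C_freeH (i : Fin (p - 1)) :
    FreeSeries.ofSeries (PowerSeries.C (freeH i)) =
      FreeSeries.gen (.D (lo i)) - FreeSeries.gen (.D (up i)) :=
  map_sub (PowerSeries.C (R := FreeAlgebra ℂ (GlGen p))) _ _

variable [IsAdicComplete hI B]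

/-- The homomorphism from `U_ħ gl_p` given by the images of the generators. -/
def glLift (E F : Fin (p - 1) → B) (D : Fin p → B) (h : IsGlFamily E F D) : Uh p →ₐ[Rh] B :=
  PresAlg.lift (glVal E F D) (by
    intro r hr
    have hS : ∀ N x y, FreeSeries.lift (glVal E F D) (qSerre N x y) =
        serre N (FreeSeries.lift (glVal E F D) x) (FreeSeries.lift (glVal E F D) y) :=
      fun N x y => map_serre (FreeSeries.lift (glVal E F D)) N x y
    cases hr with
    | DD i j =>
      simp only [map_sub, map_mul, FreeSeries.lift_gen, glVal]
      rw [h.DD, sub_self]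
    | DE i j =>
      simp only [map_sub, map_mul, map_smul, FreeSeries.lift_gen, glVal]
      rw [h.DE, sub_self]
    | DF i j =>
      simp only [map_sub, map_add, map_mul, map_smul, FreeSeries.lift_gen, glVal]
      rw [h.DF, neg_add_cancel]
    | EF i j =>
      simp only [map_sub, map_mul, FreeSeries.lift_gen, glVal]
      rw [h.EF]
      split_ifs
      · rw [FreeSeries.lift_qBracket _ _ _ (by rw [ofSeries_C_freeH, map_sub, FreeSeries.lift_gen,
          FreeSeries.lift_gen]), glVal, glVal, sub_self]
      · rw [map_zero, sub_self]
    | EE i j hij => rw [hS, FreeSeries.lift_gen, FreeSeries.lift_gen]; exact h.EE i j hij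
    | FF i j hij => rw [hS, FreeSeries.lift_gen, FreeSeries.lift_gen]; exact h.FF i j hij)

variable {E F : Fin (p - 1) → B} {D : Fin p → B} (h : IsGlFamily E F D)

theorem glLift_E (i : Fin (p - 1)) : glLift E F D h (Uh.E i) = E i := PresAlg.lift_gen _ _ _

theorem glLift_F (i : Fin (p - 1)) : glLift E F D h (Uh.F i) = F i := PresAlg.lift_gen _ _ _

theorem glLift_D (i : Fin p) : glLift E F D h (Uh.D i) = D i := PresAlg.lift_gen _ _ _

end Lift

namespace Uh

variable {p : ℕ}

/-- `H_i = D_i - D_{i+1}`. -/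
def H (i : Fin (p - 1)) : Uh p := D (lo i) - D (up i)

theorem rel {r : FreeSeries (GlGen p)} (h : GlRel p r) : PresAlg.mk {x | GlRel p x} r = 0 :=
  (PresAlg.mk_eq_zero_iff _ _).mpr (subset_closedIdeal _ h)

theorem lift_freeH (i : Fin (p - 1)) :
    FreeSeries.lift (PresAlg.gen {x | GlRel p x}) (FreeSeries.ofSeries (PowerSeries.C (freeH i))) =
      H i := by
  rw [ofSeries_C_freeH, map_sub, FreeSeries.lift_gen, FreeSeries.lift_gen]; rfl

theorem K_eq (i : Fin (p - 1)) : K i = bexp (H i) := by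
  rw [K, PresAlg.mk_eq_lift, FreeSeries.lift_expH _ _ _ (lift_freeH i)]

theorem Kinv_eq (i : Fin (p - 1)) : Kinv i = bexp (-H i) := by
  rw [Kinv, PresAlg.mk_eq_lift, FreeSeries.lift_expH _ _ (-H i)]
  rw [← lift_freeH, ← map_neg]
  exact congrArg _ (map_neg (PowerSeries.C (R := FreeAlgebra ℂ (GlGen p))) _)

theorem isGlFamily : IsGlFamily (E (p := p)) F D where
  DD i j := sub_eq_zero.mp (rel (GlRel.DD i j))
  DE i j := sub_eq_zero.mp (rel (GlRel.DE i j))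
  DF i j := eq_neg_of_add_eq_zero_left (rel (GlRel.DF i j))
  EF i j := by
    have h0 := rel (GlRel.EF i j)
    rw [map_sub, sub_eq_zero, map_sub, map_mul, map_mul] at h0
    refine h0.trans ?_
    split_ifs with h
    · refine (PresAlg.mk_eq_lift _ _).trans ?_
      rw [FreeSeries.lift_qBracket _ _ _ (lift_freeH i)]; rfl
    · exact map_zero (PresAlg.mk {x | GlRel p x})
  EE i j h := (map_serre (PresAlg.mk {x | GlRel p x}) _ _ _).symm.trans (rel (GlRel.EE i j h))
  FF i j h := (map_serre (PresAlg.mk {x | GlRel p x}) _ _ _).symm.trans (rel (GlRel.FF i j h))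

theorem D_commute (i j : Fin p) : Commute (D i) (D j) := isGlFamily.DD i j

theorem D_commute_H (i : Fin p) (j : Fin (p - 1)) : Commute (D i) (H j) :=
  (D_commute _ _).sub_right (D_commute _ _)

theorem H_commute (i j : Fin (p - 1)) : Commute (H (p := p) i) (H j) :=
  (D_commute_H _ _).sub_left (D_commute_H _ _)

theorem cartan_eq (i j : Fin (p - 1)) :
    (PowerSeries.C (cartan i j : ℂ) : Rh) =
      ((if lo i = lo j then 1 else 0) - (if lo i = up j then 1 else 0)) -
        ((if up i = lo j then 1 else 0) - (if up i = up j then 1 else 0)) := by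
  have e1 : lo i = lo j ↔ i = j := by simp [lo, Fin.ext_iff]
  have e2 : lo i = up j ↔ (j : ℕ) + 1 = i := by simp [lo, up]; omega
  have e3 : up i = lo j ↔ (i : ℕ) + 1 = j := by simp [lo, up]
  have e4 : up i = up j ↔ i = j := by simp [up, Fin.ext_iff]
  simp only [e1, e2, e3, e4, cartan]
  by_cases h1 : i = j
  · subst h1
    simp
    rw [map_ofNat, one_add_one_eq_two]
  · by_cases h2 : (i : ℕ) + 1 = j
    · have h3 : ¬ (j : ℕ) + 1 = i := by omega
      simp [h1, h2, h3]
    · by_cases h3 : (j : ℕ) + 1 = i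
      · simp [h1, h2, h3]
      · simp [h1, h2, h3]

theorem H_mul_E (i j : Fin (p - 1)) :
    H i * E j = E j * H i + (PowerSeries.C (cartan i j : ℂ) : Rh) • E j := by
  rw [cartan_eq, sub_smul, ← isGlFamily.DE, ← isGlFamily.DE, H, sub_mul, mul_sub]
  abel

theorem H_mul_F (i j : Fin (p - 1)) :
    H i * F j = F j * H i + (PowerSeries.C (-cartan i j : ℂ) : Rh) • F j := by
  have h1 := isGlFamily.DF (p := p) (lo i) j
  have h2 := isGlFamily.DF (p := p) (up i) j
  rw [sub_eq_iff_eq_add] at h1 h2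
  rw [map_neg, neg_smul, cartan_eq, sub_smul, H, sub_mul, mul_sub, h1, h2]
  abel

theorem K_mul_E (i j : Fin (p - 1)) : K i * E j = (expH (cartan i j : ℂ) : Rh) • (E j * K i) := by
  rw [K_eq]; exact bexp_mul_of_eigen _ (H_mul_E i j)

theorem Kinv_mul_F (i j : Fin (p - 1)) :
    Kinv i * F j = (expH (cartan i j : ℂ) : Rh) • (F j * Kinv i) := by
  rw [Kinv_eq]
  refine bexp_mul_of_eigen _ ?_
  rw [neg_mul, H_mul_F, map_neg, neg_smul, mul_neg]; abel

theorem K_mul_F (i j : Fin (p - 1)) : K i * F j = (expH (-cartan i j : ℂ) : Rh) • (F j * K i) := by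
  rw [K_eq]; exact bexp_mul_of_eigen _ (H_mul_F i j)

theorem Kinv_mul_E (i j : Fin (p - 1)) :
    Kinv i * E j = (expH (-cartan i j : ℂ) : Rh) • (E j * Kinv i) := by
  rw [Kinv_eq]
  refine bexp_mul_of_eigen _ ?_
  rw [neg_mul, H_mul_E, map_neg, neg_smul, mul_neg]; abel

theorem K_commute (i j : Fin (p - 1)) : Commute (K (p := p) i) (K j) := by
  rw [K_eq, K_eq]
  exact (bexp_commute (bexp_commute (H_commute i j).symm).symm)

theorem Kinv_commute (i j : Fin (p - 1)) : Commute (Kinv (p := p) i) (Kinv j) := by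
  rw [Kinv_eq, Kinv_eq]
  exact (bexp_commute (bexp_commute (H_commute i j).neg_left.neg_right.symm).symm)

theorem D_commute_K (i : Fin p) (j : Fin (p - 1)) : Commute (D i) (K j) := by
  rw [K_eq]; exact (bexp_commute (D_commute_H i j).symm).symm

theorem D_commute_Kinv (i : Fin p) (j : Fin (p - 1)) : Commute (D i) (Kinv j) := by
  rw [Kinv_eq]; exact (bexp_commute (D_commute_H i j).neg_right.symm).symm

end Uh

section Coproduct

variable {A B : Type} [Ring A] [Algebra Rh A] [Ring B] [Algebra Rh B]

theorem ctmul_zero (a : A) : ctmul a (0 : B) = 0 := by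
  have := ctmul_smul (0 : Rh) a (0 : B)
  rwa [zero_smul, zero_smul] at this

theorem zero_ctmul (b : B) : ctmul (0 : A) b = 0 := by
  have := smul_ctmul (0 : Rh) (0 : A) b
  rwa [zero_smul, zero_smul] at this

theorem ctmul_neg (a : A) (b : B) : ctmul a (-b) = -ctmul a b := by
  have := ctmul_smul (-1 : Rh) a b
  rwa [neg_smul, neg_smul, one_smul, one_smul] at this

theorem neg_ctmul (a : A) (b : B) : ctmul (-a) b = -ctmul a b := by
  have := smul_ctmul (-1 : Rh) a b
  rwa [neg_smul, neg_smul, one_smul, one_smul] at this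

theorem ctmul_sub (a : A) (b b' : B) : ctmul a (b - b') = ctmul a b - ctmul a b' := by
  rw [sub_eq_add_neg, ctmul_add, ctmul_neg, sub_eq_add_neg]

theorem sub_ctmul (a a' : A) (b : B) : ctmul (a - a') b = ctmul a b - ctmul a' b := by
  rw [sub_eq_add_neg, add_ctmul, neg_ctmul, sub_eq_add_neg]

theorem sum_ctmul {ι : Type} (s : Finset ι) (f : ι → A) (b : B) :
    ctmul (∑ i ∈ s, f i) b = ∑ i ∈ s, ctmul (f i) b := by
  classical
  induction s using Finset.induction_on with
  | empty => simp [zero_ctmul]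
  | insert a s ha ih => rw [Finset.sum_insert ha, Finset.sum_insert ha, add_ctmul, ih]

theorem ctmul_sum {ι : Type} (s : Finset ι) (a : A) (f : ι → B) :
    ctmul a (∑ i ∈ s, f i) = ∑ i ∈ s, ctmul a (f i) := by
  classical
  induction s using Finset.induction_on with
  | empty => simp [ctmul_zero]
  | insert b s hb ih => rw [Finset.sum_insert hb, Finset.sum_insert hb, ctmul_add, ih]

theorem ctmul_pow (a : A) (b : B) (n : ℕ) : ctmul a b ^ n = ctmul (a ^ n) (b ^ n) := by
  induction n with
  | zero => simp [ctmul_one_one]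
  | succ n ih => rw [pow_succ, ih, ctmul_mul_ctmul, pow_succ, pow_succ]

/-- The `q`-Serre expression of `x ⊗ k` and `y ⊗ l` for commuting `k`, `l`. -/
theorem serre_ctmul_right (N : ℕ) {x y : A} {k l : B} (h : Commute k l) :
    serre N (ctmul x k) (ctmul y l) = ctmul (serre N x y) (l * k ^ N) := by
  rw [serre, serre, sum_ctmul]
  refine Finset.sum_congr rfl fun r hr => ?_
  rw [Finset.mem_range] at hr
  rw [smul_ctmul, ctmul_pow, ctmul_pow, ctmul_mul_ctmul, ctmul_mul_ctmul, (h.pow_left r).eq,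
    mul_assoc l, ← pow_add, show r + (N - r) = N by omega]

theorem serre_ctmul_left (N : ℕ) {x y : B} {k l : A} (h : Commute k l) :
    serre N (ctmul k x) (ctmul l y) = ctmul (l * k ^ N) (serre N x y) := by
  rw [serre, serre, ctmul_sum]
  refine Finset.sum_congr rfl fun r hr => ?_
  rw [Finset.mem_range] at hr
  rw [ctmul_smul, ctmul_pow, ctmul_pow, ctmul_mul_ctmul, ctmul_mul_ctmul, (h.pow_left r).eq,
    mul_assoc l, ← pow_add, show r + (N - r) = N by omega]

variable {p : ℕ}

theorem cartan_symm (i j : Fin (p - 1)) : cartan i j = cartan j i := by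
  simp only [cartan, eq_comm (a := i) (b := j), or_comm]

theorem expH_two : (expH ((2 : ℤ) : ℂ) : Rh) = qq * qq := by
  rw [← expH_add_complex]; norm_num

theorem cartan_cases {i j : Fin (p - 1)} (h : i ≠ j) : cartan i j = 0 ∨ cartan i j = -1 := by
  rw [cartan, if_neg h]
  split_ifs <;> simp

theorem cartan_self (i : Fin (p - 1)) : cartan i i = 2 := by rw [cartan, if_pos rfl]

/-- The values of the coproduct on `E_i`, `F_i` and `D_i` satisfy the relations of `U_ħ gl_p`. -/
theorem isGlFamily_coproduct : IsGlFamily (B := CTensor (Uh p) (Uh p))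
    (fun i => ctmul (Uh.E i) (Uh.K i) + ctmul 1 (Uh.E i))
    (fun i => ctmul (Uh.F i) 1 + ctmul (Uh.Kinv i) (Uh.F i))
    (fun i => ctmul (Uh.D i) 1 + ctmul 1 (Uh.D i)) where
  DD i j := by
    simp only [add_mul, mul_add, ctmul_mul_ctmul, one_mul, mul_one, (Uh.D_commute i j).eq]
    abel
  DE i j := by
    simp only [add_mul, mul_add, ctmul_mul_ctmul, one_mul, mul_one, (Uh.D_commute_K i j).eq]
    rw [smul_add, ← smul_ctmul, ← ctmul_smul, ← Uh.isGlFamily.DE, sub_ctmul, ctmul_sub]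
    abel
  DF i j := by
    simp only [add_mul, mul_add, ctmul_mul_ctmul, one_mul, mul_one, (Uh.D_commute_Kinv i j).eq]
    rw [smul_add, neg_add, ← smul_ctmul, ← ctmul_smul, ← neg_ctmul, ← ctmul_neg,
      ← Uh.isGlFamily.DF, sub_ctmul, ctmul_sub]
    abel
  EF i j := by
    have h1 : ctmul (Uh.E i * Uh.Kinv j) (Uh.K i * Uh.F j) =
        ctmul (Uh.Kinv j * Uh.E i) (Uh.F j * Uh.K i) := by
      rw [Uh.K_mul_F, Uh.Kinv_mul_E, ctmul_smul, smul_ctmul, cartan_symm]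
    simp only [add_mul, mul_add, ctmul_mul_ctmul, one_mul, mul_one, h1]
    have h2 : ctmul (Uh.E i * Uh.F j - Uh.F j * Uh.E i) (Uh.K i) +
        ctmul (Uh.Kinv j) (Uh.E i * Uh.F j - Uh.F j * Uh.E i) =
        if i = j then qbr (ctmul (Uh.D (lo i)) 1 + ctmul 1 (Uh.D (lo i)) -
          (ctmul (Uh.D (up i)) 1 + ctmul 1 (Uh.D (up i)))) else 0 := by
      rw [Uh.isGlFamily.EF]
      split_ifs with hij
      · subst hij
        rw [show ctmul (Uh.D (lo i)) 1 + ctmul 1 (Uh.D (lo i)) -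
            (ctmul (Uh.D (up i)) 1 + ctmul 1 (Uh.D (up i))) =
            inclL (Uh p) (Uh p) (Uh.H i) + inclR (Uh p) (Uh p) (Uh.H i) by
              rw [inclL_apply, inclR_apply, Uh.H, sub_ctmul, ctmul_sub]; abel,
          qbr_add (a := inclL _ _ (Uh.H i)) (b := inclR _ _ (Uh.H i)) (commute_ctmul _ _),
          ← map_neg, ← map_bexp, ← map_bexp, ← map_qbr, ← map_qbr,
          inclL_apply, inclL_apply, inclR_apply, inclR_apply, ctmul_mul_ctmul, ctmul_mul_ctmul,
          one_mul, mul_one, one_mul, mul_one, ← Uh.K_eq, ← Uh.Kinv_eq]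
        rfl
      · rw [zero_ctmul, ctmul_zero, add_zero]
    rw [← h2, sub_ctmul, ctmul_sub]
    abel
  EE i j h := by
    have hE := Uh.isGlFamily.EE i j h
    have hKK := Uh.K_commute i j
    rcases cartan_cases h with hc | hc
    · have hc' : cartan j i = 0 := by rw [cartan_symm, hc]
      have h1 := Uh.K_mul_E i j
      have h2 := Uh.K_mul_E j i
      rw [hc] at hE h1
      rw [hc'] at h2
      simp only [Int.cast_zero, expH_zero, one_smul] at h1 h2
      simp only [hc, sub_zero, Int.toNat_one, serre_one, sub_eq_zero] at hE ⊢
      simp only [add_mul, mul_add, ctmul_mul_ctmul, one_mul, mul_one, h1, h2, hE, hKK.eq]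
      abel
    · have hN : (1 - cartan i j).toNat = 2 := by rw [hc]; rfl
      rw [hN] at hE ⊢
      have h2 := Uh.K_mul_E i i
      rw [cartan_self, expH_two] at h2
      have h3 := Uh.K_mul_E i j
      have h4 := Uh.K_mul_E j i
      rw [hc] at h3
      rw [cartan_symm, hc] at h4
      push_cast at h3 h4
      rw [serre_two_add qq_mul_qi rfl, serre_ctmul_right 2 hKK, serre_ctmul_left 2 (Commute.refl _),
        hE, zero_ctmul, ctmul_zero, add_zero]
      · rw [ctmul_mul_ctmul, ctmul_mul_ctmul, h2, ctmul_smul, smul_smul, one_mul, mul_one,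
          mul_mul_mul_comm, qi_mul_qq, mul_one, one_smul]
      · rw [ctmul_mul_ctmul, ctmul_mul_ctmul, h4, ctmul_smul, smul_smul, one_mul, mul_one,
          qq_mul_qi, one_smul]
      · rw [ctmul_mul_ctmul, ctmul_mul_ctmul, h3, ctmul_smul, smul_smul, one_mul, mul_one,
          qq_mul_qi, one_smul]
  FF i j h := by
    have hE := Uh.isGlFamily.FF i j h
    have hKK := Uh.Kinv_commute i j
    rcases cartan_cases h with hc | hc
    · have hc' : cartan j i = 0 := by rw [cartan_symm, hc]
      have h1 := Uh.Kinv_mul_F i j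
      have h2 := Uh.Kinv_mul_F j i
      rw [hc] at hE h1
      rw [hc'] at h2
      simp only [Int.cast_zero, expH_zero, one_smul] at h1 h2
      simp only [hc, sub_zero, Int.toNat_one, serre_one, sub_eq_zero] at hE ⊢
      simp only [add_mul, mul_add, ctmul_mul_ctmul, one_mul, mul_one, h1, h2, hE, hKK.eq]
      abel
    · have hN : (1 - cartan i j).toNat = 2 := by rw [hc]; rfl
      rw [hN] at hE ⊢
      have h2 := Uh.Kinv_mul_F i i
      rw [cartan_self, expH_two] at h2
      have h3 := Uh.Kinv_mul_F i j
      have h4 := Uh.Kinv_mul_F j i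
      rw [hc] at h3
      rw [cartan_symm, hc] at h4
      push_cast at h3 h4
      rw [serre_two_add qi_mul_qq (add_comm _ _), serre_ctmul_right 2 (Commute.refl _),
        serre_ctmul_left 2 hKK, hE, zero_ctmul, ctmul_zero, add_zero]
      · rw [ctmul_mul_ctmul, ctmul_mul_ctmul, h2, smul_ctmul, one_mul, mul_one]
      · rw [ctmul_mul_ctmul, ctmul_mul_ctmul, h3, smul_ctmul, one_mul, mul_one]
      · rw [ctmul_mul_ctmul, ctmul_mul_ctmul, h4, smul_ctmul, one_mul, mul_one]

variable (p) in
/-- The coproduct of `U_ħ gl_p`. -/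
def Delta : Uh p →ₐ[Rh] CTensor (Uh p) (Uh p) := glLift _ _ _ isGlFamily_coproduct

theorem isCoproduct_Delta : IsCoproduct (Delta p) where
  D := glLift_D _
  E := glLift_E _
  F := glLift_F _

theorem serre_zero_right (N : ℕ) (x : A) : serre N x 0 = 0 := by simp [serre]

theorem qbr_zero : qbr (0 : Rh) = 0 := by
  have := qbr_algebraMap (B := Rh) 0
  rwa [qBracket_zero, map_zero, map_zero] at this

variable (p) in
/-- The counit of `U_ħ gl_p`. -/
def counit : Uh p →ₐ[Rh] Rh :=
  glLift (fun _ => 0) (fun _ => 0) (fun _ => 0)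
    { DD := fun _ _ => rfl
      DE := fun _ _ => by simp
      DF := fun _ _ => by simp
      EF := fun _ _ => by simp [qbr_zero]
      EE := fun _ _ _ => serre_zero_right _ _
      FF := fun _ _ _ => serre_zero_right _ _ }

theorem isCounit_counit : IsCounit (counit p) where
  D := glLift_D _
  E := glLift_E _
  F := glLift_F _

end Coproduct

section VectorRep

theorem bexp_diagonal {n : Type} [Fintype n] [DecidableEq n] (c : n → ℂ) :
    bexp (Matrix.diagonal fun i => (PowerSeries.C (c i) : Rh)) =
      Matrix.diagonal fun i => (expH (c i) : Rh) := by
  have h := map_bexp (Matrix.diagonalAlgHom (n := n) (α := Rh) Rh)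
    (fun i => (PowerSeries.C (c i) : Rh))
  refine h.symm.trans (congrArg Matrix.diagonal (funext fun i => ?_))
  have h2 := map_bexp (Pi.evalAlgHom Rh (fun _ : n => Rh) i) (fun i => (PowerSeries.C (c i) : Rh))
  exact h2.trans (bexp_algebraMap (B := Rh) (c i))

theorem qbr_diagonal {n : Type} [Fintype n] [DecidableEq n] (c : n → ℂ) :
    qbr (Matrix.diagonal fun i => (PowerSeries.C (c i) : Rh)) =
      Matrix.diagonal fun i => (qBracket (c i) : Rh) := by
  have h := map_qbr (Matrix.diagonalAlgHom (n := n) (α := Rh) Rh)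
    (fun i => (PowerSeries.C (c i) : Rh))
  refine h.symm.trans (congrArg Matrix.diagonal (funext fun i => ?_))
  have h2 := map_qbr (Pi.evalAlgHom Rh (fun _ : n => Rh) i) (fun i => (PowerSeries.C (c i) : Rh))
  exact h2.trans (qbr_algebraMap (B := Rh) (c i))

variable {p : ℕ}

theorem lo_ne_up (i : Fin (p - 1)) : lo i ≠ up i := by simp [lo, up]

theorem lo_inj {i j : Fin (p - 1)} : lo i = lo j ↔ i = j := by simp [lo, Fin.ext_iff]

theorem up_inj {i j : Fin (p - 1)} : up i = up j ↔ i = j := by simp [up, Fin.ext_iff]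

/-- The weight `⟨H_i, ε_j⟩`. -/
def wt (i : Fin (p - 1)) (j : Fin p) : ℂ := if j = lo i then 1 else if j = up i then -1 else 0

theorem single_sub_single (i : Fin (p - 1)) :
    (Matrix.single (lo i) (lo i) 1 - Matrix.single (up i) (up i) 1 : Matrix (Fin p) (Fin p) Rh) =
      Matrix.diagonal fun j => PowerSeries.C (wt i j) := by
  have h := lo_ne_up i
  ext1 a b
  simp only [Matrix.sub_apply, Matrix.single_apply, Matrix.diagonal_apply, wt]
  by_cases hab : a = b
  · subst hab
    by_cases h1 : a = lo i
    · subst h1; simp [h.symm]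
    · by_cases h2 : a = up i
      · subst h2; simp [h, h.symm]
      · simp [h1, h2, Ne.symm h1, Ne.symm h2]
  · rw [if_neg hab, if_neg (fun h => hab (h.1.symm.trans h.2)),
      if_neg (fun h => hab (h.1.symm.trans h.2)), sub_zero]

theorem qBracket_wt (i : Fin (p - 1)) (j : Fin p) : (qBracket (wt i j) : Rh) =
    PowerSeries.C (wt i j) := by
  unfold wt
  split_ifs
  · rw [qBracket_one, map_one]
  · rw [qBracket_neg_one, map_neg, map_one]
  · rw [qBracket_zero, map_zero]

theorem single_mul_single {n : Type} [Fintype n] [DecidableEq n] (a b c d : n) :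
    (Matrix.single a b 1 * Matrix.single c d 1 : Matrix n n Rh) =
      if b = c then Matrix.single a d 1 else 0 := by
  split_ifs with h
  · subst h; rw [Matrix.single_mul_single_same, mul_one]
  · rw [Matrix.single_mul_single_of_ne _ _ _ _ h]

theorem isGlFamily_vectorRep : IsGlFamily (B := Matrix (Fin p) (Fin p) Rh)
    (fun i => Matrix.single (lo i) (up i) 1) (fun i => Matrix.single (up i) (lo i) 1)
    (fun i => Matrix.single i i 1) where
  DD i j := by
    rw [single_mul_single, single_mul_single]
    by_cases h : i = j
    · subst h; rfl
    · rw [if_neg h, if_neg (Ne.symm h)]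
  DE i j := by
    rw [single_mul_single, single_mul_single, sub_smul]
    congr 1
    · split_ifs with h
      · rw [h, one_smul]
      · rw [zero_smul]
    · split_ifs with h h' h'
      · rw [h, one_smul]
      · exact absurd h.symm h'
      · exact absurd h'.symm h
      · rw [zero_smul]
  DF i j := by
    rw [single_mul_single, single_mul_single, sub_smul, neg_sub]
    congr 1
    · split_ifs with h
      · rw [h, one_smul]
      · rw [zero_smul]
    · split_ifs with h h' h'
      · rw [h, one_smul]
      · exact absurd h.symm h'
      · exact absurd h'.symm h
      · rw [zero_smul]
  EF i j := by
    rw [single_mul_single, single_mul_single, single_sub_single, qbr_diagonal]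
    simp only [qBracket_wt, ← single_sub_single, lo_inj, up_inj]
    split_ifs with h1 h2 h2
    · subst h1; rfl
    · exact absurd h1.symm h2
    · exact absurd h2.symm h1
    · exact sub_zero _
  EE i j h := by
    have h1 : lo i ≠ up i := lo_ne_up i
    rcases cartan_cases h with hc | hc
    · have h2 : up j ≠ lo i := fun he => by
        simp only [up, lo, Fin.mk.injEq] at he
        rw [cartan, if_neg h, if_pos (Or.inr he)] at hc
        exact absurd hc (by norm_num)
      have h3 : up i ≠ lo j := fun he => by
        simp only [up, lo, Fin.mk.injEq] at he
        rw [cartan, if_neg h, if_pos (Or.inl he)] at hc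
        exact absurd hc (by norm_num)
      rw [hc]
      change serre 1 _ _ = 0
      rw [serre_one, single_mul_single, single_mul_single, if_neg h2, if_neg h3, sub_zero]
    · have h2 : ¬ (up i = lo j ∧ up j = lo i) := by
        rintro ⟨he, he'⟩
        simp only [up, lo, Fin.mk.injEq] at he he'
        omega
      rw [hc]
      change serre 2 _ _ = 0
      rw [serre_two, mul_assoc, single_mul_single, if_neg h1.symm, mul_zero, zero_sub, zero_mul,
        add_zero, single_mul_single]
      split_ifs with h3
      · rw [single_mul_single, if_neg (fun h4 => h2 ⟨h3, h4⟩), smul_zero, neg_zero]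
      · rw [zero_mul, smul_zero, neg_zero]
  FF i j h := by
    have h1 : lo i ≠ up i := lo_ne_up i
    rcases cartan_cases h with hc | hc
    · have h2 : lo j ≠ up i := fun he => by
        simp only [up, lo, Fin.mk.injEq] at he
        rw [cartan, if_neg h, if_pos (Or.inl he.symm)] at hc
        exact absurd hc (by norm_num)
      have h3 : lo i ≠ up j := fun he => by
        simp only [up, lo, Fin.mk.injEq] at he
        rw [cartan, if_neg h, if_pos (Or.inr he.symm)] at hc
        exact absurd hc (by norm_num)
      rw [hc]
      change serre 1 _ _ = 0
      rw [serre_one, single_mul_single, single_mul_single, if_neg h2, if_neg h3, sub_zero]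
    · have h2 : ¬ (lo i = up j ∧ lo j = up i) := by
        rintro ⟨he, he'⟩
        simp only [up, lo, Fin.mk.injEq] at he he'
        omega
      rw [hc]
      change serre 2 _ _ = 0
      rw [serre_two, mul_assoc, single_mul_single, if_neg h1, mul_zero, zero_sub, zero_mul,
        add_zero, single_mul_single]
      split_ifs with h3
      · rw [single_mul_single, if_neg (fun h4 => h2 ⟨h3, h4⟩), smul_zero, neg_zero]
      · rw [zero_mul, smul_zero, neg_zero]

variable (p) in
/-- The vector representation of `U_ħ gl_p`. -/
def vectorRep : Uh p →ₐ[Rh] Matrix (Fin p) (Fin p) Rh := glLift _ _ _ isGlFamily_vectorRep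

theorem isVectorRep_vectorRep : IsVectorRep (vectorRep p) where
  D := glLift_D _
  E := glLift_E _
  F := glLift_F _

theorem vectorRep_H (i : Fin (p - 1)) :
    vectorRep p (Uh.H i) = Matrix.diagonal fun j => PowerSeries.C (wt i j) := by
  rw [Uh.H, map_sub, isVectorRep_vectorRep.D, isVectorRep_vectorRep.D, single_sub_single]

theorem vectorRep_K (i : Fin (p - 1)) :
    vectorRep p (Uh.K i) = Matrix.diagonal fun j => expH (wt i j) := by
  rw [Uh.K_eq, map_bexp, vectorRep_H, bexp_diagonal]

theorem vectorRep_Kinv (i : Fin (p - 1)) :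
    vectorRep p (Uh.Kinv i) = Matrix.diagonal fun j => expH (-wt i j) := by
  rw [Uh.Kinv_eq, map_bexp, map_neg, vectorRep_H, ← bexp_diagonal]
  congr 1
  ext1 a b
  by_cases h : a = b <;> simp [h]

end VectorRep

/-! ### The convolution algebra `Hom(U_ħ gl_p, S)` -/

section Coassociativity

variable {p : ℕ}

theorem Delta_H (i : Fin (p - 1)) :
    Delta p (Uh.H i) = inclL (Uh p) (Uh p) (Uh.H i) + inclR (Uh p) (Uh p) (Uh.H i) := by
  rw [Uh.H, map_sub, isCoproduct_Delta.D, isCoproduct_Delta.D, inclL_apply, inclR_apply, sub_ctmul,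
    ctmul_sub]
  abel

theorem Delta_K (i : Fin (p - 1)) : Delta p (Uh.K i) = ctmul (Uh.K i) (Uh.K i) := by
  rw [Uh.K_eq, map_bexp, Delta_H,
    bexp_add (a := inclL _ _ (Uh.H i)) (b := inclR _ _ (Uh.H i)) (commute_ctmul _ _), ← map_bexp,
    ← map_bexp, inclL_apply, inclR_apply, ctmul_mul_ctmul, one_mul, mul_one]

theorem Delta_Kinv (i : Fin (p - 1)) : Delta p (Uh.Kinv i) = ctmul (Uh.Kinv i) (Uh.Kinv i) := by
  rw [Uh.Kinv_eq, map_bexp, map_neg, Delta_H, neg_add, ← map_neg, ← map_neg,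
    bexp_add (a := inclL _ _ (-Uh.H i)) (b := inclR _ _ (-Uh.H i)) (commute_ctmul _ _), ← map_bexp,
    ← map_bexp, inclL_apply, inclR_apply, ctmul_mul_ctmul, one_mul, mul_one]

theorem counit_K (i : Fin (p - 1)) : counit p (Uh.K i) = 1 := by
  rw [Uh.K_eq, map_bexp, Uh.H, map_sub, isCounit_counit.D, isCounit_counit.D, sub_zero, bexp_zero]

theorem counit_Kinv (i : Fin (p - 1)) : counit p (Uh.Kinv i) = 1 := by
  rw [Uh.Kinv_eq, map_bexp, map_neg, Uh.H, map_sub, isCounit_counit.D, isCounit_counit.D, sub_zero,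
    neg_zero, bexp_zero]

/-- Two homomorphisms out of `U_ħ gl_p` which agree on `E_i`, `F_i`, `D_i` are equal. -/
theorem Uh.algHom_ext {B : Type} [Ring B] [Algebra Rh B] [IsHausdorff hI B] {f g : Uh p →ₐ[Rh] B}
    (hE : ∀ i, f (Uh.E i) = g (Uh.E i)) (hF : ∀ i, f (Uh.F i) = g (Uh.F i))
    (hD : ∀ i, f (Uh.D i) = g (Uh.D i)) : f = g :=
  PresAlg.algHom_ext fun i => by
    cases i with
    | E i => exact hE i
    | F i => exact hF i
    | D i => exact hD i

theorem commute_of_ctmul {A B C : Type} [Ring A] [Algebra Rh A] [Ring B] [Algebra Rh B] [Ring C]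
    [Algebra Rh C] [IsHausdorff hI C] (f : CTensor A B →ₐ[Rh] C) (c : C)
    (h : ∀ a b, Commute (f (ctmul a b)) c) (z : CTensor A B) : Commute (f z) c :=
  CTensor.apply_ext (LinearMap.mulRight Rh c ∘ₗ f.toLinearMap)
    (LinearMap.mulLeft Rh c ∘ₗ f.toLinearMap) h z

theorem commute_inclL_inclR_comp {A B D : Type} [Ring A] [Algebra Rh A] [Ring B] [Algebra Rh B]
    [Ring D] [Algebra Rh D] (g : D →ₐ[Rh] B) (a : A) (d : D) :
    Commute (inclL A B a) (((inclR A B).comp g) d) := commute_ctmul _ _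

theorem counit_commute (x y : Uh p) :
    Commute (((Algebra.ofId Rh (Uh p)).comp (counit p)) x) ((AlgHom.id Rh (Uh p)) y) :=
  Algebra.commutes (R := Rh) (A := Uh p) (counit p x) y

variable (p) in
/-- The homomorphism `(x ⊗ y) ⊗ z ↦ x ⊗ (y ⊗ z)`, restricted to the first two factors. -/
def tripleL : CTensor (Uh p) (Uh p) →ₐ[Rh] CTensor (Uh p) (CTensor (Uh p) (Uh p)) :=
  liftC (inclL _ _) ((inclR _ _).comp (inclL _ _)) (commute_inclL_inclR_comp _)

theorem tripleL_ctmul (a b : Uh p) : tripleL p (ctmul a b) = ctmul a (ctmul b 1) := by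
  rw [tripleL, liftC_ctmul, AlgHom.comp_apply, inclL_apply, inclL_apply, inclR_apply,
    ctmul_mul_ctmul, mul_one, one_mul]

theorem tripleL_commute (x : CTensor (Uh p) (Uh p)) (y : Uh p) :
    Commute (tripleL p x) (((inclR _ _).comp (inclR _ _) :
      Uh p →ₐ[Rh] CTensor (Uh p) (CTensor (Uh p) (Uh p))) y) := by
  refine commute_of_ctmul _ _ (fun a b => ?_) x
  rw [tripleL_ctmul, AlgHom.comp_apply, inclR_apply, inclR_apply, Commute, SemiconjBy,
    ctmul_mul_ctmul, ctmul_mul_ctmul, ctmul_mul_ctmul, ctmul_mul_ctmul]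
  simp only [one_mul, mul_one]

theorem tripleL_comp_commute (x y : Uh p) :
    Commute (((tripleL p).comp (Delta p)) x) (((inclR _ _).comp (inclR _ _) :
      Uh p →ₐ[Rh] CTensor (Uh p) (CTensor (Uh p) (Uh p))) y) := tripleL_commute _ _

variable (p) in
/-- The iterated coproduct `(Δ ⊗ 1) Δ`. -/
def Delta3L : Uh p →ₐ[Rh] CTensor (Uh p) (CTensor (Uh p) (Uh p)) :=
  (liftC ((tripleL p).comp (Delta p)) ((inclR _ _).comp (inclR _ _))
    tripleL_comp_commute).comp (Delta p)

variable (p) in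
/-- The iterated coproduct `(1 ⊗ Δ) Δ`. -/
def Delta3R : Uh p →ₐ[Rh] CTensor (Uh p) (CTensor (Uh p) (Uh p)) :=
  (liftC (inclL _ _) ((inclR _ _).comp (Delta p)) (commute_inclL_inclR_comp _)).comp (Delta p)

theorem Delta_coassoc : Delta3L p = Delta3R p := by
  have hL : ∀ a b : Uh p, liftC ((tripleL p).comp (Delta p)) ((inclR _ _).comp (inclR _ _))
      (tripleL_comp_commute) (ctmul a b) =
        tripleL p (Delta p a) * ctmul 1 (ctmul 1 b) := fun a b => liftC_ctmul _ _ _ _ _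
  have hR : ∀ a b : Uh p, liftC (inclL _ _) ((inclR _ _).comp (Delta p))
      (commute_inclL_inclR_comp _) (ctmul a b) = ctmul a (Delta p b) := fun a b => by
    rw [liftC_ctmul, inclL_apply, AlgHom.comp_apply, inclR_apply, ctmul_mul_ctmul, one_mul, mul_one]
  refine Uh.algHom_ext (fun i => ?_) (fun i => ?_) (fun i => ?_)
  · simp only [Delta3L, Delta3R, AlgHom.comp_apply, isCoproduct_Delta.E, map_add, hL, hR, Delta_K,
      tripleL_ctmul, map_one, add_mul, ctmul_mul_ctmul, one_mul, mul_one, ctmul_add, add_assoc]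
  · simp only [Delta3L, Delta3R, AlgHom.comp_apply, isCoproduct_Delta.F, map_add, hL, hR,
      Delta_Kinv, tripleL_ctmul, map_one, ctmul_mul_ctmul, one_mul, mul_one, ctmul_add,
      add_assoc, ctmul_one_one]
  · simp only [Delta3L, Delta3R, AlgHom.comp_apply, isCoproduct_Delta.D, map_add, hL, hR,
      tripleL_ctmul, map_one, one_mul, mul_one, ctmul_add, add_assoc, ctmul_one_one]

theorem counit_left (x : Uh p) : liftC ((Algebra.ofId Rh (Uh p)).comp (counit p)) (AlgHom.id Rh _)
    counit_commute (Delta p x) = x := by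
  have h : (liftC ((Algebra.ofId Rh (Uh p)).comp (counit p)) (AlgHom.id Rh _)
    counit_commute).comp (Delta p) = AlgHom.id Rh _ := by
    refine Uh.algHom_ext (fun i => ?_) (fun i => ?_) (fun i => ?_)
    · simp [isCoproduct_Delta.E, liftC_ctmul, isCounit_counit.E]
    · simp [isCoproduct_Delta.F, liftC_ctmul, isCounit_counit.F, counit_Kinv]
    · simp [isCoproduct_Delta.D, liftC_ctmul, isCounit_counit.D]
  exact DFunLike.congr_fun h x

theorem counit_right (x : Uh p) : liftC (AlgHom.id Rh _) ((Algebra.ofId Rh (Uh p)).comp (counit p))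
    (fun _ _ => (counit_commute _ _).symm) (Delta p x) = x := by
  have h : (liftC (AlgHom.id Rh _) ((Algebra.ofId Rh (Uh p)).comp (counit p))
    (fun _ _ => (counit_commute _ _).symm)).comp (Delta p) = AlgHom.id Rh _ := by
    refine Uh.algHom_ext (fun i => ?_) (fun i => ?_) (fun i => ?_)
    · simp [isCoproduct_Delta.E, liftC_ctmul, isCounit_counit.E, counit_K]
    · simp [isCoproduct_Delta.F, liftC_ctmul, isCounit_counit.F]
    · simp [isCoproduct_Delta.D, liftC_ctmul, isCounit_counit.D]
  exact DFunLike.congr_fun h x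

end Coassociativity

section Conv

variable (p : ℕ) (S : Type) [Ring S] [Algebra Rh S]

/-- The space `Hom(U_ħ gl_p, S)`, which is an algebra under convolution. -/
def Conv : Type := Uh p →ₗ[Rh] S

instance : AddCommGroup (Conv p S) := inferInstanceAs (AddCommGroup (Uh p →ₗ[Rh] S))

instance : Module Rh (Conv p S) := inferInstanceAs (Module Rh (Uh p →ₗ[Rh] S))

variable {p S}

/-- The linear map underlying an element of the convolution algebra. -/
def Conv.lin : Conv p S ≃ₗ[Rh] (Uh p →ₗ[Rh] S) := LinearEquiv.refl Rh (Uh p →ₗ[Rh] S)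

theorem Conv.ext {f g : Conv p S} (h : ∀ x, f.lin x = g.lin x) : f = g := LinearMap.ext h

variable [IsAdicComplete hI S]

/-- The scalar multiples of the counit. -/
def Conv.constLin (s : S) : Uh p →ₗ[Rh] S := (counit p).toLinearMap.smulRight s

/-- The convolution product. -/
def Conv.mulLin (f g : Uh p →ₗ[Rh] S) : Uh p →ₗ[Rh] S :=
  evalTensor (LinearMap.mul Rh S) f g ∘ₗ (Delta p).toLinearMap

theorem Conv.mulLin_assoc (f g h : Uh p →ₗ[Rh] S) :
    Conv.mulLin (Conv.mulLin f g) h = Conv.mulLin f (Conv.mulLin g h) := by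
  -- both sides are the evaluation of `f ⊗ g ⊗ h` on the iterated coproduct
  let e := evalTensor (LinearMap.mul Rh S) f (evalTensor (LinearMap.mul Rh S) g h)
  have h1 : ∀ (z : CTensor (Uh p) (Uh p)) (c : Uh p), e (tripleL p z * ctmul 1 (ctmul 1 c)) =
      evalTensor (LinearMap.mul Rh S) f g z * h c := by
    intro z c
    refine CTensor.apply_ext (e ∘ₗ LinearMap.mulRight Rh (ctmul 1 (ctmul 1 c)) ∘ₗ
      (tripleL p).toLinearMap)
      (LinearMap.mulRight Rh (h c) ∘ₗ evalTensor (LinearMap.mul Rh S) f g) (fun a b => ?_) z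
    simp only [LinearMap.comp_apply, AlgHom.toLinearMap_apply, LinearMap.mulRight_apply,
      tripleL_ctmul, ctmul_mul_ctmul, one_mul, mul_one, e, evalTensor_ctmul, LinearMap.mul_apply',
      mul_assoc]
  have h2 : Conv.mulLin (Conv.mulLin f g) h = e ∘ₗ (Delta3L p).toLinearMap := by
    refine LinearMap.ext fun x => ?_
    refine CTensor.apply_ext (evalTensor (LinearMap.mul Rh S) (Conv.mulLin f g) h)
      (e ∘ₗ (liftC ((tripleL p).comp (Delta p))
      ((inclR _ _).comp (inclR _ _)) tripleL_comp_commute).toLinearMap) (fun a b => ?_) _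
    rw [evalTensor_ctmul, LinearMap.comp_apply, AlgHom.toLinearMap_apply, liftC_ctmul]
    exact (h1 (Delta p a) b).symm
  have h3 : Conv.mulLin f (Conv.mulLin g h) = e ∘ₗ (Delta3R p).toLinearMap := by
    refine LinearMap.ext fun x => ?_
    refine CTensor.apply_ext (evalTensor (LinearMap.mul Rh S) f (Conv.mulLin g h))
      (e ∘ₗ (liftC (inclL _ _) ((inclR _ _).comp (Delta p))
      (commute_inclL_inclR_comp _)).toLinearMap) (fun a b => ?_) _
    rw [evalTensor_ctmul, LinearMap.comp_apply, AlgHom.toLinearMap_apply, liftC_ctmul, inclL_apply,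
      AlgHom.comp_apply, inclR_apply, ctmul_mul_ctmul, one_mul, mul_one, evalTensor_ctmul]
    rfl
  rw [h2, h3, Delta_coassoc]

theorem Conv.constLin_mulLin (s : S) (g : Uh p →ₗ[Rh] S) :
    Conv.mulLin (Conv.constLin s) g = LinearMap.mulLeft Rh s ∘ₗ g := by
  refine LinearMap.ext fun x => ?_
  have := CTensor.apply_ext (evalTensor (LinearMap.mul Rh S) (Conv.constLin s) g)
    (LinearMap.mulLeft Rh s ∘ₗ g ∘ₗ (liftC ((Algebra.ofId Rh (Uh p)).comp (counit p))
      (AlgHom.id Rh _) counit_commute).toLinearMap) (fun a b => by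
    rw [evalTensor_ctmul, LinearMap.comp_apply, LinearMap.comp_apply, AlgHom.toLinearMap_apply,
      liftC_ctmul]
    simp [Conv.constLin, Algebra.ofId_apply, ← Algebra.smul_def]) (Delta p x)
  refine this.trans ?_
  rw [LinearMap.comp_apply, LinearMap.comp_apply, AlgHom.toLinearMap_apply, counit_left]
  rfl

theorem Conv.mulLin_constLin (s : S) (g : Uh p →ₗ[Rh] S) :
    Conv.mulLin g (Conv.constLin s) = LinearMap.mulRight Rh s ∘ₗ g := by
  refine LinearMap.ext fun x => ?_
  have := CTensor.apply_ext (evalTensor (LinearMap.mul Rh S) g (Conv.constLin s))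
    (LinearMap.mulRight Rh s ∘ₗ g ∘ₗ (liftC (AlgHom.id Rh _)
      ((Algebra.ofId Rh (Uh p)).comp (counit p))
      (fun _ _ => (counit_commute _ _).symm)).toLinearMap) (fun a b => by
    rw [evalTensor_ctmul, LinearMap.comp_apply, LinearMap.comp_apply, AlgHom.toLinearMap_apply,
      liftC_ctmul]
    simp [Conv.constLin, Algebra.ofId_apply, ← Algebra.commutes, ← Algebra.smul_def]) (Delta p x)
  refine this.trans ?_
  rw [LinearMap.comp_apply, LinearMap.comp_apply, AlgHom.toLinearMap_apply, counit_right]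
  rfl

theorem Conv.mulLin_ext {f f' g g' h h' : Uh p →ₗ[Rh] S} (c : Rh)
    (hc : ∀ a b, f a * g b + c • (f' a * g' b) = h a * h' b) :
    Conv.mulLin f g + c • Conv.mulLin f' g' = Conv.mulLin h h' := by
  refine LinearMap.ext fun x => CTensor.apply_ext (evalTensor (LinearMap.mul Rh S) f g +
    c • evalTensor (LinearMap.mul Rh S) f' g') (evalTensor (LinearMap.mul Rh S) h h')
    (fun a b => ?_) (Delta p x)
  rw [LinearMap.add_apply, LinearMap.smul_apply, evalTensor_ctmul, evalTensor_ctmul,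
    evalTensor_ctmul]
  exact hc a b

instance : Ring (Conv p S) :=
  { (inferInstance : AddCommGroup (Conv p S)) with
    mul := fun f g => Conv.mulLin f.lin g.lin
    one := Conv.constLin 1
    mul_assoc := fun f g h => Conv.mulLin_assoc f.lin g.lin h.lin
    one_mul := fun f => (Conv.constLin_mulLin 1 f.lin).trans (LinearMap.ext fun x => one_mul _)
    mul_one := fun f => (Conv.mulLin_constLin 1 f.lin).trans (LinearMap.ext fun x => mul_one _)
    zero_mul := fun f => LinearMap.ext fun x =>
      CTensor.apply_ext (evalTensor (LinearMap.mul Rh S) 0 f.lin) 0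
        (fun a b => (evalTensor_ctmul _ _ _ _ _).trans (zero_mul _)) (Delta p x)
    mul_zero := fun f => LinearMap.ext fun x =>
      CTensor.apply_ext (evalTensor (LinearMap.mul Rh S) f.lin 0) 0
        (fun a b => (evalTensor_ctmul _ _ _ _ _).trans (mul_zero _)) (Delta p x)
    left_distrib := fun f g h => by
      have := Conv.mulLin_ext (f := f.lin) (g := g.lin) (f' := f.lin) (g' := h.lin)
        (h := f.lin) (h' := g.lin + h.lin) 1 (fun a b => by
          rw [one_smul, ← mul_add]; rfl)
      rw [one_smul] at this
      exact this.symm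
    right_distrib := fun f g h => by
      have := Conv.mulLin_ext (f := f.lin) (g := h.lin) (f' := g.lin) (g' := h.lin)
        (h := f.lin + g.lin) (h' := h.lin) 1 (fun a b => by
          rw [one_smul, ← add_mul]; rfl)
      rw [one_smul] at this
      exact this.symm }

instance : Algebra Rh (Conv p S) :=
  Algebra.ofModule
    (fun c f g => LinearMap.ext fun x => CTensor.apply_ext
      (evalTensor (LinearMap.mul Rh S) (c • f.lin) g.lin)
      (c • evalTensor (LinearMap.mul Rh S) f.lin g.lin) (fun a b => by
        rw [LinearMap.smul_apply, evalTensor_ctmul, evalTensor_ctmul]; simp) (Delta p x))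
    (fun c f g => LinearMap.ext fun x => CTensor.apply_ext
      (evalTensor (LinearMap.mul Rh S) f.lin (c • g.lin))
      (c • evalTensor (LinearMap.mul Rh S) f.lin g.lin) (fun a b => by
        rw [LinearMap.smul_apply, evalTensor_ctmul, evalTensor_ctmul]; simp) (Delta p x))

instance : IsAdicComplete hI (Conv p S) :=
  inferInstanceAs (IsAdicComplete hI (Uh p →ₗ[Rh] S))

theorem Conv.mul_lin (f g : Conv p S) (x : Uh p) :
    (f * g).lin x = evalTensor (LinearMap.mul Rh S) f.lin g.lin (Delta p x) := rfl

theorem Conv.one_lin (x : Uh p) : (1 : Conv p S).lin x = counit p x • 1 := rfl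

variable (p S) in
/-- The evaluation `f ↦ f 1`, as an algebra homomorphism. -/
def Conv.evalOne : Conv p S →ₐ[Rh] S :=
  AlgHom.ofLinearMap ((LinearMap.applyₗ (R := Rh) (1 : Uh p)) ∘ₗ Conv.lin.toLinearMap)
    (by change counit p 1 • (1 : S) = 1; rw [map_one, one_smul])
    (fun f g => by
      change evalTensor (LinearMap.mul Rh S) f.lin g.lin (Delta p 1) = f.lin 1 * g.lin 1
      rw [map_one, ← ctmul_one_one, evalTensor_ctmul]; rfl)

variable (p S) in
/-- The homomorphism `s ↦ (x ↦ ε(x) s)`. -/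
def Conv.const : S →ₐ[Rh] Conv p S :=
  AlgHom.ofLinearMap (Conv.lin.symm.toLinearMap ∘ₗ
      LinearMap.smulRightₗ (R := Rh) (counit p).toLinearMap) rfl
    (fun s t => ((Conv.constLin_mulLin s (Conv.constLin t)).trans
      (LinearMap.ext fun x => by simp [Conv.constLin]; rfl)).symm)

theorem Conv.const_mul_lin (s : S) (f : Conv p S) (x : Uh p) :
    (Conv.const p S s * f).lin x = s * f.lin x :=
  DFunLike.congr_fun (Conv.constLin_mulLin s f.lin) x

theorem Conv.mul_const_lin (s : S) (f : Conv p S) (x : Uh p) :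
    (f * Conv.const p S s).lin x = f.lin x * s :=
  DFunLike.congr_fun (Conv.mulLin_constLin s f.lin) x

variable {S' : Type} [Ring S'] [Algebra Rh S'] [IsAdicComplete hI S']

variable (p) in
/-- Composition with an algebra homomorphism is a homomorphism of convolution algebras. -/
def Conv.map (φ : S →ₐ[Rh] S') : Conv p S →ₐ[Rh] Conv p S' :=
  AlgHom.ofLinearMap (LinearMap.compRight Rh φ.toLinearMap)
    (Conv.ext fun x => by
      change φ (counit p x • 1) = counit p x • 1
      rw [map_smul, map_one])
    (fun f g => Conv.ext fun x => CTensor.apply_ext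
      (φ.toLinearMap ∘ₗ evalTensor (LinearMap.mul Rh S) f.lin g.lin)
      (evalTensor (LinearMap.mul Rh S') (φ.toLinearMap ∘ₗ f.lin) (φ.toLinearMap ∘ₗ g.lin))
      (fun a b => by
        rw [LinearMap.comp_apply, evalTensor_ctmul, evalTensor_ctmul]
        exact map_mul φ _ _) (Delta p x))

theorem Conv.map_lin (φ : S →ₐ[Rh] S') (f : Conv p S) (x : Uh p) :
    (Conv.map p φ f).lin x = φ (f.lin x) := rfl

end Conv

/-! ### The `RTT` relations and homomorphisms out of `S_ħ(k,n)` -/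

section RTT

variable {k l n : ℕ} {B C : Type} [Ring B] [Algebra Rh B] [Ring C] [Algebra Rh C]

/-- The permuting coefficients of the `R`-matrix. -/
def rc (i a : Fin k) : Rh := if i = a then qi else 1

/-- The non-permuting coefficients of the `R`-matrix. -/
def lc (i a : Fin k) : Rh := if i < a then qq - qi else 0

theorem rc_comm (i a : Fin k) : rc i a = rc a i := by simp only [rc, eq_comm]

theorem rc_self (i : Fin k) : rc i i = qi := if_pos rfl

theorem lc_self (i : Fin k) : lc i i = 0 := if_neg (lt_irrefl i)

/-- The entries of the matrix `T` satisfy `T₁ T₂ R = R T₁ T₂`, where the square matrix `R` has the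
entries `rc` on the flip and `-lc` on the diagonal.  For the column and the row indices the matrices
`R` have different sizes. -/
def RTT (T : Fin k → Fin n → B) : Prop :=
  ∀ i a j b, rc j b • (T i b * T a j) - lc j b • (T i j * T a b) =
    rc i a • (T a j * T i b) - lc i a • (T i j * T a b)

theorem RTT.map {T : Fin k → Fin n → B} (h : RTT T) (f : B →ₐ[Rh] C) :
    RTT fun i j => f (T i j) := by
  intro i a j b
  have := congrArg f (h i a j b)
  simpa only [map_sub, map_smul, map_mul] using this

/-- The relation satisfied by the tensor `P_{ij,ab} = T_{ij} T_{ab}` of an `RTT` matrix `T`.  It is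
also used for tensors which are not of this form, such as `L_{ij} (L_{ab} f)` for operators `L`. -/
def RTT4 (P : Fin k → Fin n → Fin k → Fin n → B) : Prop :=
  ∀ i a j b, rc j b • P i b a j - lc j b • P i j a b = rc i a • P a j i b - lc i a • P i j a b

/-- The relations compose: the middle indices carry the same matrix `R` on both sides. -/
theorem RTT4.mul {P : Fin k → Fin l → Fin k → Fin l → B} {Q : Fin l → Fin n → Fin l → Fin n → B}
    (hP : RTT4 P) (hQ : RTT4 Q) : RTT4 fun i j a b => ∑ c, ∑ d, P i c a d * Q c j d b := by
  intro i a j b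
  simp only [Finset.smul_sum, ← Finset.sum_sub_distrib]
  have h1 : ∀ c d, rc j b • (P i c a d * Q c b d j) - lc j b • (P i c a d * Q c j d b) =
      rc c d • (P i c a d * Q d j c b) - lc c d • (P i c a d * Q c j d b) := by
    intro c d
    rw [← mul_smul_comm (rc j b), ← mul_smul_comm (lc j b), ← mul_sub, hQ c d j b, mul_sub,
      mul_smul_comm, mul_smul_comm]
  have h2 : ∀ c d, rc i a • (P a c i d * Q c j d b) - lc i a • (P i c a d * Q c j d b) =
      rc c d • (P i d a c * Q c j d b) - lc c d • (P i c a d * Q c j d b) := by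
    intro c d
    rw [← smul_mul_assoc (rc i a), ← smul_mul_assoc (lc i a), ← sub_mul, ← hP i a c d, sub_mul,
      smul_mul_assoc, smul_mul_assoc]
  simp only [h1, h2, Finset.sum_sub_distrib]
  congr 1
  rw [Finset.sum_comm]
  exact Finset.sum_congr rfl fun c _ => Finset.sum_congr rfl fun d _ => by rw [rc_comm]

/-- The product of two `RTT` matrices with mutually commuting entries is an `RTT` matrix. -/
theorem RTT.mul {S : Fin k → Fin l → B} {T : Fin l → Fin n → B} (hS : RTT S) (hT : RTT T)
    (h : ∀ i c d j, Commute (S i c) (T d j)) : RTT fun i j => ∑ c, S i c * T c j := by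
  have key : ∀ i a j b, (∑ c, S i c * T c j) * (∑ d, S a d * T d b) =
      ∑ c, ∑ d, (S i c * S a d) * (T c j * T d b) := by
    intro i a j b
    rw [Finset.sum_mul_sum]
    refine Finset.sum_congr rfl fun c _ => Finset.sum_congr rfl fun d _ => ?_
    rw [mul_assoc, mul_assoc, ← mul_assoc (T c j), ← (h a d c j).eq, mul_assoc]
  intro i a j b
  simp only [key]
  exact RTT4.mul (P := fun i j a b => S i j * S a b)
    (Q := fun i j a b => T i j * T a b) hS hT i a j b

section Consequences

variable {T : Fin k → Fin n → B} (hT : RTT T)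
include hT

theorem RTT.comm {i a : Fin k} {j b : Fin n} (h : i < a) (h' : b < j) :
    T i j * T a b = T a b * T i j := by
  have := hT i a b j
  rw [rc, if_neg h'.ne, rc, if_neg h.ne, lc, if_pos h', lc, if_pos h, one_smul, one_smul] at this
  exact sub_left_injective this

theorem RTT.col {i a : Fin k} (h : i < a) (j : Fin n) : T i j * T a j = qi • (T a j * T i j) := by
  have := hT i a j j
  rw [rc_self, lc_self, rc, if_neg h.ne, lc, if_pos h, one_smul, zero_smul, sub_zero,
    eq_sub_iff_add_eq, ← add_smul, add_sub_cancel] at this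
  rw [← this, smul_smul, qi_mul_qq, one_smul]

theorem RTT.row (i : Fin k) {j b : Fin n} (h : j < b) : T i j * T i b = qi • (T i b * T i j) := by
  have := hT i i j b
  rw [rc_self, lc_self, rc, if_neg h.ne, lc, if_pos h, one_smul, zero_smul, sub_zero,
    sub_eq_iff_eq_add, ← add_smul, add_sub_cancel] at this
  rw [this, smul_smul, qi_mul_qq, one_smul]

theorem RTT.cross {i a : Fin k} {j b : Fin n} (h : i < a) (h' : j < b) :
    T i j * T a b = T a b * T i j - (qq - qi) • (T a j * T i b) := by
  have := hT i a b j
  rw [rc, if_neg h'.ne', rc, if_neg h.ne, lc, if_neg h'.not_gt, lc, if_pos h, one_smul, one_smul,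
    zero_smul, sub_zero] at this
  rw [this, hT.comm h h']

end Consequences

/-- The defining relations of `S_ħ(k,n)` imply the `RTT` relations. -/
theorem RTT.of_relations {T : Fin k → Fin n → B}
    (comm : ∀ {i a : Fin k} {j b : Fin n}, i < a → b < j → T i j * T a b = T a b * T i j)
    (col : ∀ {i a : Fin k} (j : Fin n), i < a → T i j * T a j = qi • (T a j * T i j))
    (row : ∀ (i : Fin k) {j b : Fin n}, j < b → T i j * T i b = qi • (T i b * T i j))
    (cross : ∀ {i a : Fin k} {j b : Fin n}, i < a → j < b →
      T i j * T a b = T a b * T i j - (qq - qi) • (T a j * T i b)) : RTT T := by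
  have col' : ∀ {i a : Fin k} (j : Fin n), i < a → T a j * T i j = qq • (T i j * T a j) := by
    intro i a j h
    rw [col j h, smul_smul, qq_mul_qi, one_smul]
  have row' : ∀ (i : Fin k) {j b : Fin n}, j < b → T i b * T i j = qq • (T i j * T i b) := by
    intro i j b h
    rw [row i h, smul_smul, qq_mul_qi, one_smul]
  intro i a j b
  rcases lt_trichotomy i a with hia | rfl | hia
  · rcases lt_trichotomy j b with hjb | rfl | hjb
    · rw [rc, if_neg hjb.ne, rc, if_neg hia.ne, lc, if_pos hjb, lc, if_pos hia, comm hia hjb]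
    · rw [rc_self, lc_self, rc, if_neg hia.ne, lc, if_pos hia, col' j hia, one_smul,
        zero_smul, sub_zero, sub_smul, sub_sub_cancel]
    · rw [rc, if_neg hjb.ne', rc, if_neg hia.ne, lc, if_neg hjb.not_gt, lc, if_pos hia,
        cross hia hjb, one_smul, one_smul, zero_smul, sub_zero, comm hia hjb]
  · rcases lt_trichotomy j b with hjb | rfl | hjb
    · rw [rc_self, lc_self, rc, if_neg hjb.ne, lc, if_pos hjb, row' i hjb, one_smul,
        zero_smul, sub_zero, sub_smul, sub_sub_cancel]
    · rw [rc_self, rc_self, lc_self, lc_self]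
    · rw [rc_self, lc_self, rc, if_neg hjb.ne', lc, if_neg hjb.not_gt, one_smul, row i hjb]
  · rcases lt_trichotomy j b with hjb | rfl | hjb
    · rw [rc, if_neg hjb.ne, rc, if_neg hia.ne', lc, if_pos hjb, lc, if_neg hia.not_gt, one_smul,
        one_smul, zero_smul, sub_zero, cross hia hjb, ← comm hia hjb]
    · rw [rc_self, lc_self, rc, if_neg hia.ne', lc, if_neg hia.not_gt, one_smul, col j hia]
    · rw [rc, if_neg hjb.ne', rc, if_neg hia.ne', lc, if_neg hjb.not_gt, lc, if_neg hia.not_gt,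
        comm hia hjb]

variable (k n) in
/-- The generators of `S_ħ(k,n)` form an `RTT` matrix. -/
theorem Sh.rtt_X : RTT (Sh.X (k := k) (n := n)) :=
  RTT.of_relations (fun h h' => sub_eq_zero.mp (Sh.rel (MatRel.comm _ _ _ _ (Or.inl ⟨h, h'⟩))))
    (fun _ h => sub_eq_zero.mp (Sh.rel (MatRel.qcomm _ _ _ _ (Or.inl ⟨h, rfl⟩))))
    (fun _ _ _ h => sub_eq_zero.mp (Sh.rel (MatRel.qcomm _ _ _ _ (Or.inr ⟨rfl, h⟩))))
    (fun h h' => sub_eq_zero.mp (Sh.rel (MatRel.cross _ _ _ _ ⟨h, h'⟩)))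

/-- The homomorphism out of `S_ħ(k,n)` defined by an `RTT` matrix. -/
def Sh.lift [IsAdicComplete hI B] (T : Fin k → Fin n → B) (hT : RTT T) : Sh k n →ₐ[Rh] B :=
  PresAlg.lift (fun e => T e.1 e.2) (by
    intro r hr
    cases hr with
    | comm i a j b h =>
      simp only [map_sub, map_mul, FreeSeries.lift_gen]
      rcases h with ⟨h, h'⟩ | ⟨h, h'⟩
      · rw [hT.comm h h', sub_self]
      · rw [hT.comm h h', sub_self]
    | qcomm i a j b h =>
      simp only [map_sub, map_mul, map_smul, FreeSeries.lift_gen]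
      rcases h with ⟨h, rfl⟩ | ⟨rfl, h⟩
      · rw [hT.col h, sub_self]
      · rw [hT.row _ h, sub_self]
    | cross i a j b h =>
      simp only [map_sub, map_mul, map_smul, FreeSeries.lift_gen]
      rw [hT.cross h.1 h.2, sub_self])

theorem Sh.lift_X [IsAdicComplete hI B] (T : Fin k → Fin n → B) (hT : RTT T) (i : Fin k)
    (j : Fin n) : Sh.lift T hT (Sh.X i j) = T i j := PresAlg.lift_gen _ _ _

theorem Sh.algHom_ext [IsHausdorff hI B] {f g : Sh k n →ₐ[Rh] B}
    (h : ∀ i j, f (Sh.X i j) = g (Sh.X i j)) : f = g := PresAlg.algHom_ext fun e => h e.1 e.2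

/-- A closed subspace which contains `1` and is stable under left multiplication by the generators
is everything. -/
theorem Sh.induction (S : Submodule Rh (Sh k n)) (hS : IsClosedSub S) (h1 : 1 ∈ S)
    (hg : ∀ i j, ∀ f ∈ S, Sh.X i j * f ∈ S) (f : Sh k n) : f ∈ S :=
  PresAlg.induction S hS h1 (fun e => hg e.1 e.2) f

end RTT

section Coproduct

variable (k l n p : ℕ)

/-- The homomorphism `Δ_{kln}`. -/
def matDelta : Sh k n →ₐ[Rh] CTensor (Sh k l) (Sh l n) :=
  Sh.lift _ (((Sh.rtt_X k l).map (inclL (Sh k l) (Sh l n))).mul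
    ((Sh.rtt_X l n).map (inclR (Sh k l) (Sh l n))) fun _ _ _ _ => commute_ctmul _ _)

theorem isMatCoproduct_matDelta : IsMatCoproduct (matDelta k l n) := by
  intro i j
  rw [matDelta, Sh.lift_X]
  refine Finset.sum_congr rfl fun c _ => ?_
  rw [inclL_apply, inclR_apply, ctmul_mul_ctmul, one_mul, mul_one]

variable {p} in
/-- The `R`-matrix commutes with the diagonal matrices whose entries are symmetric in the two
factors. -/
theorem rc_lc_diagonal (w : Fin p → Fin p → Rh) (hw : ∀ i a, w i a = w a i) (i a j b : Fin p) :
    rc j b * (if i = b ∧ a = j then w i a else 0) - lc j b * (if i = j ∧ a = b then w i a else 0) =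
      rc i a * (if a = j ∧ i = b then w a i else 0) -
        lc i a * (if i = j ∧ a = b then w i a else 0) := by
  congr 1
  · by_cases h : i = b ∧ a = j
    · rw [if_pos h, if_pos h.symm, h.1, h.2, rc_comm, hw]
    · rw [if_neg h, if_neg (fun h' => h h'.symm), mul_zero, mul_zero]
  · by_cases h : i = j ∧ a = b
    · rw [h.1, h.2]
    · rw [if_neg h, mul_zero, mul_zero]

/-- The counit of `S_ħ(p,p)`. -/
def matCounit : Sh p p →ₐ[Rh] Rh :=
  Sh.lift (fun i j => if i = j then 1 else 0) (by
    intro i a j b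
    have := rc_lc_diagonal (fun _ _ => 1) (fun _ _ => rfl) i a j b
    simpa only [smul_eq_mul, ite_zero_mul_ite_zero, mul_one] using this)

theorem isMatCounit_matCounit : IsMatCounit (matCounit p) := fun i j => Sh.lift_X _ _ i j

end Coproduct

section Kappa

variable {p : ℕ}

open scoped Kronecker

variable (p) in
/-- The algebra homomorphism `A ↦ A ⊗ 1` for matrices. -/
def kronL : Matrix (Fin p) (Fin p) Rh →ₐ[Rh] Matrix (Fin p × Fin p) (Fin p × Fin p) Rh :=
  AlgHom.ofLinearMap
    { toFun := fun x => x ⊗ₖ (1 : Matrix (Fin p) (Fin p) Rh)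
      map_add' := fun x y => Matrix.add_kronecker x y 1
      map_smul' := fun c x => Matrix.smul_kronecker c x 1 }
    Matrix.one_kronecker_one (fun x y => by
      change (x * y) ⊗ₖ (1 : Matrix (Fin p) (Fin p) Rh) = x ⊗ₖ 1 * y ⊗ₖ 1
      rw [← Matrix.mul_kronecker_mul, one_mul])

variable (p) in
/-- The algebra homomorphism `A ↦ 1 ⊗ A` for matrices. -/
def kronR : Matrix (Fin p) (Fin p) Rh →ₐ[Rh] Matrix (Fin p × Fin p) (Fin p × Fin p) Rh :=
  AlgHom.ofLinearMap
    { toFun := fun x => (1 : Matrix (Fin p) (Fin p) Rh) ⊗ₖ x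
      map_add' := fun x y => Matrix.kronecker_add 1 x y
      map_smul' := fun c x => Matrix.kronecker_smul c 1 x }
    Matrix.one_kronecker_one (fun x y => by
      change (1 : Matrix (Fin p) (Fin p) Rh) ⊗ₖ (x * y) = 1 ⊗ₖ x * 1 ⊗ₖ y
      rw [← Matrix.mul_kronecker_mul, one_mul])

theorem kronL_mul_kronR (x y : Matrix (Fin p) (Fin p) Rh) :
    kronL p x * kronR p y = x ⊗ₖ y := by
  change (x ⊗ₖ (1 : Matrix (Fin p) (Fin p) Rh)) * ((1 : Matrix (Fin p) (Fin p) Rh) ⊗ₖ y) = _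
  rw [← Matrix.mul_kronecker_mul, one_mul, mul_one]

theorem kronR_mul_kronL (x y : Matrix (Fin p) (Fin p) Rh) :
    kronR p y * kronL p x = x ⊗ₖ y := by
  change ((1 : Matrix (Fin p) (Fin p) Rh) ⊗ₖ y) * (x ⊗ₖ (1 : Matrix (Fin p) (Fin p) Rh)) = _
  rw [← Matrix.mul_kronecker_mul, one_mul, mul_one]

theorem kronL_commute_kronR (x y : Uh p) :
    Commute (((kronL p).comp (vectorRep p)) x) (((kronR p).comp (vectorRep p)) y) :=
  (kronL_mul_kronR _ _).trans (kronR_mul_kronL _ _).symm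

variable (p) in
/-- The tensor square of the vector representation. -/
def vectorRep2 : Uh p →ₐ[Rh] Matrix (Fin p × Fin p) (Fin p × Fin p) Rh :=
  (liftC ((kronL p).comp (vectorRep p)) ((kronR p).comp (vectorRep p)) kronL_commute_kronR).comp
    (Delta p)

/-- The `R`-matrix of the vector representation, composed with the flip; the first entry of a pair
is the index of the first tensor factor. -/
def Rmat (p : ℕ) : Matrix (Fin p × Fin p) (Fin p × Fin p) Rh := fun e f =>
  (if e.1 = f.2 ∧ e.2 = f.1 then rc f.1 f.2 else 0) -
    if e.1 = f.1 ∧ e.2 = f.2 then lc f.1 f.2 else 0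

theorem mul_Rmat (M : Matrix (Fin p × Fin p) (Fin p × Fin p) Rh) (i a j b : Fin p) :
    (M * Rmat p) (i, a) (j, b) = rc j b * M (i, a) (b, j) - lc j b * M (i, a) (j, b) := by
  rw [Matrix.mul_apply]
  simp only [Rmat, mul_sub, Finset.sum_sub_distrib, mul_ite, mul_zero]
  congr 1
  · rw [Finset.sum_eq_single (b, j)]
    · simp [mul_comm]
    · rintro ⟨c, d⟩ _ h
      rw [if_neg]; rintro ⟨h1, h2⟩; exact h (Prod.ext h1 h2)
    · simp
  · rw [Finset.sum_eq_single (j, b)]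
    · simp [mul_comm]
    · rintro ⟨c, d⟩ _ h
      rw [if_neg]; rintro ⟨h1, h2⟩; exact h (Prod.ext h1 h2)
    · simp

theorem Rmat_mul (M : Matrix (Fin p × Fin p) (Fin p × Fin p) Rh) (i a j b : Fin p) :
    (Rmat p * M) (i, a) (j, b) = rc i a * M (a, i) (j, b) - lc i a * M (i, a) (j, b) := by
  rw [Matrix.mul_apply]
  simp only [Rmat, sub_mul, Finset.sum_sub_distrib, ite_mul, zero_mul]
  congr 1
  · rw [Finset.sum_eq_single (a, i)]
    · simp [rc_comm]
    · rintro ⟨c, d⟩ _ h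
      rw [if_neg]; rintro ⟨h1, h2⟩; exact h (Prod.ext h2.symm h1.symm)
    · simp
  · rw [Finset.sum_eq_single (i, a)]
    · simp
    · rintro ⟨c, d⟩ _ h
      rw [if_neg]; rintro ⟨h1, h2⟩; exact h (Prod.ext h1.symm h2.symm)
    · simp

theorem Rmat_commute_of {M : Matrix (Fin p × Fin p) (Fin p × Fin p) Rh}
    (h : ∀ i a j b, rc j b * M (i, a) (b, j) - lc j b * M (i, a) (j, b) =
      rc i a * M (a, i) (j, b) - lc i a * M (i, a) (j, b)) : M * Rmat p = Rmat p * M := by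
  ext ⟨i, a⟩ ⟨j, b⟩
  rw [mul_Rmat, Rmat_mul, h]

theorem vectorRep2_of {x : Uh p} {a b c d : Uh p} (h : Delta p x = ctmul a b + ctmul c d) :
    vectorRep2 p x = vectorRep p a ⊗ₖ vectorRep p b +
      vectorRep p c ⊗ₖ vectorRep p d := by
  rw [vectorRep2, AlgHom.comp_apply, h, map_add, liftC_ctmul, liftC_ctmul]
  exact congrArg₂ _ (kronL_mul_kronR _ _) (kronL_mul_kronR _ _)

theorem vectorRep2_D (l i a j b : Fin p) : vectorRep2 p (Uh.D l) (i, a) (j, b) =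
    if i = j ∧ a = b then (if i = l then 1 else 0) + (if a = l then 1 else 0) else 0 := by
  rw [vectorRep2_of (isCoproduct_Delta.D l), isVectorRep_vectorRep.D, map_one, Matrix.add_apply,
    Matrix.kronecker_apply, Matrix.kronecker_apply, Matrix.single_apply, Matrix.single_apply,
    Matrix.one_apply, Matrix.one_apply]
  by_cases h1 : i = j
  · by_cases h2 : a = b
    · subst h1 h2
      simp [eq_comm]
    · have : ¬ (l = a ∧ l = b) := fun h => h2 (h.1.symm.trans h.2)
      simp [h2, this]
  · have : ¬ (l = i ∧ l = j) := fun h => h1 (h.1.symm.trans h.2)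
    simp [h1, this]

theorem vectorRep2_E (l : Fin (p - 1)) (i a j b : Fin p) : vectorRep2 p (Uh.E l) (i, a) (j, b) =
    (if i = lo l ∧ j = up l ∧ a = b then (expH (wt l b) : Rh) else 0) +
      if i = j ∧ a = lo l ∧ b = up l then 1 else 0 := by
  rw [vectorRep2_of (isCoproduct_Delta.E l), isVectorRep_vectorRep.E, vectorRep_K, map_one,
    Matrix.add_apply, Matrix.kronecker_apply, Matrix.kronecker_apply, Matrix.single_apply,
    Matrix.single_apply, Matrix.one_apply, Matrix.diagonal_apply, ite_zero_mul_ite_zero,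
    ite_zero_mul_ite_zero, one_mul, one_mul]
  simp only [and_assoc, eq_comm (a := lo l), eq_comm (a := up l)]
  congr 1
  by_cases h : a = b
  · rw [h]
  · simp [h]

theorem vectorRep2_F (l : Fin (p - 1)) (i a j b : Fin p) : vectorRep2 p (Uh.F l) (i, a) (j, b) =
    (if i = up l ∧ j = lo l ∧ a = b then 1 else 0) +
      if i = j ∧ a = up l ∧ b = lo l then (expH (-wt l i) : Rh) else 0 := by
  rw [vectorRep2_of (isCoproduct_Delta.F l), isVectorRep_vectorRep.F, vectorRep_Kinv, map_one,
    Matrix.add_apply, Matrix.kronecker_apply, Matrix.kronecker_apply, Matrix.single_apply,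
    Matrix.single_apply, Matrix.one_apply, Matrix.diagonal_apply, ite_zero_mul_ite_zero,
    ite_zero_mul_ite_zero, mul_one, mul_one]
  simp only [and_assoc, eq_comm (a := lo l), eq_comm (a := up l)]

theorem wt_lo (l : Fin (p - 1)) : wt l (lo l) = 1 := if_pos rfl

theorem wt_up (l : Fin (p - 1)) : wt l (up l) = -1 := by
  rw [wt, if_neg (lo_ne_up l).symm, if_pos rfl]

theorem wt_of_ne {l : Fin (p - 1)} {j : Fin p} (h : j ≠ lo l) (h' : j ≠ up l) : wt l j = 0 := by
  rw [wt, if_neg h, if_neg h']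

theorem lc_lo_up (l : Fin (p - 1)) : lc (lo l) (up l) = qq - qi :=
  if_pos (by simp [lo, up, Fin.lt_def])

theorem lc_up_lo (l : Fin (p - 1)) : lc (up l) (lo l) = 0 :=
  if_neg (by simp [lo, up, Fin.lt_def])

theorem rc_of_ne {i j : Fin p} (h : i ≠ j) : rc i j = 1 := if_neg h

/-- No index lies strictly between `l` and `l + 1`. -/
theorem lc_lo_eq_up {l : Fin (p - 1)} {j : Fin p} (h : j ≠ up l) :
    lc (lo l) j = lc (up l) j := by
  have : lo l < j ↔ up l < j := by
    simp only [lo, up, Fin.lt_def, ne_eq, Fin.ext_iff] at h ⊢; omega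
  simp only [lc, this]

theorem lc_eq_lo_up {l : Fin (p - 1)} {j : Fin p} (h : j ≠ lo l) :
    lc j (lo l) = lc j (up l) := by
  have : j < lo l ↔ j < up l := by
    simp only [lo, up, Fin.lt_def, ne_eq, Fin.ext_iff] at h ⊢; omega
  simp only [lc, this]

/-- The entries of both products are nonzero only for index patterns of three kinds: the two cases
in which one of the factors is permuted, and the case in which only the diagonal part of `R`
contributes. -/
theorem vectorRep2_E_commute (l : Fin (p - 1)) :
    vectorRep2 p (Uh.E l) * Rmat p = Rmat p * vectorRep2 p (Uh.E l) := by
  refine Rmat_commute_of fun i a j b => ?_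
  simp only [vectorRep2_E]
  have hlu := lo_ne_up l
  have hul := hlu.symm
  by_cases h1 : i = lo l ∧ b = up l ∧ a = j
  · obtain ⟨rfl, rfl, rfl⟩ := h1
    by_cases h : a = lo l
    · subst h
      simp [hlu, rc_self, rc_of_ne hlu, lc_self, lc_lo_up, wt_lo]
    · by_cases h' : a = up l
      · subst h'
        simp [hul, rc_self, rc_of_ne hlu, lc_self, lc_lo_up, wt_up]
        linear_combination qq_mul_qi
      · simp [hlu, h, h', Ne.symm h, rc_of_ne h', rc_of_ne (Ne.symm h), wt_of_ne h h', expH_zero]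
  by_cases h2 : i = b ∧ a = lo l ∧ j = up l
  · obtain ⟨rfl, rfl, rfl⟩ := h2
    by_cases h : i = lo l
    · subst h
      simp [hlu, rc_self, rc_of_ne hul, lc_self, lc_up_lo, wt_lo, qi_mul_qq]
    · by_cases h' : i = up l
      · subst h'
        simp [hul, rc_self, rc_of_ne hul, lc_self, lc_up_lo, wt_up]
      · simp [h, h', rc_of_ne h, rc_of_ne (Ne.symm h'), wt_of_ne h h', expH_zero]
  have h2' : ¬ (a = lo l ∧ j = up l ∧ i = b) := fun h => h2 ⟨h.2.2, h.1, h.2.1⟩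
  have h1' : ¬ (a = j ∧ i = lo l ∧ b = up l) := fun h => h1 ⟨h.2.1, h.2.2, h.1⟩
  rw [if_neg h1, if_neg h2, if_neg h2', if_neg h1', add_zero, mul_zero, mul_zero]
  congr 1
  by_cases h3 : i = lo l ∧ j = up l ∧ a = b
  · obtain ⟨rfl, rfl, rfl⟩ := h3
    rw [lc_lo_eq_up (fun h => h1 ⟨rfl, h, h⟩)]
  · by_cases h4 : i = j ∧ a = lo l ∧ b = up l
    · obtain ⟨rfl, rfl, rfl⟩ := h4
      rw [lc_eq_lo_up (fun h => h1 ⟨h, rfl, h.symm⟩)]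
    · rw [if_neg h3, if_neg h4, add_zero, mul_zero, mul_zero]

theorem vectorRep2_F_commute (l : Fin (p - 1)) :
    vectorRep2 p (Uh.F l) * Rmat p = Rmat p * vectorRep2 p (Uh.F l) := by
  refine Rmat_commute_of fun i a j b => ?_
  simp only [vectorRep2_F]
  have hlu := lo_ne_up l
  have hul := hlu.symm
  by_cases h1 : i = up l ∧ b = lo l ∧ a = j
  · obtain ⟨rfl, rfl, rfl⟩ := h1
    by_cases h : a = lo l
    · subst h
      simp [hlu, rc_self, rc_of_ne hul, lc_self, lc_up_lo, wt_lo]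
    · by_cases h' : a = up l
      · subst h'
        simp [hul, rc_self, rc_of_ne hul, lc_self, lc_up_lo, wt_up, qi_mul_qq]
      · simp [hul, h, h', Ne.symm h', rc_of_ne h, rc_of_ne (Ne.symm h'), wt_of_ne h h', expH_zero]
  by_cases h2 : i = b ∧ a = up l ∧ j = lo l
  · obtain ⟨rfl, rfl, rfl⟩ := h2
    by_cases h : i = lo l
    · subst h
      simp [hlu, rc_self, rc_of_ne hlu, lc_self, lc_lo_up, wt_lo]
      linear_combination qq_mul_qi
    · by_cases h' : i = up l
      · subst h'
        simp [hul, rc_self, rc_of_ne hlu, lc_self, lc_lo_up, wt_up]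
      · simp [h, h', rc_of_ne h', rc_of_ne (Ne.symm h), wt_of_ne h h', expH_zero]
  have h2' : ¬ (a = up l ∧ j = lo l ∧ i = b) := fun h => h2 ⟨h.2.2, h.1, h.2.1⟩
  have h1' : ¬ (a = j ∧ i = up l ∧ b = lo l) := fun h => h1 ⟨h.2.1, h.2.2, h.1⟩
  rw [if_neg h1, if_neg h2, if_neg h2', if_neg h1', add_zero, mul_zero, mul_zero]
  congr 1
  by_cases h3 : i = up l ∧ j = lo l ∧ a = b
  · obtain ⟨rfl, rfl, rfl⟩ := h3
    rw [lc_lo_eq_up (fun h => h2 ⟨h.symm, h, rfl⟩)]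
  · by_cases h4 : i = j ∧ a = up l ∧ b = lo l
    · obtain ⟨rfl, rfl, rfl⟩ := h4
      rw [lc_eq_lo_up (fun h => h2 ⟨h, rfl, h⟩)]
    · rw [if_neg h3, if_neg h4, add_zero, mul_zero, mul_zero]

/-- The `R`-matrix is an intertwiner of the tensor square of the vector representation. -/
theorem vectorRep2_commute (x : Uh p) : vectorRep2 p x * Rmat p = Rmat p * vectorRep2 p x := by
  refine PresAlg.induction (LinearMap.eqLocus
    (LinearMap.mulRight Rh (Rmat p) ∘ₗ (vectorRep2 p).toLinearMap)
    (LinearMap.mulLeft Rh (Rmat p) ∘ₗ (vectorRep2 p).toLinearMap)) (isClosedSub_eqLocus _ _)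
    (by simp [LinearMap.mem_eqLocus]) (fun g y hy => ?_) x
  have hg : vectorRep2 p (PresAlg.gen _ g) * Rmat p = Rmat p * vectorRep2 p (PresAlg.gen _ g) := by
    cases g with
    | E l => exact vectorRep2_E_commute l
    | F l => exact vectorRep2_F_commute l
    | D l =>
      refine Rmat_commute_of fun i a j b => ?_
      have := rc_lc_diagonal (fun i a => (if i = l then 1 else 0) + (if a = l then 1 else 0))
        (fun _ _ => add_comm _ _) i a j b
      have h := vectorRep2_D (p := p) l
      rw [Uh.D] at h
      rw [h, h, h]
      exact this
  change vectorRep2 p y * Rmat p = Rmat p * vectorRep2 p y at hy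
  change vectorRep2 p (_ * y) * Rmat p = Rmat p * vectorRep2 p (_ * y)
  rw [map_mul, mul_assoc, hy, ← mul_assoc, hg, mul_assoc]

/-- The matrix coefficient `t_{ij}` of the vector representation. -/
def matCoeff (i j : Fin p) : Conv p Rh :=
  Conv.lin.symm (Matrix.entryLinearMap Rh Rh i j ∘ₗ (vectorRep p).toLinearMap)

theorem matCoeff_lin (i j : Fin p) (x : Uh p) : (matCoeff i j).lin x = vectorRep p x i j := rfl

theorem matCoeff_mul_lin (i j a b : Fin p) (x : Uh p) :
    (matCoeff i j * matCoeff a b).lin x = vectorRep2 p x (i, a) (j, b) := by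
  refine CTensor.apply_ext (evalTensor (LinearMap.mul Rh Rh) (matCoeff i j).lin (matCoeff a b).lin)
    (Matrix.entryLinearMap Rh Rh (i, a) (j, b) ∘ₗ (liftC ((kronL p).comp (vectorRep p))
      ((kronR p).comp (vectorRep p)) kronL_commute_kronR).toLinearMap) (fun y z => ?_) (Delta p x)
  rw [evalTensor_ctmul, LinearMap.comp_apply, AlgHom.toLinearMap_apply, liftC_ctmul]
  exact (congrFun₂ (kronL_mul_kronR _ _) (i, a) (j, b)).symm

/-- The matrix coefficients form an `RTT` matrix in the convolution algebra, because the `R`-matrix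
is an intertwiner. -/
theorem rtt_matCoeff : RTT (matCoeff (p := p)) := by
  intro i a j b
  refine Conv.ext fun x => ?_
  have h := congrFun₂ (vectorRep2_commute x) (i, a) (j, b)
  rw [mul_Rmat, Rmat_mul] at h
  simp only [map_sub, map_smul, LinearMap.sub_apply, LinearMap.smul_apply, matCoeff_mul_lin,
    smul_eq_mul]
  exact h

variable (p) in
/-- The bialgebra morphism `κ` as a homomorphism to the convolution algebra. -/
def kappa : Sh p p →ₐ[Rh] Conv p Rh := Sh.lift matCoeff rtt_matCoeff

theorem kappa_X (i j : Fin p) : kappa p (Sh.X i j) = matCoeff i j := Sh.lift_X _ _ _ _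

variable (p) in
/-- The morphism `κ` with values in the dual of `U_ħ gl_p`. -/
def kappaDual : Sh p p →ₗ[Rh] Module.Dual Rh (Uh p) := Conv.lin.toLinearMap ∘ₗ (kappa p).toLinearMap

theorem kappaDual_apply (f : Sh p p) (x : Uh p) : kappaDual p f x = (kappa p f).lin x := rfl

end Kappa

/-! ### The actions on `S_ħ(k,n)` -/

section Action

variable {k n p : ℕ}

theorem Conv.const_commute_map_ofId {S : Type} [Ring S] [Algebra Rh S] [IsAdicComplete hI S] (s : S)
    (g : Conv p Rh) : Commute (Conv.const p S s) (Conv.map p (Algebra.ofId Rh S) g) :=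
  Conv.ext fun x => by
    rw [Conv.const_mul_lin, Conv.mul_const_lin, Conv.map_lin, Algebra.ofId_apply,
      Algebra.commutes]

theorem coactR_commute (f : Sh k n) (g : Sh n n) : Commute (Conv.const n (Sh k n) f)
    (((Conv.map n (Algebra.ofId Rh (Sh k n))).comp (kappa n)) g) :=
  Conv.const_commute_map_ofId f (kappa n g)

variable (k n) in
/-- The right coaction `f ↦ (y ↦ y f)`, which is an algebra homomorphism to the convolution
algebra: this is the module algebra property. -/
def coactR : Sh k n →ₐ[Rh] Conv n (Sh k n) :=
  (liftC (Conv.const n (Sh k n)) ((Conv.map n (Algebra.ofId Rh (Sh k n))).comp (kappa n))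
    coactR_commute).comp (matDelta k n n)

theorem rightPairing_eq (y : Uh n) (f : Sh k n) :
    rightPairing (kappaDual n) (matDelta k n n) y f = (coactR k n f).lin y := by
  refine CTensor.apply_ext (evalTensor (LinearMap.lsmul Rh (Sh k n)).flip LinearMap.id
    ((kappaDual n).flip y)) (LinearMap.applyₗ y ∘ₗ Conv.lin.toLinearMap ∘ₗ
    (liftC (Conv.const n (Sh k n)) ((Conv.map n (Algebra.ofId Rh (Sh k n))).comp (kappa n))
    coactR_commute).toLinearMap) (fun a b => ?_) (matDelta k n n f)
  rw [evalTensor_ctmul, LinearMap.comp_apply, LinearMap.comp_apply, AlgHom.toLinearMap_apply,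
    liftC_ctmul]
  change kappaDual n b y • a = (Conv.const n (Sh k n) a * _).lin y
  rw [Conv.const_mul_lin, AlgHom.comp_apply, Conv.map_lin, Algebra.ofId_apply,
    ← Algebra.commutes, ← Algebra.smul_def]
  rfl

theorem coactR_X_lin (i : Fin k) (j : Fin n) (y : Uh n) :
    (coactR k n (Sh.X i j)).lin y = ∑ a, vectorRep n y a j • Sh.X i a := by
  rw [← rightPairing_eq, rightPairing, isMatCoproduct_matDelta, map_sum]
  refine Finset.sum_congr rfl fun a _ => ?_
  rw [evalTensor_ctmul]
  change kappaDual n (Sh.X a j) y • Sh.X i a = _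
  rw [kappaDual_apply, kappa_X, matCoeff_lin]

theorem coactR_lin_one (f : Sh k n) : (coactR k n f).lin 1 = f := by
  have : (Conv.evalOne n (Sh k n)).comp (coactR k n) = AlgHom.id Rh _ :=
    Sh.algHom_ext fun i j => by
      change (coactR k n (Sh.X i j)).lin 1 = Sh.X i j
      simp [coactR_X_lin, Matrix.one_apply]
  exact DFunLike.congr_fun this f

theorem coactR_mul_lin (f g : Sh k n) (y : Uh n) : (coactR k n (f * g)).lin y =
    evalTensor (LinearMap.mul Rh (Sh k n)) (coactR k n f).lin (coactR k n g).lin (Delta n y) := by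
  rw [map_mul, Conv.mul_lin]

/-- Compatibility of the action with products in `U_ħ gl_n`.  It holds on the generators because the
vector representation is a representation, and it passes to products in `S_ħ(k,n)` because `Δ` is
multiplicative. -/
theorem coactR_lin_mul (f : Sh k n) (x y : Uh n) :
    (coactR k n f).lin (x * y) = (coactR k n ((coactR k n f).lin y)).lin x := by
  let L : Sh k n →ₗ[Rh] Uh n →ₗ[Rh] Sh k n := Conv.lin.toLinearMap ∘ₗ (coactR k n).toLinearMap
  let good : Submodule Rh (Sh k n) := ⨅ x : Uh n, ⨅ y : Uh n,
    LinearMap.eqLocus (L.flip (x * y)) (L.flip x ∘ₗ L.flip y)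
  have hmem : ∀ f, f ∈ good ↔ ∀ x y, L f (x * y) = L (L f y) x := fun f => by
    simp only [good, Submodule.mem_iInf, LinearMap.mem_eqLocus]; rfl
  have hX : ∀ i j, Sh.X i j ∈ good := fun i j => by
    refine (hmem _).mpr fun x y => ?_
    change (coactR k n (Sh.X i j)).lin (x * y) =
      (coactR k n ((coactR k n (Sh.X i j)).lin y)).lin x
    have hs : (coactR k n (∑ a, vectorRep n y a j • Sh.X i a)).lin x =
        ∑ a, vectorRep n y a j • (coactR k n (Sh.X i a)).lin x := by
      rw [map_sum, map_sum, LinearMap.sum_apply]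
      simp only [map_smul, LinearMap.smul_apply]
    rw [coactR_X_lin, coactR_X_lin, hs]
    simp only [coactR_X_lin, Finset.smul_sum, smul_smul, map_mul, Matrix.mul_apply,
      Finset.sum_smul]
    rw [Finset.sum_comm]
    simp only [mul_comm]
  have hmul : ∀ f g, f ∈ good → g ∈ good → f * g ∈ good := by
    intro f g hf hg
    rw [hmem] at hf hg ⊢
    intro x y
    let e := evalTensor (LinearMap.mul Rh (Sh k n)) (L f) (L g)
    have h1 : ∀ c d, e (Delta n x * ctmul c d) = L (L f c * L g d) x := by
      intro c d
      refine (CTensor.apply_ext (e ∘ₗ LinearMap.mulRight Rh (ctmul c d))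
        (evalTensor (LinearMap.mul Rh (Sh k n)) (L (L f c)) (L (L g d))) (fun a b => ?_)
        (Delta n x)).trans (coactR_mul_lin _ _ _).symm
      rw [LinearMap.comp_apply, LinearMap.mulRight_apply, ctmul_mul_ctmul, evalTensor_ctmul,
        evalTensor_ctmul, hf, hg]
    have h2 := CTensor.apply_ext (e ∘ₗ LinearMap.mulLeft Rh (Delta n x)) (L.flip x ∘ₗ e)
      (fun c d => (h1 c d).trans
        (congrArg (fun s => L s x)
          (evalTensor_ctmul (LinearMap.mul Rh (Sh k n)) (L f) (L g) c d).symm))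
      (Delta n y)
    have h3 : L (f * g) (x * y) = e (Delta n x * Delta n y) := by
      rw [← map_mul]; exact coactR_mul_lin f g _
    have h4 : L (f * g) y = e (Delta n y) := coactR_mul_lin f g _
    rw [h3, h4]
    exact h2
  have h1 : (1 : Sh k n) ∈ good := by
    refine (hmem _).mpr fun x y => ?_
    have h : ∀ x, L 1 x = counit n x • 1 := fun x => by
      change (coactR k n 1).lin x = _
      rw [map_one, Conv.one_lin]
    rw [h, h, map_smul, LinearMap.smul_apply, h, smul_smul, map_mul, mul_comm]
  exact (hmem f).mp (Sh.induction good
    (isClosedSub_iInf fun _ => isClosedSub_iInf fun _ => isClosedSub_eqLocus _ _) h1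
    (fun i j g hg => hmul _ _ (hX i j) hg) f) x y

variable (k n) in
/-- The action of `U_ħ gl_n` on `S_ħ(k,n)`. -/
def actR : Uh n →ₐ[Rh] Module.End Rh (Sh k n) :=
  AlgHom.ofLinearMap (Conv.lin.toLinearMap ∘ₗ (coactR k n).toLinearMap).flip
    (LinearMap.ext coactR_lin_one)
    (fun x y => LinearMap.ext fun f => coactR_lin_mul f x y)

theorem actR_apply (y : Uh n) (f : Sh k n) : actR k n y f = (coactR k n f).lin y := rfl

theorem actR_X (y : Uh n) (i : Fin k) (j : Fin n) :
    actR k n y (Sh.X i j) = ∑ a, vectorRep n y a j • Sh.X i a := coactR_X_lin i j y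

theorem actR_one (y : Uh n) : actR k n y 1 = counit n y • 1 := by
  rw [actR_apply, map_one, Conv.one_lin]

theorem actR_mul (y : Uh n) (f g : Sh k n) : actR k n y (f * g) =
    evalTensor (LinearMap.mul Rh (Sh k n)) ((actR k n).toLinearMap.flip f)
      ((actR k n).toLinearMap.flip g) (Delta n y) := coactR_mul_lin f g y

/-! ### The pairing is a bialgebra pairing -/

/-- The pairing is recovered from the action through the counit, so that the compatibility of `κ`
with coproducts is the associativity of the action. -/
theorem kappaDual_eq_counit_actR (f : Sh p p) (y : Uh p) :
    kappaDual p f y = matCounit p (actR p p y f) := by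
  have : (Conv.map p (matCounit p)).comp (coactR p p) = kappa p :=
    Sh.algHom_ext fun i j => Conv.ext fun x => by
      rw [AlgHom.comp_apply, Conv.map_lin, coactR_X_lin, kappa_X, matCoeff_lin, map_sum]
      simp [isMatCounit_matCounit p i _]
  rw [kappaDual_apply, ← this, AlgHom.comp_apply, Conv.map_lin, actR_apply]

theorem isKappa_kappaDual (p : ℕ) : IsKappa (Delta p) (counit p) (vectorRep p) (matDelta p p p)
    (matCounit p) (kappaDual p) where
  gen i j x := by rw [kappaDual_apply, kappa_X, matCoeff_lin]
  mul f g x := by rw [kappaDual_apply, map_mul, Conv.mul_lin]; rfl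
  one x := by rw [kappaDual_apply, map_one, Conv.one_lin, smul_eq_mul, mul_one]
  comul f x y := by
    rw [kappaDual_eq_counit_actR, map_mul, Module.End.mul_apply, ← kappaDual_eq_counit_actR,
      actR_apply, ← rightPairing_eq]
    refine CTensor.apply_ext ((kappaDual p).flip x ∘ₗ evalTensor
      (LinearMap.lsmul Rh (Sh p p)).flip LinearMap.id ((kappaDual p).flip y))
      (evalTensor (LinearMap.mul Rh Rh) ((kappaDual p).flip x) ((kappaDual p).flip y))
      (fun a b => ?_) (matDelta p p p f)
    rw [LinearMap.comp_apply, evalTensor_ctmul, evalTensor_ctmul]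
    change (kappaDual p).flip x ((kappaDual p).flip y b • a) = _
    rw [map_smul, smul_eq_mul, mul_comm]
    rfl
  counit f := by rw [kappaDual_eq_counit_actR, map_one, Module.End.one_apply]

/-! ### The left action, and its commutation with the right action -/

theorem transpose_X (i : Fin k) (j : Fin n) : Sh.transpose k n (Sh.X i j) = Sh.X j i :=
  PresAlg.map_gen _ _ _

theorem transpose_transpose (f : Sh k n) : Sh.transpose n k (Sh.transpose k n f) = f := by
  have : (Sh.transpose n k).comp (Sh.transpose k n) = AlgHom.id Rh _ :=
    Sh.algHom_ext fun i j => by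
      rw [AlgHom.comp_apply, transpose_X, transpose_X]; rfl
  exact DFunLike.congr_fun this f

variable (k n) in
/-- The transposition as a linear equivalence. -/
def transposeEquiv : Sh k n ≃ₗ[Rh] Sh n k :=
  LinearEquiv.ofLinearMap (Sh.transpose k n).toLinearMap (Sh.transpose n k).toLinearMap
    (LinearMap.ext transpose_transpose) (LinearMap.ext transpose_transpose)

variable (k n) in
/-- The action of `U_ħ gl_k` on `S_ħ(k,n)`, transported from the right action by transposition. -/
def actL : Uh k →ₐ[Rh] Module.End Rh (Sh k n) :=
  AlgHom.ofLinearMap ((transposeEquiv n k).conj.toLinearMap ∘ₗ (actR n k).toLinearMap)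
    (by
      change (transposeEquiv n k).conj (actR n k 1) = 1
      rw [map_one]; exact LinearEquiv.conj_id _)
    (fun x y => by
      change (transposeEquiv n k).conj (actR n k (x * y)) = _
      rw [map_mul]; exact LinearEquiv.conj_comp _ _ _)

theorem actL_apply (x : Uh k) (f : Sh k n) :
    actL k n x f = Sh.transpose n k (actR n k x (Sh.transpose k n f)) := rfl

theorem transpose_actR (y : Uh n) (f : Sh k n) :
    Sh.transpose k n (actR k n y f) = actL n k y (Sh.transpose k n f) := by
  rw [actL_apply, transpose_transpose]

variable (k n) in
/-- The left coaction `f ↦ (x ↦ x f)`. -/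
def coactL : Sh k n →ₐ[Rh] Conv k (Sh k n) :=
  (Conv.map k (Sh.transpose n k)).comp ((coactR n k).comp (Sh.transpose k n))

theorem coactL_lin (f : Sh k n) (x : Uh k) : (coactL k n f).lin x = actL k n x f := rfl

theorem actL_X (x : Uh k) (i : Fin k) (j : Fin n) :
    actL k n x (Sh.X i j) = ∑ a, vectorRep k x a i • Sh.X a j := by
  rw [actL_apply, transpose_X, actR_X, map_sum]
  simp only [map_smul, transpose_X]

theorem actL_one (x : Uh k) : actL k n x 1 = counit k x • 1 := by
  rw [actL_apply, map_one, actR_one, map_smul, map_one]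

theorem actL_mul (x : Uh k) (f g : Sh k n) : actL k n x (f * g) =
    evalTensor (LinearMap.mul Rh (Sh k n)) ((actL k n).toLinearMap.flip f)
      ((actL k n).toLinearMap.flip g) (Delta k x) := by
  rw [← coactL_lin, map_mul, Conv.mul_lin]
  rfl

theorem leftPairing_commute (f : Sh k k) (g : Sh k n) : Commute
    (((Conv.map k (Algebra.ofId Rh (Sh k n))).comp ((kappa k).comp (Sh.transpose k k))) f)
    (Conv.const k (Sh k n) g) :=
  (Conv.const_commute_map_ofId g (kappa k (Sh.transpose k k f))).symm

/-- The transported action is the one given by the pairing with `(τ ⊗ 1) Δ_{kkn}`: both are given by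
algebra homomorphisms to the convolution algebra, which agree on the generators. -/
theorem leftPairing_eq (x : Uh k) (f : Sh k n) :
    leftPairing (kappaDual k) (matDelta k k n) x f = actL k n x f := by
  have key : (liftC ((Conv.map k (Algebra.ofId Rh (Sh k n))).comp
      ((kappa k).comp (Sh.transpose k k))) (Conv.const k (Sh k n)) leftPairing_commute).comp
      (matDelta k k n) = coactL k n := by
    refine Sh.algHom_ext fun i j => Conv.ext fun y => ?_
    rw [coactL_lin, actL_X, AlgHom.comp_apply, isMatCoproduct_matDelta, map_sum, map_sum,
      LinearMap.sum_apply]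
    refine Finset.sum_congr rfl fun a _ => ?_
    rw [liftC_ctmul, Conv.mul_const_lin, AlgHom.comp_apply, AlgHom.comp_apply, transpose_X,
      kappa_X, Conv.map_lin, matCoeff_lin, Algebra.ofId_apply, Algebra.smul_def]
  rw [← coactL_lin, ← key]
  refine CTensor.apply_ext (evalTensor (LinearMap.lsmul Rh (Sh k n))
    ((kappaDual k).flip x ∘ₗ (Sh.transpose k k).toLinearMap) LinearMap.id)
    (LinearMap.applyₗ x ∘ₗ Conv.lin.toLinearMap ∘ₗ (liftC ((Conv.map k
      (Algebra.ofId Rh (Sh k n))).comp ((kappa k).comp (Sh.transpose k k)))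
      (Conv.const k (Sh k n)) leftPairing_commute).toLinearMap) (fun a b => ?_) (matDelta k k n f)
  rw [evalTensor_ctmul, LinearMap.comp_apply, LinearMap.comp_apply, LinearMap.comp_apply,
    AlgHom.toLinearMap_apply, AlgHom.toLinearMap_apply, liftC_ctmul]
  change kappaDual k (Sh.transpose k k a) x • b = (_ * Conv.const k (Sh k n) b).lin x
  rw [Conv.mul_const_lin, AlgHom.comp_apply, Conv.map_lin, Algebra.ofId_apply,
    ← Algebra.smul_def]
  rfl

theorem deltaR_commute (a : Sh k k) (b : Sh k n) :
    Commute (((Conv.const n (CTensor (Sh k k) (Sh k n))).comp (inclL (Sh k k) (Sh k n))) a)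
      (((Conv.map n (inclR (Sh k k) (Sh k n))).comp (coactR k n)) b) :=
  Conv.ext fun y => by
    rw [AlgHom.comp_apply, AlgHom.comp_apply, Conv.const_mul_lin, Conv.mul_const_lin, Conv.map_lin]
    exact (commute_ctmul _ _).eq

/-- `Δ_{kkn}` intertwines the right actions on `S_ħ(k,n)` and on the second tensor factor. -/
theorem matDelta_actR (y : Uh n) (f : Sh k n) : matDelta k k n (actR k n y f) =
    (liftC ((Conv.const n (CTensor (Sh k k) (Sh k n))).comp (inclL (Sh k k) (Sh k n)))
      ((Conv.map n (inclR (Sh k k) (Sh k n))).comp (coactR k n)) deltaR_commute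
      (matDelta k k n f)).lin y := by
  have key : (Conv.map n (matDelta k k n)).comp (coactR k n) =
      (liftC ((Conv.const n (CTensor (Sh k k) (Sh k n))).comp (inclL (Sh k k) (Sh k n)))
      ((Conv.map n (inclR (Sh k k) (Sh k n))).comp (coactR k n)) deltaR_commute).comp
      (matDelta k k n) := by
    refine Sh.algHom_ext fun i j => Conv.ext fun x => ?_
    rw [AlgHom.comp_apply, Conv.map_lin, coactR_X_lin, AlgHom.comp_apply, isMatCoproduct_matDelta,
      map_sum, map_sum, map_sum, LinearMap.sum_apply]
    simp only [map_smul, isMatCoproduct_matDelta k k n i _, Finset.smul_sum]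
    rw [Finset.sum_comm]
    refine Finset.sum_congr rfl fun a _ => ?_
    rw [liftC_ctmul, AlgHom.comp_apply, Conv.const_mul_lin, AlgHom.comp_apply, Conv.map_lin,
      coactR_X_lin, map_sum, Finset.mul_sum]
    refine Finset.sum_congr rfl fun b _ => ?_
    rw [map_smul, inclL_apply, inclR_apply, mul_smul_comm, ctmul_mul_ctmul, one_mul, mul_one]
  have := congrArg (fun g : Conv n _ => g.lin y) (DFunLike.congr_fun key f)
  exact this

/-- The left action is computed on the first factor of `Δ_{kkn}`, and the right action on the second,
so they commute. -/
theorem actL_actR (x : Uh k) (y : Uh n) (f : Sh k n) :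
    actL k n x (actR k n y f) = actR k n y (actL k n x f) := by
  rw [← leftPairing_eq, ← leftPairing_eq, leftPairing, leftPairing, matDelta_actR]
  refine CTensor.apply_ext (evalTensor (LinearMap.lsmul Rh (Sh k n))
    ((kappaDual k).flip x ∘ₗ (Sh.transpose k k).toLinearMap) LinearMap.id ∘ₗ LinearMap.applyₗ y ∘ₗ
      Conv.lin.toLinearMap ∘ₗ (liftC ((Conv.const n (CTensor (Sh k k) (Sh k n))).comp
      (inclL (Sh k k) (Sh k n)))
      ((Conv.map n (inclR (Sh k k) (Sh k n))).comp (coactR k n)) deltaR_commute).toLinearMap)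
    (actR k n y ∘ₗ evalTensor (LinearMap.lsmul Rh (Sh k n))
    ((kappaDual k).flip x ∘ₗ (Sh.transpose k k).toLinearMap) LinearMap.id) (fun a b => ?_)
    (matDelta k k n f)
  rw [LinearMap.comp_apply, LinearMap.comp_apply, LinearMap.comp_apply, LinearMap.comp_apply,
    AlgHom.toLinearMap_apply, liftC_ctmul, evalTensor_ctmul]
  change evalTensor _ _ _ ((Conv.const n _ (inclL _ _ a) * _).lin y) = _
  rw [Conv.const_mul_lin, AlgHom.comp_apply, Conv.map_lin, inclL_apply, inclR_apply,
    ctmul_mul_ctmul, one_mul, mul_one, evalTensor_ctmul]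
  exact (map_smul (actR k n y) _ b).symm

theorem actL_commute_actR (x : Uh k) (y : Uh n) : Commute (actL k n x) (actR k n y) :=
  LinearMap.ext fun f => actL_actR x y f

variable (k n) in
/-- The action of `U_ħ gl_k ⊗ U_ħ gl_n` on `S_ħ(k,n)`. -/
def act : CTensor (Uh k) (Uh n) →ₐ[Rh] Module.End Rh (Sh k n) :=
  liftC (actL k n) (actR k n) actL_commute_actR

theorem act_ctmul (x : Uh k) (y : Uh n) (f : Sh k n) :
    act k n (ctmul x y) f = actL k n x (actR k n y f) := by
  rw [act, liftC_ctmul, Module.End.mul_apply]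

theorem act_left (x : Uh k) (f : Sh k n) : act k n (ctmul x 1) f = actL k n x f := by
  rw [act_ctmul, map_one, Module.End.one_apply]

theorem act_right (y : Uh n) (f : Sh k n) : act k n (ctmul 1 y) f = actR k n y f := by
  rw [act_ctmul, map_one, Module.End.one_apply]

theorem isModuleAlgebra_act : IsModuleAlgebra (tensorComul (Delta k) (Delta n))
    (tensorCounit (counit k) (counit n)) (act k n) where
  act_mul z p q := by
    let e := evalTensor (LinearMap.mul Rh (Sh k n)) ((act k n).toLinearMap.flip p)
      ((act k n).toLinearMap.flip q)
    refine CTensor.apply_ext ((act k n).toLinearMap.flip (p * q))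
      (e ∘ₗ tensorComul (Delta k) (Delta n)) (fun x y => ?_) z
    let I : CTensor (Uh k) (Uh k) →ₗ[Rh] _ :=
      mapTensor (inclL (Uh k) (Uh n)).toLinearMap (inclL (Uh k) (Uh n)).toLinearMap
    let J : CTensor (Uh n) (Uh n) →ₗ[Rh] _ :=
      mapTensor (inclR (Uh k) (Uh n)).toLinearMap (inclR (Uh k) (Uh n)).toLinearMap
    have h1 : ∀ c d, e (I (Delta k x) * ctmul (ctmul 1 c) (ctmul 1 d)) =
        actL k n x (actR k n c p * actR k n d q) := by
      intro c d
      rw [actL_mul]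
      refine CTensor.apply_ext (e ∘ₗ LinearMap.mulRight Rh (ctmul (ctmul 1 c) (ctmul 1 d)) ∘ₗ I)
        (evalTensor (LinearMap.mul Rh (Sh k n)) ((actL k n).toLinearMap.flip (actR k n c p))
          ((actL k n).toLinearMap.flip (actR k n d q))) (fun a b => ?_) (Delta k x)
      simp only [LinearMap.comp_apply, I, mapTensor_ctmul, LinearMap.mulRight_apply,
        ctmul_mul_ctmul, AlgHom.toLinearMap_apply, inclL_apply, mul_one, one_mul, e,
        evalTensor_ctmul, LinearMap.flip_apply, act_ctmul]
    have h2 : ∀ w, e (I (Delta k x) * J w) = actL k n x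
        (evalTensor (LinearMap.mul Rh (Sh k n)) ((actR k n).toLinearMap.flip p)
          ((actR k n).toLinearMap.flip q) w) := by
      refine CTensor.apply_ext (e ∘ₗ LinearMap.mulLeft Rh (I (Delta k x)) ∘ₗ J)
        (actL k n x ∘ₗ evalTensor (LinearMap.mul Rh (Sh k n)) ((actR k n).toLinearMap.flip p)
          ((actR k n).toLinearMap.flip q)) fun c d => ?_
      rw [LinearMap.comp_apply, LinearMap.comp_apply, LinearMap.comp_apply, mapTensor_ctmul,
        LinearMap.mulLeft_apply, evalTensor_ctmul]
      exact h1 c d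
    rw [LinearMap.comp_apply, tensorComul, evalTensor_ctmul, LinearMap.flip_apply,
      AlgHom.toLinearMap_apply, act_ctmul, actR_mul]
    exact (h2 (Delta n y)).symm
  act_one z := by
    refine CTensor.apply_ext ((act k n).toLinearMap.flip 1)
      (LinearMap.toSpanSingleton Rh (Sh k n) 1 ∘ₗ tensorCounit (counit k) (counit n))
      (fun x y => ?_) z
    rw [LinearMap.comp_apply, tensorCounit, evalTensor_ctmul, LinearMap.flip_apply,
      AlgHom.toLinearMap_apply, act_ctmul, actR_one, map_smul, actL_one,
      LinearMap.toSpanSingleton_apply, smul_smul, mul_comm]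
    rfl

end Action

/-! ### A matrix solution of the `RTT` relations -/

section Smat

variable {k : ℕ}

/-- An upper triangular `RTT` matrix with entries in the matrix algebra: the `L`-operator of the
vector representation. -/
def Smat (a b : Fin k) : Matrix (Fin k) (Fin k) Rh :=
  if a = b then Matrix.diagonal fun u => if u = a then qq else 1
  else if a < b then (qq - qi) • Matrix.single b a 1 else 0

theorem Smat_self (a : Fin k) : Smat a a = Matrix.diagonal fun u => if u = a then qq else 1 :=
  if_pos rfl

theorem Smat_lt {a b : Fin k} (h : a < b) : Smat a b = (qq - qi) • Matrix.single b a 1 := by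
  rw [Smat, if_neg h.ne, if_pos h]

theorem Smat_gt {a b : Fin k} (h : b < a) : Smat a b = 0 := by
  rw [Smat, if_neg h.ne', if_neg h.not_gt]

theorem diagonal_mul_single (d : Fin k → Rh) (a b : Fin k) :
    Matrix.diagonal d * Matrix.single a b (1 : Rh) = d a • Matrix.single a b 1 := by
  ext u v
  simp only [Matrix.diagonal_mul, Matrix.smul_apply, Matrix.single_apply, smul_eq_mul]
  by_cases h : a = u ∧ b = v
  · rw [h.1]
  · rw [if_neg h, mul_zero, mul_zero]

theorem single_mul_diagonal (d : Fin k → Rh) (a b : Fin k) :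
    Matrix.single a b (1 : Rh) * Matrix.diagonal d = d b • Matrix.single a b 1 := by
  ext u v
  simp only [Matrix.mul_diagonal, Matrix.smul_apply, Matrix.single_apply, smul_eq_mul]
  by_cases h : a = u ∧ b = v
  · rw [h.2, mul_comm]
  · rw [if_neg h, mul_zero, zero_mul]

theorem single_mul_single_ne {a b c d : Fin k} (h : b ≠ c) :
    Matrix.single a b (1 : Rh) * Matrix.single c d 1 = 0 :=
  Matrix.single_mul_single_of_ne _ _ _ _ h _

theorem Smat_self_mul_lt {c a b : Fin k} (h : a < b) :
    Smat c c * Smat a b = ((qq - qi) * if b = c then qq else 1) • Matrix.single b a 1 := by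
  rw [Smat_self, Smat_lt h, mul_smul_comm, diagonal_mul_single, smul_smul]

theorem Smat_lt_mul_self {c a b : Fin k} (h : a < b) :
    Smat a b * Smat c c = ((qq - qi) * if a = c then qq else 1) • Matrix.single b a 1 := by
  rw [Smat_self, Smat_lt h, smul_mul_assoc, single_mul_diagonal, smul_smul]

theorem Smat_lt_mul_lt {a b c d : Fin k} (h : a < b) (h' : c < d) (hne : a ≠ d) :
    Smat a b * Smat c d = 0 := by
  rw [Smat_lt h, Smat_lt h', smul_mul_smul_comm, single_mul_single_ne hne, smul_zero]

theorem rtt_Smat : RTT (Smat (k := k)) := by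
  refine RTT.of_relations ?_ ?_ ?_ ?_
  · intro i a j b hia hbj
    rcases lt_trichotomy a b with h | rfl | h
    · rw [Smat_lt_mul_lt (hia.trans (h.trans hbj)) h (hia.trans h).ne,
        Smat_lt_mul_lt h (hia.trans (h.trans hbj)) (h.trans hbj).ne]
    · rw [Smat_lt_mul_self (hia.trans hbj), Smat_self_mul_lt (hia.trans hbj), if_neg hia.ne,
        if_neg hbj.ne']
    · rw [Smat_gt h, mul_zero, zero_mul]
  · intro i a j hia
    rcases lt_trichotomy a j with h | rfl | h
    · rw [Smat_lt_mul_lt (hia.trans h) h (hia.trans h).ne, Smat_lt_mul_lt h (hia.trans h) h.ne,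
        smul_zero]
    · rw [Smat_lt_mul_self hia, Smat_self_mul_lt hia, if_neg hia.ne, if_pos rfl, smul_smul,
        mul_left_comm, qi_mul_qq]
    · rw [Smat_gt h, mul_zero, zero_mul, smul_zero]
  · intro i j b hjb
    rcases lt_trichotomy i j with h | rfl | h
    · rw [Smat_lt_mul_lt h (h.trans hjb) (h.trans hjb).ne, Smat_lt_mul_lt (h.trans hjb) h h.ne,
        smul_zero]
    · rw [Smat_lt_mul_self hjb, Smat_self_mul_lt hjb, if_neg hjb.ne', if_pos rfl, smul_smul,
        mul_left_comm, qi_mul_qq]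
    · rw [Smat_gt h, mul_zero, zero_mul, smul_zero]
  · intro i a j b hia hjb
    rcases lt_trichotomy i j with h | rfl | h
    · rcases lt_trichotomy a b with h' | rfl | h'
      · rw [Smat_lt_mul_lt h h' (hia.trans h').ne]
        rcases lt_trichotomy a j with h2 | rfl | h2
        · rw [Smat_lt_mul_lt h' h h2.ne, Smat_lt_mul_lt h2 (hia.trans h') h'.ne]
          simp
        · rw [Smat_self_mul_lt (hia.trans h'), if_neg h'.ne', Smat_lt h', Smat_lt h,
            smul_mul_smul_comm, Matrix.single_mul_single_same]
          simp
        · rw [Smat_gt h2, Smat_lt_mul_lt h' h h2.ne']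
          simp
      · rw [Smat_lt_mul_self h, Smat_self_mul_lt h, if_neg hia.ne, if_neg hjb.ne, Smat_gt hjb]
        simp
      · rw [Smat_gt h', Smat_gt (hjb.trans h')]
        simp
    · rw [Smat_gt hia]
      rcases lt_trichotomy a b with h' | rfl | h'
      · rw [Smat_lt_mul_self h', Smat_self_mul_lt h', if_neg hia.ne', if_neg hjb.ne']
        simp
      · rw [Smat_self, Smat_self, Matrix.diagonal_mul_diagonal, Matrix.diagonal_mul_diagonal]
        simp [mul_comm]
      · rw [Smat_gt h']
        simp
    · rw [Smat_gt h, Smat_gt (h.trans hia)]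
      simp

theorem Smat_apply (a b u v : Fin k) : Smat a b u v =
    (if u = v ∧ a = b then (if u = a then qq else 1) else 0) +
      if v = a ∧ u = b then lc a b else 0 := by
  rcases lt_trichotomy a b with h | rfl | h
  · rw [Smat_lt h, Matrix.smul_apply, Matrix.single_apply,
      if_neg (show ¬(u = v ∧ a = b) from fun h' => h.ne h'.2), zero_add, lc, if_pos h,
      smul_eq_mul, mul_ite, mul_one, mul_zero]
    simp only [and_comm, eq_comm]
  · rw [Smat_self, Matrix.diagonal_apply, lc_self, ite_self, add_zero]
    simp
  · rw [Smat_gt h, lc, if_neg h.not_gt, ite_self, add_zero, if_neg (fun h' => h.ne' h'.2)]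
    rfl

/-- This symmetry turns the `RTT` relations of `Smat` into those of the operators `Lop` on the
generators. -/
theorem Smat_symm (a b u v : Fin k) : Smat a b u v = Smat v u b a := by
  rw [Smat_apply, Smat_apply]
  congr 1
  · by_cases h : u = v ∧ a = b
    · obtain ⟨rfl, rfl⟩ := h
      simp only [and_self, if_true, eq_comm (a := a) (b := u)]
    · rw [if_neg h, if_neg fun h' => h ⟨h'.2.symm, h'.1.symm⟩]
  · by_cases h : v = a ∧ u = b
    · rw [if_pos h, if_pos ⟨h.1.symm, h.2.symm⟩, h.1, h.2]
    · rw [if_neg h, if_neg fun h' => h ⟨h'.1.symm, h'.2.symm⟩]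

end Smat

/-! ### The commutation operators of a new column with `S_ħ(k,n)` -/

section Lop

variable {k n : ℕ}

variable (k n) in
/-- The homomorphism `σ` with `X_{i,n+1} f = ∑_c σ(f)_{ic} X_{c,n+1}` in `S_ħ(k,n+1)`, for
`f ∈ S_ħ(k,n)`. -/
def sigma : Sh k n →ₐ[Rh] Matrix (Fin k) (Fin k) (Sh k n) :=
  Sh.lift _ ((rtt_Smat.map ((Algebra.ofId Rh (Sh k n)).mapMatrix)).mul
    ((Sh.rtt_X k n).map (Matrix.scalarAlgHom (Fin k) Rh)) fun a b c j => by
      ext u v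
      simp [Matrix.mul_diagonal, Matrix.diagonal_mul, Algebra.ofId_apply, Algebra.commutes])

theorem sigma_X (a : Fin k) (j : Fin n) (i c : Fin k) :
    sigma k n (Sh.X a j) i c = ∑ b, Smat a b i c • Sh.X b j := by
  rw [sigma, Sh.lift_X, Matrix.sum_apply]
  simp [Matrix.mul_diagonal, Algebra.ofId_apply, ← Algebra.smul_def]

/-- The operator `f ↦ σ(f)_{ic}`. -/
def Lop (i c : Fin k) : Module.End Rh (Sh k n) :=
  Matrix.entryLinearMap Rh (Sh k n) i c ∘ₗ (sigma k n).toLinearMap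

theorem Lop_apply (i c : Fin k) (f : Sh k n) : Lop i c f = sigma k n f i c := rfl

theorem Lop_X (a : Fin k) (j : Fin n) (i c : Fin k) :
    Lop i c (Sh.X a j) = ∑ b, Smat a b i c • Sh.X b j := sigma_X a j i c

theorem Lop_X' (a : Fin k) (j : Fin n) (i c : Fin k) : Lop i c (Sh.X a j) =
    (if i = c then (if i = a then qq else 1 : Rh) • Sh.X a j else 0) +
      if c = a then lc a i • Sh.X i j else 0 := by
  simp only [Lop_X, Smat_apply, add_smul, Finset.sum_add_distrib]
  congr 1
  · rw [Finset.sum_eq_single a]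
    · by_cases h : i = c
      · rw [if_pos h, if_pos ⟨h, rfl⟩]
      · rw [if_neg h, if_neg fun h' => h h'.1, zero_smul]
    · intro b _ hb
      rw [if_neg fun h' => hb h'.2.symm, zero_smul]
    · simp
  · rw [Finset.sum_eq_single i]
    · by_cases h : c = a
      · rw [if_pos h, if_pos ⟨h, rfl⟩]
      · rw [if_neg h, if_neg fun h' => h h'.1, zero_smul]
    · intro b _ hb
      rw [if_neg fun h' => hb h'.2.symm, zero_smul]
    · simp

theorem Lop_one (i c : Fin k) : Lop i c (1 : Sh k n) = if i = c then 1 else 0 := by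
  rw [Lop_apply, map_one, Matrix.one_apply]

theorem Lop_mul (i c : Fin k) (f g : Sh k n) : Lop i c (f * g) = ∑ d, Lop i d f * Lop d c g := by
  rw [Lop_apply, map_mul, Matrix.mul_apply]
  rfl

/-- On products, the relations follow from `Lop_mul` in the same way as for a product of `RTT`
matrices. -/
theorem rtt_Lop : RTT (Lop (k := k) (n := n)) := by
  let good : Submodule Rh (Sh k n) := ⨅ i, ⨅ a, ⨅ j, ⨅ b, LinearMap.eqLocus
    (rc j b • (Lop i b * Lop a j) - lc j b • (Lop i j * Lop a b))
    (rc i a • (Lop a j * Lop i b) - lc i a • (Lop i j * Lop a b))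
  have hmem : ∀ f, f ∈ good ↔ RTT4 fun i j a b => Lop i j (Lop a b f) := fun f => by
    simp only [good, Submodule.mem_iInf, LinearMap.mem_eqLocus]; rfl
  have hX : ∀ u v, Sh.X u v ∈ good := fun u v => by
    rw [hmem]
    have h : ∀ i j a b : Fin k, Lop i j (Lop a b (Sh.X u v)) =
        ∑ w, (Smat j i * Smat b a) w u • Sh.X w v := by
      intro i j a b
      rw [Lop_X, map_sum]
      simp only [map_smul, Lop_X, Finset.smul_sum, smul_smul, Matrix.mul_apply, Finset.sum_smul]
      rw [Finset.sum_comm]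
      refine Finset.sum_congr rfl fun w _ => Finset.sum_congr rfl fun x _ => ?_
      rw [Smat_symm u, Smat_symm x, mul_comm]
    intro i a j b
    simp only [h, Finset.smul_sum, smul_smul, ← Finset.sum_sub_distrib, ← sub_smul]
    refine Finset.sum_congr rfl fun w _ => ?_
    congr 1
    exact (congrFun₂ (rtt_Smat j b i a) w u).symm
  have hmul : ∀ f g, f ∈ good → g ∈ good → f * g ∈ good := by
    intro f g hf hg
    rw [hmem] at hf hg ⊢
    intro i a j b
    have h : ∀ i j a b : Fin k, Lop i j (Lop a b (f * g)) =
        ∑ c, ∑ d, Lop i c (Lop a d f) * Lop c j (Lop d b g) := by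
      intro i j a b
      simp only [Lop_mul, map_sum]
      exact Finset.sum_comm
    simp only [h]
    exact RTT4.mul hf hg i a j b
  have h1 : (1 : Sh k n) ∈ good := by
    rw [hmem]
    have h : ∀ i j a b : Fin k, Lop i j (Lop a b (1 : Sh k n)) =
        if i = j ∧ a = b then 1 else 0 := by
      intro i j a b
      rw [Lop_one, apply_ite (Lop i j), Lop_one, map_zero]
      simp only [ite_and]
      split_ifs <;> rfl
    intro i a j b
    have := congrArg (fun c : Rh => c • (1 : Sh k n))
      (rc_lc_diagonal (fun _ _ => 1) (fun _ _ => rfl) i a j b)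
    simp only [h]
    simpa only [mul_ite, mul_one, mul_zero, sub_smul, ite_smul, zero_smul, smul_ite,
      smul_zero] using this
  intro i a j b
  refine LinearMap.ext fun f => ?_
  exact (hmem f).mp (Sh.induction good
    (isClosedSub_iInf fun _ => isClosedSub_iInf fun _ => isClosedSub_iInf fun _ =>
      isClosedSub_iInf fun _ => isClosedSub_eqLocus _ _) h1
    (fun i j g hg => hmul _ _ (hX i j) hg) f) i a j b

end Lop

/-! ### Linear independence of the monomials -/

section NewColumn

variable {k n : ℕ}

/-- Operators act pointwise on functions. -/
def pointwise (ι S : Type) [AddCommGroup S] [Module Rh S] :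
    Module.End Rh S →ₐ[Rh] Module.End Rh (ι → S) :=
  AlgHom.ofLinearMap
    { toFun := fun f => f.compLeft ι
      map_add' := fun _ _ => rfl
      map_smul' := fun _ _ => rfl } rfl fun _ _ => rfl

theorem pointwise_apply {ι S : Type} [AddCommGroup S] [Module Rh S] (f : Module.End Rh S)
    (φ : ι → S) (i : ι) : pointwise ι S f φ i = f (φ i) := rfl

theorem pointwise_single {ι S : Type} [AddCommGroup S] [Module Rh S] [DecidableEq ι]
    (f : Module.End Rh S) (m : ι) (v : S) :
    pointwise ι S f (Pi.single m v) = Pi.single m (f v) := by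
  ext i
  rw [pointwise_apply, ← Pi.apply_single (fun _ => f) (fun _ => map_zero f)]

/-- Left multiplication by the generator `X_c` of a column, in the basis of column monomials, on
functions of the exponents with coefficients in a module. -/
def colOp (S : Type) [AddCommGroup S] [Module Rh S] (c : Fin k) :
    Module.End Rh ((Fin k → ℕ) → S) where
  toFun φ m := if m c = 0 then 0 else qq ^ (∑ i ∈ Finset.Iio c, m i) • φ (m - Pi.single c 1)
  map_add' φ ψ := by
    ext m
    by_cases h : m c = 0 <;> simp [h]
  map_smul' r φ := by
    ext m
    by_cases h : m c = 0
    · simp [h]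
    · simp only [if_neg h, Pi.smul_apply, RingHom.id_apply]
      exact smul_comm _ _ _

variable {S : Type} [AddCommGroup S] [Module Rh S]

theorem colOp_apply (c : Fin k) (φ : (Fin k → ℕ) → S) (m : Fin k → ℕ) : colOp S c φ m =
    if m c = 0 then 0 else qq ^ (∑ i ∈ Finset.Iio c, m i) • φ (m - Pi.single c 1) := rfl

theorem pointwise_commute_colOp (f : Module.End Rh S) (c : Fin k) :
    Commute (pointwise (Fin k → ℕ) S f) (colOp S c) := by
  refine LinearMap.ext fun φ => funext fun m => ?_
  rw [Module.End.mul_apply, Module.End.mul_apply, pointwise_apply, colOp_apply, colOp_apply,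
    apply_ite f, map_zero, map_smul, pointwise_apply]

theorem sum_Iio_sub_single_of_ge {a i : Fin k} (h : a ≤ i) (m : Fin k → ℕ) :
    ∑ c ∈ Finset.Iio a, (m - Pi.single i 1 : Fin k → ℕ) c = ∑ c ∈ Finset.Iio a, m c := by
  refine Finset.sum_congr rfl fun c hc => ?_
  have : c ≠ i := ((Finset.mem_Iio.mp hc).trans_le h).ne
  simp [this]

theorem sum_Iio_sub_single_of_lt {a i : Fin k} (h : i < a) {m : Fin k → ℕ} (hm : m i ≠ 0) :
    ∑ c ∈ Finset.Iio a, m c = ∑ c ∈ Finset.Iio a, (m - Pi.single i 1 : Fin k → ℕ) c + 1 := by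
  have h1 : ∀ c, m c = (m - Pi.single i 1 : Fin k → ℕ) c + if c = i then 1 else 0 := by
    intro c
    by_cases hc : c = i
    · subst hc
      simp only [Pi.sub_apply, Pi.single_eq_same, if_true]
      omega
    · simp [hc]
  rw [Finset.sum_congr rfl fun c _ => h1 c, Finset.sum_add_distrib, Finset.sum_ite_eq',
    if_pos (Finset.mem_Iio.mpr h)]

theorem rtt_colOp : RTT fun (c : Fin k) (_ : Fin 1) => colOp S c := by
  refine RTT.of_relations (fun _ h => absurd h (by omega)) (fun {i a} _ h => ?_)
    (fun _ _ _ h => absurd h (by omega)) (fun _ h => absurd h (by omega))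
  refine LinearMap.ext fun φ => funext fun m => ?_
  simp only [Module.End.mul_apply, LinearMap.smul_apply, Pi.smul_apply, colOp_apply]
  by_cases hi : m i = 0
  · simp [hi]
  by_cases ha : m a = 0
  · simp [ha]
  rw [if_neg hi, if_neg ha, if_neg (by simpa [h.ne'] using ha), if_neg (by simpa [h.ne] using hi),
    sum_Iio_sub_single_of_lt h hi, sum_Iio_sub_single_of_ge h.le, tsub_right_comm, smul_smul,
    smul_smul, smul_smul]
  congr 1
  linear_combination (-(qq ^ (∑ c ∈ Finset.Iio i, m c) *
    qq ^ (∑ c ∈ Finset.Iio a, (m - Pi.single i 1 : Fin k → ℕ) c))) * qi_mul_qq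

theorem colOp_single (c : Fin k) (m : Fin k → ℕ) (v : S) : colOp S c (Pi.single m v) =
    qq ^ (∑ i ∈ Finset.Iio c, m i) • Pi.single (m + Pi.single c 1) v := by
  ext m'
  rw [colOp_apply, Pi.smul_apply]
  by_cases h : m' = m + Pi.single c 1
  · have h2 : m' - Pi.single c 1 = m := by rw [h]; exact add_tsub_cancel_right _ _
    rw [if_neg (by simp [h]), h2, ← sum_Iio_sub_single_of_ge le_rfl m', h2, h, Pi.single_eq_same,
      Pi.single_eq_same]
  · rw [Pi.single_eq_of_ne h, smul_zero]
    split_ifs with h0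
    · rfl
    · rw [Pi.single_eq_of_ne, smul_zero]
      intro h2
      refine h (h2 ▸ (tsub_add_cancel_of_le fun i => ?_).symm)
      by_cases hi : i = c
      · subst hi; simp; omega
      · simp [hi]

/-- The action of the generators `X_{i,n+1}` of the new column: `f X_{n+1}^m` goes to
`∑_c σ(f)_{ic} X_{c,n+1} X_{n+1}^m`. -/
def newCol (i : Fin k) : Module.End Rh ((Fin k → ℕ) → Sh k n) :=
  ∑ c, pointwise (Fin k → ℕ) (Sh k n) (Lop i c) * colOp (Sh k n) c

theorem rtt_newCol : RTT fun (i : Fin k) (_ : Fin 1) => newCol (n := n) i :=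
  (rtt_Lop.map (pointwise (Fin k → ℕ) (Sh k n))).mul rtt_colOp
    fun _ _ _ _ => pointwise_commute_colOp _ _

variable (k n) in
/-- Pointwise left multiplication. -/
def mulOp : Sh k n →ₐ[Rh] Module.End Rh ((Fin k → ℕ) → Sh k n) :=
  (pointwise (Fin k → ℕ) (Sh k n)).comp (Algebra.lmul Rh (Sh k n))

theorem mulOp_apply (f : Sh k n) : mulOp k n f = pointwise _ _ (LinearMap.mulLeft Rh f) := rfl

/-- The commutation rule of the generators of the new column with the old ones. -/
theorem newCol_mul_mulOp (i a : Fin k) (j : Fin n) : newCol i * mulOp k n (Sh.X a j) =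
    (if i = a then qq else 1 : Rh) • (mulOp k n (Sh.X a j) * newCol i) +
      lc a i • (mulOp k n (Sh.X i j) * newCol a) := by
  have h : ∀ c, pointwise (Fin k → ℕ) (Sh k n) (Lop i c) * mulOp k n (Sh.X a j) =
      (if i = a then qq else 1 : Rh) • (mulOp k n (Sh.X a j) * pointwise _ _ (Lop i c)) +
        lc a i • (mulOp k n (Sh.X i j) * pointwise _ _ (Lop a c)) := by
    intro c
    rw [mulOp_apply, mulOp_apply, ← map_mul, ← map_mul, ← map_mul, ← map_smul, ← map_smul,
      ← map_add]
    congr 1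
    refine LinearMap.ext fun f => ?_
    simp only [Module.End.mul_apply, LinearMap.mulLeft_apply, LinearMap.add_apply,
      LinearMap.smul_apply, Lop_mul, Lop_X', add_mul, ite_mul, zero_mul, smul_mul_assoc,
      Finset.sum_add_distrib, Finset.sum_ite_eq, Finset.sum_ite_eq', Finset.mem_univ, if_true]
  rw [newCol, newCol, Finset.sum_mul, Finset.mul_sum, Finset.mul_sum, Finset.smul_sum,
    Finset.smul_sum, ← Finset.sum_add_distrib]
  refine Finset.sum_congr rfl fun c _ => ?_
  have hc : Commute (mulOp k n (Sh.X a j)) (colOp (Sh k n) c) :=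
    pointwise_commute_colOp (LinearMap.mulLeft Rh (Sh.X a j)) c
  rw [mul_assoc, ← hc.eq, ← mul_assoc, h, add_mul, smul_mul_assoc, smul_mul_assoc, mul_assoc,
    mul_assoc]

/-- The action of the generators of `S_ħ(k,n+1)` on functions with values in `S_ħ(k,n)`.  A function
`φ` stands for `∑ φ(m) X_{n+1}^m`. -/
def extOp (i : Fin k) : Fin (n + 1) → Module.End Rh ((Fin k → ℕ) → Sh k n) :=
  Fin.snoc (α := fun _ => Module.End Rh ((Fin k → ℕ) → Sh k n)) (fun j => mulOp k n (Sh.X i j))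
    (newCol i)

theorem extOp_castSucc (i : Fin k) (j : Fin n) : extOp i j.castSucc = mulOp k n (Sh.X i j) :=
  Fin.snoc_castSucc (α := fun _ => Module.End Rh ((Fin k → ℕ) → Sh k n)) _ _ _

theorem extOp_last (i : Fin k) : extOp i (Fin.last n) = newCol i :=
  Fin.snoc_last (α := fun _ => Module.End Rh ((Fin k → ℕ) → Sh k n)) _ _

theorem rtt_extOp : RTT (extOp (k := k) (n := n)) := by
  have hq : qi * qq = 1 := qi_mul_qq
  intro i a j b
  refine Fin.lastCases ?_ (fun j => ?_) j <;> refine Fin.lastCases ?_ (fun b => ?_) b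
  · simp only [extOp_last]
    have := rtt_newCol (n := n) i a 0 0
    simpa only [rc_self, lc_self] using this
  · have h1 : rc (Fin.last n) b.castSucc = 1 := if_neg (Fin.castSucc_lt_last b).ne'
    have h2 : lc (Fin.last n) b.castSucc = 0 := if_neg (Fin.castSucc_lt_last b).not_gt
    simp only [extOp_last, extOp_castSucc, h1, h2, newCol_mul_mulOp]
    simp only [rc, lc]
    rcases lt_trichotomy i a with h | rfl | h
    · simp [h, h.ne, h.ne', h.not_gt]
    · simp [smul_smul, hq]
    · simp [h, h.ne, h.ne', h.not_gt]
  · have h1 : rc j.castSucc (Fin.last n) = 1 := if_neg (Fin.castSucc_lt_last j).ne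
    have h2 : lc j.castSucc (Fin.last n) = qq - qi := if_pos (Fin.castSucc_lt_last j)
    simp only [extOp_last, extOp_castSucc, h1, h2, newCol_mul_mulOp]
    simp only [rc, lc]
    rcases lt_trichotomy i a with h | rfl | h
    · simp [h, h.ne, h.not_gt]
    · simp [smul_smul, sub_smul]
    · simp [h, h.ne', h.not_gt]
  · have h := Sh.rtt_X k n i a j b
    have h1 : rc j.castSucc b.castSucc = rc j b := by simp [rc]
    have h2 : lc j.castSucc b.castSucc = lc j b := by simp [lc]
    simp only [extOp_castSucc, h1, h2, ← map_mul, ← map_smul, ← map_sub, h]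

variable (k n) in
/-- The representation of `S_ħ(k,n+1)` on functions of the exponents of the last column with values
in `S_ħ(k,n)`. -/
def extRep : Sh k (n + 1) →ₐ[Rh] Module.End Rh ((Fin k → ℕ) → Sh k n) := Sh.lift extOp rtt_extOp

theorem newCol_single (i : Fin k) (m : Fin k → ℕ) : newCol (n := n) i (Pi.single m 1) =
    qq ^ (∑ c ∈ Finset.Iio i, m c) • Pi.single (m + Pi.single i 1) 1 := by
  rw [newCol, LinearMap.sum_apply, Finset.sum_eq_single i]
  · rw [Module.End.mul_apply, colOp_single, map_smul, pointwise_single, Lop_one, if_pos rfl]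
  · intro c _ hc
    rw [Module.End.mul_apply, colOp_single, map_smul, pointwise_single, Lop_one, if_neg hc.symm,
      Pi.single_zero, smul_zero]
  · simp

theorem newCol_pow_single (i : Fin k) (m : Fin k → ℕ) (hm : ∀ c < i, m c = 0) (r : ℕ) :
    (newCol (n := n) i ^ r) (Pi.single m 1) = Pi.single (m + Pi.single i r) 1 := by
  induction r with
  | zero => simp
  | succ r ih =>
    rw [pow_succ', Module.End.mul_apply, ih, newCol_single, Finset.sum_eq_zero, pow_zero, one_smul,
      add_assoc, ← Pi.single_add]
    intro c hc
    have hc := Finset.mem_Iio.mp hc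
    simp [hm c hc, hc.ne]

theorem newCol_list_single (m : Fin k → ℕ) (l : List (Fin k)) (hl : l.Pairwise (· < ·)) :
    ((l.map fun i => newCol (n := n) i ^ m i).prod) (Pi.single 0 1) =
      Pi.single (fun i => if i ∈ l then m i else 0) 1 := by
  induction l with
  | nil => simp; rfl
  | cons a l ih =>
    rw [List.pairwise_cons] at hl
    rw [List.map_cons, List.prod_cons, Module.End.mul_apply, ih hl.2, newCol_pow_single]
    · congr 1
      ext i
      by_cases hi : i = a
      · subst hi
        have : i ∉ l := fun h => lt_irrefl _ (hl.1 i h)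
        simp [this]
      · simp [hi]
    · intro c hc
      exact if_neg fun h => lt_asymm hc (hl.1 c h)

end NewColumn

section Coefficients

variable {k n : ℕ}

/-- The monomial `∏ X_{ij}^{m i}` of the `j`-th column. -/
def colMonomial (j : Fin n) (m : Fin k → ℕ) : Sh k n := (List.ofFn fun i => Sh.X i j ^ m i).prod

theorem monomial_eq (m : Matrix (Fin k) (Fin n) ℕ) :
    Sh.monomial m = (List.ofFn fun j => colMonomial j fun i => m i j).prod := rfl

/-- The homomorphism induced by a strictly monotone map of the columns. -/
def colMap (k : ℕ) {n n' : ℕ} (φ : Fin n → Fin n') (hφ : StrictMono φ) : Sh k n →ₐ[Rh] Sh k n' :=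
  Sh.lift (fun i j => Sh.X i (φ j)) (by
    intro i a j b
    have h := Sh.rtt_X k n' i a (φ j) (φ b)
    simpa only [rc, lc, hφ.lt_iff_lt, hφ.injective.eq_iff] using h)

theorem colMap_X {n' : ℕ} (φ : Fin n → Fin n') (hφ : StrictMono φ) (i : Fin k) (j : Fin n) :
    colMap k φ hφ (Sh.X i j) = Sh.X i (φ j) := Sh.lift_X _ _ _ _

variable (k n) in
/-- The inclusion of the first `n` columns. -/
def initCol : Sh k n →ₐ[Rh] Sh k (n + 1) := colMap k Fin.castSucc Fin.strictMono_castSucc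

theorem map_colMonomial {n' : ℕ} {f : Sh k n →ₐ[Rh] Sh k n'} {φ : Fin n → Fin n'}
    (hf : ∀ i j, f (Sh.X i j) = Sh.X i (φ j)) (j : Fin n) (m : Fin k → ℕ) :
    f (colMonomial j m) = colMonomial (φ j) m := by
  rw [colMonomial, map_list_prod, List.map_ofFn, colMonomial]
  congr 2
  ext i
  rw [Function.comp_apply, map_pow, hf]

theorem monomial_succ (m : Matrix (Fin k) (Fin (n + 1)) ℕ) : Sh.monomial m =
    initCol k n (Sh.monomial (Matrix.of fun i j => m i j.castSucc)) *
      colMonomial (Fin.last n) fun i => m i (Fin.last n) := by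
  rw [monomial_eq, List.ofFn_succ', List.concat_eq_append, List.prod_append, List.prod_singleton,
    monomial_eq, map_list_prod, List.map_ofFn]
  congr 3
  ext j
  exact (map_colMonomial (colMap_X _ _) j _).symm

theorem extRep_initCol (f : Sh k n) : extRep k n (initCol k n f) = mulOp k n f := by
  have : (extRep k n).comp (initCol k n) = mulOp k n :=
    Sh.algHom_ext fun i j => by
      rw [AlgHom.comp_apply, initCol, colMap_X, extRep, Sh.lift_X, extOp_castSucc]
  exact DFunLike.congr_fun this f

/-- The representation recovers the exponents of a monomial of the last column from its action on
the function that represents `1`. -/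
theorem extRep_colMonomial (m : Fin k → ℕ) :
    extRep k n (colMonomial (Fin.last n) m) (Pi.single 0 1) = Pi.single m 1 := by
  rw [colMonomial, map_list_prod, List.map_ofFn, List.ofFn_eq_map]
  have : (fun i => extRep k n (Sh.X i (Fin.last n) ^ m i)) = fun i => newCol i ^ m i := by
    ext1 i
    rw [map_pow, extRep, Sh.lift_X, extOp_last]
  change ((List.map (fun i => extRep k n (Sh.X i (Fin.last n) ^ m i)) (List.finRange k)).prod) _ = _
  rw [this, newCol_list_single _ _ (List.pairwise_lt_finRange k)]
  simp

/-- There are linear functionals which compute the coefficients of combinations of monomials. -/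
theorem exists_coeff (k n : ℕ) : ∃ Λ : Sh k n →ₗ[Rh] (Matrix (Fin k) (Fin n) ℕ → Rh),
    ∀ m, Λ (Sh.monomial m) = Pi.single m 1 := by
  induction n with
  | zero =>
    refine ⟨LinearMap.pi fun _ => (Sh.lift (fun _ _ => 0) fun _ _ j => j.elim0 :
      Sh k 0 →ₐ[Rh] Rh).toLinearMap, fun m => funext fun m' => ?_⟩
    have : m' = m := by ext i j; exact j.elim0
    rw [this, Pi.single_eq_same, LinearMap.pi_apply, AlgHom.toLinearMap_apply, monomial_eq,
      List.ofFn_zero, List.prod_nil, map_one]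
  | succ n ih =>
    obtain ⟨Λ, hΛ⟩ := ih
    let θ : Sh k (n + 1) →ₗ[Rh] ((Fin k → ℕ) → Sh k n) :=
      LinearMap.applyₗ (Pi.single 0 1) ∘ₗ (extRep k n).toLinearMap
    refine ⟨LinearMap.pi fun m : Matrix (Fin k) (Fin (n + 1)) ℕ =>
      LinearMap.proj (Matrix.of fun i j => m i j.castSucc) ∘ₗ Λ ∘ₗ
      LinearMap.proj (fun i => m i (Fin.last n)) ∘ₗ θ, fun m => funext fun m' => ?_⟩
    have h : θ (Sh.monomial m) = Pi.single (fun i => m i (Fin.last n))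
        (Sh.monomial (Matrix.of fun i j => m i j.castSucc)) := by
      change extRep k n (Sh.monomial m) (Pi.single 0 1) = _
      rw [monomial_succ, map_mul, Module.End.mul_apply, extRep_initCol, extRep_colMonomial,
        mulOp_apply, pointwise_single, LinearMap.mulLeft_apply, mul_one]
    rw [LinearMap.pi_apply, LinearMap.comp_apply, LinearMap.comp_apply, LinearMap.comp_apply, h,
      LinearMap.proj_apply, LinearMap.proj_apply]
    by_cases h1 : (fun i => m' i (Fin.last n)) = fun i => m i (Fin.last n)
    · rw [h1, Pi.single_eq_same, hΛ]
      by_cases h2 : (Matrix.of fun i j => m' i j.castSucc : Matrix (Fin k) (Fin n) ℕ) =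
          Matrix.of fun i j => m i j.castSucc
      · have : m' = m := by
          ext i j
          refine Fin.lastCases (congrFun h1 i) (fun j => congrFun₂ h2 i j) j
        rw [h2, this, Pi.single_eq_same, Pi.single_eq_same]
      · rw [Pi.single_eq_of_ne h2, Pi.single_eq_of_ne]
        rintro rfl
        exact h2 rfl
    · rw [Pi.single_eq_of_ne h1, map_zero, Pi.zero_apply, Pi.single_eq_of_ne]
      rintro rfl
      exact h1 rfl

variable (k n) in
/-- The coefficients with respect to the monomials. -/
def coeff : Sh k n →ₗ[Rh] (Matrix (Fin k) (Fin n) ℕ → Rh) := (exists_coeff k n).choose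

theorem coeff_monomial (m : Matrix (Fin k) (Fin n) ℕ) :
    coeff k n (Sh.monomial m) = Pi.single m 1 := (exists_coeff k n).choose_spec m

end Coefficients

/-! ### The monomials span -/

section Span

variable {k n : ℕ}

theorem hbar_dvd_qi_sub_one : hbar ∣ qi - 1 := by
  rw [PowerSeries.X_dvd_iff, map_sub, map_one, qi, ← PowerSeries.coeff_zero_eq_constantCoeff_apply]
  simp [expH]

theorem hbar_dvd_rc_sub_one {p : ℕ} (i j : Fin p) : hbar ∣ rc i j - 1 := by
  rw [rc]
  split_ifs
  · exact hbar_dvd_qi_sub_one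
  · rw [sub_self]; exact dvd_zero _

theorem hbar_dvd_lc {p : ℕ} (i j : Fin p) : hbar ∣ lc i j := by
  rw [lc]
  split_ifs
  · exact ⟨_, qq_sub_qi⟩
  · exact dvd_zero _

/-- The product of a list of generators. -/
def genProd (l : List (Fin k × Fin n)) : Sh k n := (l.map fun e => Sh.X e.1 e.2).prod

theorem genProd_cons (e : Fin k × Fin n) (l : List (Fin k × Fin n)) :
    genProd (e :: l) = Sh.X e.1 e.2 * genProd l := by
  rw [genProd, List.map_cons, List.prod_cons, genProd]

theorem X_mem_homog (i : Fin k) (j : Fin n) : Sh.X i j ∈ Sh.homog k n 1 := by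
  rw [Sh.homog, pow_one]
  exact Submodule.subset_span ⟨(i, j), rfl⟩

theorem mul_mem_homog {d d' : ℕ} {f g : Sh k n} (hf : f ∈ Sh.homog k n d)
    (hg : g ∈ Sh.homog k n d') : f * g ∈ Sh.homog k n (d + d') := by
  rw [Sh.homog, pow_add]
  exact Submodule.mul_mem_mul hf hg

theorem one_mem_homog : (1 : Sh k n) ∈ Sh.homog k n 0 := by
  rw [Sh.homog, pow_zero]
  exact Submodule.one_le.mp le_rfl

theorem genProd_mem_homog (l : List (Fin k × Fin n)) : genProd l ∈ Sh.homog k n l.length := by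
  induction l with
  | nil => exact one_mem_homog
  | cons e l ih =>
    rw [genProd_cons, List.length_cons, add_comm]
    exact mul_mem_homog (X_mem_homog _ _) ih

/-- The algebra `S_ħ(k,n)` is commutative modulo `ħ`. -/
theorem X_mul_X_sub (e f : Fin k × Fin n) : ∃ z ∈ Sh.homog k n 2,
    Sh.X e.1 e.2 * Sh.X f.1 f.2 - Sh.X f.1 f.2 * Sh.X e.1 e.2 = hbar • z := by
  obtain ⟨i, b⟩ := e
  obtain ⟨a, j⟩ := f
  obtain ⟨c1, h1⟩ := hbar_dvd_rc_sub_one j b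
  obtain ⟨c2, h2⟩ := hbar_dvd_lc j b
  obtain ⟨c3, h3⟩ := hbar_dvd_rc_sub_one i a
  obtain ⟨c4, h4⟩ := hbar_dvd_lc i a
  have h := Sh.rtt_X k n i a j b
  have hm : ∀ (i a : Fin k) (j b : Fin n), Sh.X i j * Sh.X a b ∈ Sh.homog k n 2 := fun i a j b =>
    mul_mem_homog (X_mem_homog _ _) (X_mem_homog _ _)
  refine ⟨c3 • (Sh.X a j * Sh.X i b) - c4 • (Sh.X i j * Sh.X a b) -
    c1 • (Sh.X i b * Sh.X a j) + c2 • (Sh.X i j * Sh.X a b),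
    Submodule.add_mem _ (Submodule.sub_mem _ (Submodule.sub_mem _ ?_ ?_) ?_) ?_, ?_⟩
  any_goals exact Submodule.smul_mem _ _ (hm _ _ _ _)
  rw [sub_eq_iff_eq_add] at h1 h3
  rw [h1, h2, h3, h4] at h
  simp only [add_smul, one_smul, mul_smul] at h
  rw [smul_add, smul_sub, smul_sub]
  have h' := sub_eq_zero.mpr h
  rw [← sub_eq_zero, ← h']
  abel

theorem genProd_perm {l l' : List (Fin k × Fin n)} (h : l.Perm l') :
    ∃ z ∈ Sh.homog k n l.length, genProd l - genProd l' = hbar • z := by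
  induction h with
  | nil => exact ⟨0, zero_mem _, by rw [sub_self, smul_zero]⟩
  | cons e _ ih =>
    obtain ⟨z, hz, h⟩ := ih
    refine ⟨Sh.X e.1 e.2 * z, ?_, ?_⟩
    · rw [List.length_cons, add_comm]
      exact mul_mem_homog (X_mem_homog _ _) hz
    · rw [genProd_cons, genProd_cons, ← mul_sub, h, mul_smul_comm]
  | swap e f l =>
    obtain ⟨z, hz, h⟩ := X_mul_X_sub f e
    refine ⟨z * genProd l, ?_, ?_⟩
    · rw [List.length_cons, List.length_cons, add_assoc, add_comm]
      exact mul_mem_homog hz (genProd_mem_homog l)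
    · simp only [genProd_cons]
      rw [← mul_assoc, ← mul_assoc, ← sub_mul, h, smul_mul_assoc]
  | trans h1 _ ih1 ih2 =>
    obtain ⟨z1, hz1, h1'⟩ := ih1
    obtain ⟨z2, hz2, h2'⟩ := ih2
    rw [← h1.length_eq] at hz2
    exact ⟨z1 + z2, add_mem hz1 hz2, by rw [smul_add, ← h1', ← h2']; abel⟩

/-- The list of generators of a monomial. -/
def genList (m : Matrix (Fin k) (Fin n) ℕ) : List (Fin k × Fin n) :=
  (List.ofFn fun j => (List.ofFn fun i => List.replicate (m i j) (i, j)).flatten).flatten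

theorem genProd_genList (m : Matrix (Fin k) (Fin n) ℕ) : genProd (genList m) = Sh.monomial m := by
  rw [genProd, genList, List.map_flatten, List.prod_flatten, List.map_map, List.map_ofFn,
    Sh.monomial]
  congr 2
  ext1 j
  rw [Function.comp_apply, Function.comp_apply, List.map_flatten, List.prod_flatten, List.map_map,
    List.map_ofFn]
  congr 2
  ext1 i
  simp

theorem count_genList (m : Matrix (Fin k) (Fin n) ℕ) (e : Fin k × Fin n) :
    (genList m).count e = m e.1 e.2 := by
  rw [genList, List.count_flatten, List.map_ofFn, List.sum_ofFn, Finset.sum_eq_single e.2]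
  · rw [Function.comp_apply, List.count_flatten, List.map_ofFn, List.sum_ofFn,
      Finset.sum_eq_single e.1]
    · simp
    · intro i _ hi
      simp [List.count_replicate, Prod.ext_iff, hi]
    · simp
  · intro j _ hj
    rw [Function.comp_apply, List.count_flatten, List.map_ofFn, List.sum_ofFn]
    exact Finset.sum_eq_zero fun i _ => by simp [List.count_replicate, Prod.ext_iff, hj]
  · simp

/-- The degree of a monomial. -/
def mdeg (m : Matrix (Fin k) (Fin n) ℕ) : ℕ := (genList m).length

theorem mdeg_eq (m : Matrix (Fin k) (Fin n) ℕ) : mdeg m = ∑ j, ∑ i, m i j := by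
  rw [mdeg, genList, List.length_flatten, List.map_ofFn, List.sum_ofFn]
  refine Finset.sum_congr rfl fun j _ => ?_
  rw [Function.comp_apply, List.length_flatten, List.map_ofFn, List.sum_ofFn]
  simp

theorem monomial_mem_homog (m : Matrix (Fin k) (Fin n) ℕ) :
    Sh.monomial m ∈ Sh.homog k n (mdeg m) := by
  rw [← genProd_genList]
  exact genProd_mem_homog _

theorem exists_monomial (l : List (Fin k × Fin n)) : ∃ m : Matrix (Fin k) (Fin n) ℕ,
    mdeg m = l.length ∧ ∃ z ∈ Sh.homog k n l.length, genProd l = Sh.monomial m + hbar • z := by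
  let m : Matrix (Fin k) (Fin n) ℕ := Matrix.of fun i j => l.count (i, j)
  have h : l.Perm (genList m) := List.perm_iff_count.mpr fun e => (count_genList m e).symm
  obtain ⟨z, hz, h'⟩ := genProd_perm h
  refine ⟨m, h.length_eq.symm, z, hz, ?_⟩
  rw [← genProd_genList, ← h']
  abel

theorem homog_le_span_genProd (d : ℕ) :
    Sh.homog k n d ≤ Submodule.span Rh {f | ∃ l : List (Fin k × Fin n), l.length = d ∧
      genProd l = f} := by
  induction d with
  | zero =>
    rw [Sh.homog, pow_zero, Submodule.one_le]
    exact Submodule.subset_span ⟨[], rfl, rfl⟩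
  | succ d ih =>
    rw [Sh.homog, pow_succ']
    refine (mul_le_mul_right ih _).trans ?_
    rw [Submodule.span_mul_span, Submodule.span_le]
    rintro _ ⟨_, ⟨e, rfl⟩, _, ⟨l, rfl, rfl⟩, rfl⟩
    exact Submodule.subset_span ⟨e :: l, rfl, genProd_cons e l⟩

theorem homog_fg (d : ℕ) : (Sh.homog k n d).FG :=
  Submodule.FG.pow (Submodule.fg_span (Set.finite_range _)) d

/-- The homogeneous component is spanned by the monomials of its degree: this holds modulo `ħ`, and
then by Nakayama's lemma. -/
theorem homog_eq_span (d : ℕ) : Sh.homog k n d =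
    Submodule.span Rh (Sh.monomial '' {m : Matrix (Fin k) (Fin n) ℕ | mdeg m = d}) := by
  refine le_antisymm ?_ ?_
  · refine Submodule.le_of_le_smul_of_le_jacobson_bot (homog_fg d)
      (IsAdicComplete.le_jacobson_bot hI) ((homog_le_span_genProd d).trans ?_)
    rw [Submodule.span_le]
    rintro _ ⟨l, rfl, rfl⟩
    obtain ⟨m, hm, z, hz, h⟩ := exists_monomial l
    rw [h]
    exact Submodule.add_mem_sup (Submodule.subset_span ⟨m, hm, rfl⟩)
      (Submodule.smul_mem_smul (Ideal.mem_span_singleton_self _) hz)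
  · rw [Submodule.span_le]
    rintro _ ⟨m, rfl, rfl⟩
    exact monomial_mem_homog m

theorem finite_mdeg (k n d : ℕ) : {m : Matrix (Fin k) (Fin n) ℕ | mdeg m = d}.Finite := by
  refine (Set.finite_Iic (fun _ _ => d : Fin k → Fin n → ℕ)).subset ?_
  intro m hm i j
  have h : ∑ j, ∑ i, m i j = d := (mdeg_eq m).symm.trans hm
  rw [← h]
  exact (Finset.single_le_sum (f := fun i => m i j) (fun _ _ => Nat.zero_le _)
    (Finset.mem_univ i)).trans
    (Finset.single_le_sum (f := fun j => ∑ i, m i j) (fun _ _ => Nat.zero_le _) (Finset.mem_univ j))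

variable (k n) in
/-- The projection to a homogeneous component. -/
def homogProj (d : ℕ) : Module.End Rh (Sh k n) :=
  ∑ m ∈ (finite_mdeg k n d).toFinset,
    (LinearMap.proj m ∘ₗ coeff k n).smulRight (Sh.monomial m)

theorem homogProj_monomial (m : Matrix (Fin k) (Fin n) ℕ) :
    homogProj k n (mdeg m) (Sh.monomial m) = Sh.monomial m := by
  rw [homogProj, LinearMap.sum_apply, Finset.sum_eq_single m]
  · rw [LinearMap.smulRight_apply, LinearMap.comp_apply, coeff_monomial, LinearMap.proj_apply,
      Pi.single_eq_same, one_smul]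
  · intro m' _ hm
    rw [LinearMap.smulRight_apply, LinearMap.comp_apply, coeff_monomial, LinearMap.proj_apply,
      Pi.single_eq_of_ne hm, zero_smul]
  · intro h
    exact absurd ((finite_mdeg k n _).mem_toFinset.mpr rfl) h

theorem homog_eq_eqLocus (d : ℕ) :
    Sh.homog k n d = LinearMap.eqLocus (homogProj k n d) LinearMap.id := by
  refine le_antisymm ?_ fun f hf => ?_
  · rw [homog_eq_span, Submodule.span_le]
    rintro _ ⟨m, rfl, rfl⟩
    exact homogProj_monomial m
  · rw [LinearMap.mem_eqLocus, LinearMap.id_apply] at hf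
    rw [← hf, homogProj, LinearMap.sum_apply]
    refine Submodule.sum_mem _ fun m hm => ?_
    rw [LinearMap.smulRight_apply, ← (finite_mdeg k n d).mem_toFinset.mp hm]
    exact Submodule.smul_mem _ _ (monomial_mem_homog m)

theorem isClosedSub_homog (d : ℕ) : IsClosedSub (Sh.homog k n d) := by
  rw [homog_eq_eqLocus]
  exact isClosedSub_eqLocus _ _

/-- Every element is a combination of monomials modulo `ħ`. -/
theorem exists_span_monomial_add (f : Sh k n) :
    ∃ w ∈ Submodule.span Rh (Set.range (Sh.monomial (k := k) (n := n))),
      ∃ z, f = w + hbar • z := by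
  let W := Submodule.span Rh (Set.range (Sh.monomial (k := k) (n := n)))
  let S : Submodule Rh (Sh k n) := W ⊔ LinearMap.range (LinearMap.lsmul Rh (Sh k n) hbar)
  have hS : ∀ z, hbar • z ∈ S := fun z => Submodule.mem_sup_right ⟨z, rfl⟩
  have hl : ∀ l, genProd l ∈ S := fun l => by
    obtain ⟨m, _, z, _, h⟩ := exists_monomial l
    rw [h]
    exact S.add_mem (Submodule.mem_sup_left (Submodule.subset_span ⟨m, rfl⟩)) (hS z)
  have : f ∈ S := by
    refine Sh.induction S (fun x hx => ?_) (hl []) (fun i j => ?_) f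
    · obtain ⟨z, hz⟩ := hx 1
      rw [pow_one] at hz
      exact (S.sub_mem_iff_left (hS z)).mp hz
    · change S ≤ S.comap (LinearMap.mulLeft Rh (Sh.X i j))
      refine sup_le ?_ ?_
      · rw [Submodule.span_le]
        rintro _ ⟨m, rfl⟩
        change Sh.X i j * Sh.monomial m ∈ S
        rw [← genProd_genList]
        exact (genProd_cons (i, j) _) ▸ hl ((i, j) :: genList m)
      · rintro _ ⟨z, rfl⟩
        change Sh.X i j * (hbar • z) ∈ S
        rw [mul_smul_comm]
        exact hS _
  obtain ⟨w, hw, _, ⟨z, rfl⟩, h⟩ := Submodule.mem_sup.mp this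
  exact ⟨w, hw, z, h.symm⟩

/-- The monomials span a dense subspace. -/
theorem monomial_induction (S : Submodule Rh (Sh k n)) (hS : IsClosedSub S)
    (h : ∀ m, Sh.monomial m ∈ S) (f : Sh k n) : f ∈ S := by
  refine hS f fun N => ?_
  induction N generalizing f with
  | zero => exact ⟨f, by simp⟩
  | succ N ih =>
    obtain ⟨w, hw, f', rfl⟩ := exists_span_monomial_add f
    obtain ⟨z, hz⟩ := ih f'
    refine ⟨z, ?_⟩
    rw [pow_succ', mul_smul, add_sub_assoc, ← smul_sub]
    refine S.add_mem (Submodule.span_le.mpr ?_ hw) (S.smul_mem _ hz)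
    rintro _ ⟨m, rfl⟩
    exact h m

/-! ### The action preserves the degree -/

theorem actL_mem_homog (x : Uh k) (d : ℕ) (f : Sh k n) (hf : f ∈ Sh.homog k n d) :
    actL k n x f ∈ Sh.homog k n d := by
  induction d generalizing x f with
  | zero =>
    rw [Sh.homog, pow_zero] at hf
    obtain ⟨c, rfl⟩ := Submodule.mem_one.mp hf
    rw [Algebra.algebraMap_eq_smul_one, map_smul, actL_one]
    exact Submodule.smul_mem _ _ (Submodule.smul_mem _ _ one_mem_homog)
  | succ d ih =>
    rw [Sh.homog, pow_succ'] at hf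
    refine Submodule.mul_induction_on hf (fun v hv g hg => ?_) fun f g hf hg => ?_
    · rw [actL_mul]
      refine CTensor.mem_of_ctmul_mem ((Sh.homog k n (d + 1)).comap (evalTensor
        (LinearMap.mul Rh (Sh k n)) ((actL k n).toLinearMap.flip v)
        ((actL k n).toLinearMap.flip g))) ((isClosedSub_homog _).comap _) (fun a b => ?_) _
      rw [Submodule.mem_comap, evalTensor_ctmul, add_comm]
      refine mul_mem_homog ?_ (ih b g hg)
      change v ∈ (Sh.homog k n 1).comap (actL k n a)
      refine Submodule.span_le.mpr ?_ hv
      rintro _ ⟨e, rfl⟩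
      change actL k n a (Sh.X e.1 e.2) ∈ Sh.homog k n 1
      rw [actL_X]
      exact Submodule.sum_mem _ fun i _ => Submodule.smul_mem _ _ (X_mem_homog _ _)
    · rw [map_add]
      exact Submodule.add_mem _ hf hg

/-- Algebra homomorphisms which are linear on the generators preserve the degree. -/
theorem map_homog {k' n' : ℕ} (φ : Sh k n →ₐ[Rh] Sh k' n')
    (h : ∀ i j, φ (Sh.X i j) ∈ Sh.homog k' n' 1) {d : ℕ} {f : Sh k n} (hf : f ∈ Sh.homog k n d) :
    φ f ∈ Sh.homog k' n' d := by
  have h1 : (Sh.homog k n d).map φ.toLinearMap ≤ Sh.homog k' n' d := by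
    rw [Sh.homog, Sh.homog, Submodule.map_pow]
    refine pow_le_pow_left' ?_ d
    rw [Submodule.map_span_le]
    rintro _ ⟨e, rfl⟩
    simpa [Sh.homog] using h e.1 e.2
  exact h1 ⟨f, hf, rfl⟩

theorem transpose_mem_homog {d : ℕ} {f : Sh k n} (hf : f ∈ Sh.homog k n d) :
    Sh.transpose k n f ∈ Sh.homog n k d :=
  map_homog _ (fun i j => by rw [transpose_X]; exact X_mem_homog _ _) hf

theorem actR_mem_homog (y : Uh n) (d : ℕ) (f : Sh k n) (hf : f ∈ Sh.homog k n d) :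
    actR k n y f ∈ Sh.homog k n d := by
  rw [← transpose_transpose (actR k n y f), transpose_actR]
  exact transpose_mem_homog (actL_mem_homog y d _ (transpose_mem_homog hf))

theorem act_mem_homog (d : ℕ) (z : CTensor (Uh k) (Uh n)) (f : Sh k n)
    (hf : f ∈ Sh.homog k n d) : act k n z f ∈ Sh.homog k n d := by
  refine CTensor.mem_of_ctmul_mem ((Sh.homog k n d).comap ((act k n).toLinearMap.flip f))
    ((isClosedSub_homog _).comap _) (fun x y => ?_) z
  change act k n (ctmul x y) f ∈ Sh.homog k n d
  rw [act_ctmul]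
  exact actL_mem_homog x d _ (actR_mem_homog y d f hf)

end Span

/-! ### Completed tensor powers and the map `Φ` -/

section TensorPowers

variable {M N : Type} [AddCommGroup M] [Module Rh M] [AddCommGroup N] [Module Rh N]

/-- The closure of a subspace in the `ħ`-adic topology. -/
def closureSub (W : Submodule Rh N) : Submodule Rh N where
  carrier := {x | ∀ r : ℕ, ∃ z : N, x - hbar ^ r • z ∈ W}
  add_mem' := fun {x y} hx hy r => by
    obtain ⟨z, hz⟩ := hx r
    obtain ⟨z', hz'⟩ := hy r
    refine ⟨z + z', ?_⟩
    rw [smul_add, add_sub_add_comm]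
    exact W.add_mem hz hz'
  zero_mem' := fun r => ⟨0, by simp⟩
  smul_mem' := fun c x hx r => by
    obtain ⟨z, hz⟩ := hx r
    refine ⟨c • z, ?_⟩
    rw [smul_comm, ← smul_sub]
    exact W.smul_mem _ hz

theorem isClosedSub_closureSub (W : Submodule Rh N) : IsClosedSub (closureSub W) := by
  intro x hx r
  obtain ⟨z, hz⟩ := hx r
  obtain ⟨z', hz'⟩ := hz r
  exact ⟨z + z', by rwa [smul_add, ← sub_sub]⟩

theorem le_closureSub (W : Submodule Rh N) : W ≤ closureSub W :=
  fun x hx r => ⟨0, by simpa using hx⟩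

theorem tpow_induction {a : ℕ} (S : Submodule Rh (TPow M a)) (hS : IsClosedSub S)
    (h : ∀ v : Fin a → M, tpure v ∈ S) (t : TPow M a) : t ∈ S := by
  refine hS t fun r => ?_
  obtain ⟨y, z, rfl⟩ := AdicCompletion.exists_sub_of_eq t r
  refine ⟨z, ?_⟩
  rw [add_sub_cancel_right]
  have : y ∈ Submodule.span Rh
      (Set.range (PiTensorProduct.tprod Rh (s := fun _ : Fin a => M))) := by
    rw [PiTensorProduct.span_tprod_eq_top]; trivial
  change y ∈ S.comap (AdicCompletion.of hI (TensorPower Rh a M))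
  refine Submodule.span_le.mpr ?_ this
  rintro _ ⟨v, rfl⟩
  exact h v

theorem tpow_linearMap_ext {a : ℕ} [IsHausdorff hI N] (f g : TPow M a →ₗ[Rh] N)
    (h : ∀ v : Fin a → M, f (tpure v) = g (tpure v)) (t : TPow M a) : f t = g t :=
  tpow_induction _ (isClosedSub_eqLocus f g) h t

/-- The tensor `v ↦ v 0 ⊗ ⋯` as a function of one of its factors. -/
def tpureAt {a : ℕ} (v : Fin a → M) (j : Fin a) : M →ₗ[Rh] TPow M a :=
  AdicCompletion.of hI (TensorPower Rh a M) ∘ₗ (PiTensorProduct.tprod Rh).toLinearMap v j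

theorem tpureAt_apply {a : ℕ} (v : Fin a → M) (j : Fin a) (x : M) :
    tpureAt v j x = tpure (Function.update v j x) := rfl

variable {k n : ℕ}

/-- The tensor products of monomials span a dense subspace. -/
theorem tpow_monomial_induction {a : ℕ} (S : Submodule Rh (TPow (Sh k n) a)) (hS : IsClosedSub S)
    (h : ∀ w : Fin a → Matrix (Fin k) (Fin n) ℕ, tpure (fun j => Sh.monomial (w j)) ∈ S)
    (t : TPow (Sh k n) a) : t ∈ S := by
  -- the factors are replaced by arbitrary elements one after the other
  have key : ∀ (s : Finset (Fin a)) (v : Fin a → Sh k n) (w : Fin a → Matrix (Fin k) (Fin n) ℕ),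
      (∀ j ∉ s, v j = Sh.monomial (w j)) → tpure v ∈ S := by
    intro s
    induction s using Finset.induction with
    | empty =>
      intro v w hv
      rw [show v = fun j => Sh.monomial (w j) from funext fun j => hv j (Finset.notMem_empty j)]
      exact h w
    | insert j s hj ih =>
      intro v w hv
      rw [← Function.update_eq_self j v, ← tpureAt_apply]
      refine monomial_induction (S.comap (tpureAt v j)) (hS.comap _) (fun m => ?_) (v j)
      rw [Submodule.mem_comap, tpureAt_apply]
      refine ih _ (Function.update w j m) fun i hi => ?_
      by_cases hij : i = j
      · subst hij; rw [Function.update_self, Function.update_self]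
      · rw [Function.update_of_ne hij, Function.update_of_ne hij]
        exact hv i (by simp [hij, hi])
  exact tpow_induction S hS (fun v => key Finset.univ v (fun _ => 0) fun j hj =>
    absurd (Finset.mem_univ j) hj) t

/-- The linear map `v 0 ⊗ ⋯ ⊗ v (a - 1) ↦ c 0 (v 0) ⋯ c (a - 1) (v (a - 1))`. -/
def tprodMap {B : Type} [Ring B] [Algebra Rh B] [IsAdicComplete hI B] {a : ℕ}
    (c : Fin a → M →ₗ[Rh] B) : TPow M a →ₗ[Rh] B :=
  extendC (PiTensorProduct.lift ((MultilinearMap.mkPiAlgebraFin Rh a B).compLinearMap c))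

theorem tprodMap_tpure {B : Type} [Ring B] [Algebra Rh B] [IsAdicComplete hI B] {a : ℕ}
    (c : Fin a → M →ₗ[Rh] B) (v : Fin a → M) :
    tprodMap c (tpure v) = (List.ofFn fun j => c j (v j)).prod := by
  rw [tprodMap, tpure, extendC_of, PiTensorProduct.lift.tprod, MultilinearMap.compLinearMap_apply,
    MultilinearMap.mkPiAlgebraFin_apply]

theorem tprodMap_snocC {B C : Type} [Ring B] [Algebra Rh B] [IsAdicComplete hI B] [Ring C]
    [Algebra Rh C] [IsAdicComplete hI C] {a : ℕ} (c : Fin a → M →ₗ[Rh] B)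
    (c' : Fin (a + 1) → M →ₗ[Rh] C) (ι : B →ₐ[Rh] C)
    (h : ∀ j v, c' (Fin.castSucc j) v = ι (c j v)) (t : TPow M a) (v : M) :
    tprodMap c' (snocC M a t v) = ι (tprodMap c t) * c' (Fin.last a) v := by
  refine tpow_linearMap_ext (tprodMap c' ∘ₗ (snocC M a).flip v)
    (LinearMap.mulRight Rh (c' (Fin.last a) v) ∘ₗ ι.toLinearMap ∘ₗ tprodMap c) (fun w => ?_) t
  rw [LinearMap.comp_apply, LinearMap.flip_apply, snocC_tpure, tprodMap_tpure, LinearMap.comp_apply,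
    LinearMap.comp_apply, tprodMap_tpure, List.ofFn_succ', List.concat_eq_append, List.prod_append,
    List.prod_singleton, Fin.snoc_last, AlgHom.toLinearMap_apply, map_list_prod, List.map_ofFn,
    LinearMap.mulRight_apply]
  congr 3
  ext1 j
  rw [Fin.snoc_castSucc, Function.comp_apply, h]

/-- Actions on algebras `S a` which are, compatibly, the `a`-th tensor powers of a module `M`,
transport to the tensor power action. -/
theorem isTensorPowerAction_conj {A : Type} [Ring A] [Algebra Rh A] [IsAdicComplete hI M]
    {S : ℕ → Type} [∀ a, Ring (S a)] [∀ a, Algebra Rh (S a)] [∀ a, IsAdicComplete hI (S a)]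
    (Δ : A →ₐ[Rh] CTensor A A) (ε : A →ₐ[Rh] Rh) (β : A →ₐ[Rh] Module.End Rh M)
    (ρ : ∀ a, A →ₐ[Rh] Module.End Rh (S a)) (Θ : ∀ a, TPow M a ≃ₗ[Rh] S a)
    (ι : ∀ a, S a →ₐ[Rh] S (a + 1)) (c : ∀ a, M →ₗ[Rh] S (a + 1))
    (hΘ : ∀ a t v, Θ (a + 1) (snocC M a t v) = ι a (Θ a t) * c a v)
    (hι : ∀ a x f, ρ (a + 1) x (ι a f) = ι a (ρ a x f))
    (hc : ∀ a x v, ρ (a + 1) x (c a v) = c a (β x v))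
    (hmul : ∀ a x f g, ρ a x (f * g) = evalTensor (LinearMap.mul Rh (S a))
      ((ρ a).toLinearMap.flip f) ((ρ a).toLinearMap.flip g) (Δ x))
    (h0 : ∀ x f, ρ 0 x f = ε x • f) :
    ∃ T : ∀ a : ℕ, A →ₐ[Rh] Module.End Rh (TPow M a), IsTensorPowerAction Δ ε β T ∧
      ∀ a x t, Θ a (T a x t) = ρ a x (Θ a t) := by
  let T : ∀ a : ℕ, A →ₐ[Rh] Module.End Rh (TPow M a) := fun a =>
    AlgHom.ofLinearMap ((Θ a).symm.conj.toLinearMap ∘ₗ (ρ a).toLinearMap)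
    (by
      change (Θ a).symm.conj (ρ a 1) = 1
      rw [map_one]; exact LinearEquiv.conj_id _)
    (fun x y => by
      change (Θ a).symm.conj (ρ a (x * y)) = _
      rw [map_mul]; exact LinearEquiv.conj_comp _ _ _)
  have hT : ∀ a x t, Θ a (T a x t) = ρ a x (Θ a t) := fun a x t =>
    (Θ a).apply_symm_apply _
  refine ⟨T, ⟨fun x t => (Θ 0).injective ?_, fun a x t v => (Θ (a + 1)).injective ?_⟩, hT⟩
  · rw [hT, h0, map_smul]
  · rw [hT, hΘ, hmul]
    refine (CTensor.apply_ext ((Θ (a + 1)).toLinearMap ∘ₗ evalTensor (snocC M a)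
      ((T a).toLinearMap.flip t) (β.toLinearMap.flip v)) (evalTensor (LinearMap.mul Rh (S (a + 1)))
      ((ρ (a + 1)).toLinearMap.flip (ι a (Θ a t))) ((ρ (a + 1)).toLinearMap.flip (c a v)))
      (fun x y => ?_) (Δ x)).symm
    rw [LinearMap.comp_apply, evalTensor_ctmul, evalTensor_ctmul]
    change Θ (a + 1) (snocC M a (T a x t) (β y v)) = ρ (a + 1) x (ι a (Θ a t)) *
      ρ (a + 1) y (c a v)
    rw [hΘ, hT, hι, hc]

end TensorPowers

section Phi

variable {k n : ℕ}

theorem Phi_eq (k n : ℕ) : Sh.Phi k n = tprodMap fun j => (Sh.col k j).toLinearMap := rfl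

theorem Psi_eq (k n : ℕ) : Sh.Psi k n = tprodMap fun i => (Sh.row n i).toLinearMap := rfl

theorem col_X (j : Fin n) (i : Fin k) (e : Fin 1) : Sh.col k j (Sh.X i e) = Sh.X i j :=
  PresAlg.map_gen _ _ _

theorem row_X (j : Fin n) (i : Fin k) (e : Fin 1) : Sh.row n i (Sh.X e j) = Sh.X i j :=
  PresAlg.map_gen _ _ _

theorem col_monomial (j : Fin n) (m : Matrix (Fin k) (Fin 1) ℕ) :
    Sh.col k j (Sh.monomial m) = colMonomial j fun i => m i 0 := by
  rw [monomial_eq, List.ofFn_succ, List.ofFn_zero, List.prod_singleton]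
  exact map_colMonomial (φ := fun _ => j) (fun i e => col_X j i e) 0 _

theorem Phi_monomial (w : Fin n → Matrix (Fin k) (Fin 1) ℕ) :
    Sh.Phi k n (tpure fun j => Sh.monomial (w j)) =
      Sh.monomial (Matrix.of fun i j => w j i 0) := by
  rw [Phi_eq, tprodMap_tpure, monomial_eq]
  simp only [AlgHom.toLinearMap_apply, col_monomial]
  rfl

theorem monomial_eq_Phi (m : Matrix (Fin k) (Fin n) ℕ) :
    Sh.monomial m = Sh.Phi k n (tpure fun j => Sh.monomial (Matrix.of fun i _ => m i j)) := by
  rw [Phi_monomial]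
  rfl

theorem Phi_surjective (k n : ℕ) : Function.Surjective (Sh.Phi k n) := by
  refine surjective_of_surjective_mod _ fun y => ?_
  obtain ⟨w, hw, z, rfl⟩ := exists_span_monomial_add y
  have : w ∈ LinearMap.range (Sh.Phi k n) := by
    refine Submodule.span_le.mpr ?_ hw
    rintro _ ⟨m, rfl⟩
    exact ⟨_, (monomial_eq_Phi m).symm⟩
  obtain ⟨x, rfl⟩ := this
  exact ⟨x, z, rfl⟩

/-- `Φ` maps the tensor products of monomials, which are dense, bijectively to the monomials, whose
coefficients are determined. -/
theorem Phi_injective (k n : ℕ) : Function.Injective (Sh.Phi k n) := by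
  rw [← LinearMap.ker_eq_bot, LinearMap.ker_eq_bot']
  intro t ht
  let b : Matrix (Fin k) (Fin n) ℕ → TPow (Sh k 1) n :=
    fun m => tpure fun j => Sh.monomial (Matrix.of fun i _ => m i j)
  have hb : ∀ m, Sh.Phi k n (b m) = Sh.monomial m := fun m => (monomial_eq_Phi m).symm
  refine eq_zero_of_forall_hbar_pow fun N => ?_
  obtain ⟨z, hz⟩ := tpow_monomial_induction (closureSub (Submodule.span Rh (Set.range b)))
    (isClosedSub_closureSub _) (fun w => le_closureSub _ (Submodule.subset_span
      ⟨Matrix.of fun i j => w j i 0, by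
        refine congrArg tpure (funext fun j => congrArg Sh.monomial ?_)
        ext i e
        rw [Subsingleton.elim e 0]
        rfl⟩)) t N
  obtain ⟨c, hc⟩ := Finsupp.mem_span_range_iff_exists_finsupp.mp hz
  -- the coefficients are read off from the image under `Φ`, which is divisible by `ħ ^ N`
  have h1 : Sh.Phi k n (c.sum fun m r => r • b m) = c.sum fun m r => r • Sh.monomial m := by
    rw [map_finsuppSum]
    simp only [map_smul, hb]
  have h2 : ∀ m, c m = hbar ^ N * coeff k n (Sh.Phi k n (-z)) m := by
    intro m
    have h3 : coeff k n (c.sum fun m r => r • Sh.monomial m) m = c m := by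
      rw [map_finsuppSum, Finsupp.sum, Finset.sum_apply, Finset.sum_eq_single m]
      · rw [map_smul, coeff_monomial, Pi.smul_apply, Pi.single_eq_same, smul_eq_mul, mul_one]
      · intro m' _ hm
        rw [map_smul, coeff_monomial, Pi.smul_apply, Pi.single_eq_of_ne hm.symm, smul_zero]
      · intro hm
        rw [Finsupp.notMem_support_iff.mp hm, zero_smul, map_zero, Pi.zero_apply]
    rw [← h3, ← h1, hc, map_sub, ht, zero_sub, map_smul, ← smul_neg, ← map_neg, map_smul,
      Pi.smul_apply, smul_eq_mul]
  refine ⟨z + ∑ m ∈ c.support, coeff k n (Sh.Phi k n (-z)) m • b m, ?_⟩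
  rw [smul_add, ← sub_eq_iff_eq_add', ← hc, Finsupp.sum, Finset.smul_sum]
  refine Finset.sum_congr rfl fun m _ => ?_
  rw [h2, mul_smul]

variable (k n) in
/-- The isomorphism `Φ`. -/
def PhiEquiv : TPow (Sh k 1) n ≃ₗ[Rh] Sh k n :=
  LinearEquiv.ofBijective (Sh.Phi k n) ⟨Phi_injective k n, Phi_surjective k n⟩

theorem list_prod_mem_homog {a : ℕ} (f : Fin a → Sh k n) (e : Fin a → ℕ)
    (h : ∀ j, f j ∈ Sh.homog k n (e j)) :
    (List.ofFn f).prod ∈ Sh.homog k n (∑ j, e j) := by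
  induction a with
  | zero => exact one_mem_homog
  | succ a ih =>
    rw [List.ofFn_succ, List.prod_cons, Fin.sum_univ_succ]
    exact mul_mem_homog (h 0) (ih _ _ fun j => h j.succ)

theorem map_tensorHomog_Phi (k n d : ℕ) :
    (Sh.tensorHomog k 1 n d).map (Sh.Phi k n) = Sh.homog k n d := by
  refine le_antisymm ?_ ?_
  · rw [Sh.tensorHomog, Submodule.map_span_le]
    rintro _ ⟨e, v, rfl, hv, rfl⟩
    rw [Phi_eq, tprodMap_tpure]
    exact list_prod_mem_homog _ e fun j => map_homog (Sh.col k j)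
      (fun i e => by rw [col_X]; exact X_mem_homog _ _) (hv j)
  · rw [homog_eq_span, Submodule.span_le]
    rintro _ ⟨m, rfl, rfl⟩
    refine ⟨_, Submodule.subset_span ⟨fun j => mdeg (Matrix.of fun i (_ : Fin 1) => m i j), _, ?_,
      fun j => monomial_mem_homog _, rfl⟩, (monomial_eq_Phi m).symm⟩
    rw [mdeg_eq]
    exact Finset.sum_congr rfl fun j _ => (mdeg_eq _).trans (by simp)

/-- Substitutions of the columns commute with the left action. -/
theorem actL_map {n' : ℕ} (φ : Fin n → Fin n') (g : Sh k n →ₐ[Rh] Sh k n')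
    (hg : ∀ i j, g (Sh.X i j) = Sh.X i (φ j)) (x : Uh k) (f : Sh k n) :
    actL k n' x (g f) = g (actL k n x f) := by
  have : (coactL k n').comp g = (Conv.map k g).comp (coactL k n) :=
    Sh.algHom_ext fun i j => Conv.ext fun y => by
      rw [AlgHom.comp_apply, hg, coactL_lin, actL_X, AlgHom.comp_apply, Conv.map_lin, coactL_lin,
        actL_X, map_sum]
      simp only [map_smul, hg]
  have h := congrArg (fun c : Conv k (Sh k n') => c.lin x) (DFunLike.congr_fun this f)
  exact h

theorem actL_zero (x : Uh k) (f : Sh k 0) : actL k 0 x f = counit k x • f :=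
  LinearMap.mem_eqLocus.mp <| Sh.induction
    (LinearMap.eqLocus (actL k 0 x) (counit k x • LinearMap.id))
    (isClosedSub_eqLocus _ _) (LinearMap.mem_eqLocus.mpr (actL_one x)) (fun _ j => j.elim0) f

theorem exists_tensorPowerAction_Phi (k : ℕ) :
    ∃ T : ∀ a : ℕ, Uh k →ₐ[Rh] Module.End Rh (TPow (Sh k 1) a),
      IsTensorPowerAction (Delta k) (counit k) ((act k 1).comp (inclL (Uh k) (Uh 1))) T ∧
      ∀ a x t, Sh.Phi k a (T a x t) = actL k a x (Sh.Phi k a t) := by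
  refine isTensorPowerAction_conj (S := fun a => Sh k a) (Delta k) (counit k) _
    (fun a => actL k a) (fun a => PhiEquiv k a) (fun a => initCol k a)
    (fun a => (Sh.col k (Fin.last a)).toLinearMap) (fun a t v => ?_) (fun a x f => ?_)
    (fun a x v => ?_) (fun a x f g => actL_mul x f g) actL_zero
  · change Sh.Phi k (a + 1) _ = initCol k a (Sh.Phi k a t) * _
    rw [Phi_eq, Phi_eq]
    refine tprodMap_snocC _ _ _ (fun j v => ?_) t v
    have : Sh.col k j.castSucc = (initCol k a).comp (Sh.col k j) :=
      Sh.algHom_ext fun i e => by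
        rw [AlgHom.comp_apply, col_X, col_X, initCol, colMap_X]
    rw [this]
    rfl
  · exact actL_map Fin.castSucc _ (colMap_X _ _) x f
  · change actL k (a + 1) x (Sh.col k (Fin.last a) v) =
      Sh.col k (Fin.last a) (act k 1 (ctmul x 1) v)
    rw [act_left]
    exact actL_map (fun _ => Fin.last a) _ (fun i e => col_X _ i e) x v

end Phi

/-! ### The map `Ψ` -/

section Psi

variable {k n : ℕ}

/-- A linear map acts on completed tensor powers. -/
def tpowMap {M N : Type} [AddCommGroup M] [Module Rh M] [AddCommGroup N] [Module Rh N] (a : ℕ)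
    (f : M →ₗ[Rh] N) : TPow M a →ₗ[Rh] TPow N a := mapC (PiTensorProduct.map fun _ => f)

theorem tpowMap_tpure {M N : Type} [AddCommGroup M] [Module Rh M] [AddCommGroup N] [Module Rh N]
    {a : ℕ} (f : M →ₗ[Rh] N) (v : Fin a → M) : tpowMap a f (tpure v) = tpure fun j => f (v j) :=
  (AdicCompletion.map_of hI _ _).trans
    (congrArg (AdicCompletion.of hI _) (PiTensorProduct.map_tprod _ _))

variable (k n) in
/-- The transposition of the factors of a tensor power. -/
def tpowTranspose (a : ℕ) : TPow (Sh k n) a ≃ₗ[Rh] TPow (Sh n k) a :=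
  LinearEquiv.ofLinearMap (tpowMap a (Sh.transpose k n).toLinearMap)
    (tpowMap a (Sh.transpose n k).toLinearMap)
    (LinearMap.ext fun t => tpow_linearMap_ext (tpowMap a (Sh.transpose k n).toLinearMap ∘ₗ
      tpowMap a (Sh.transpose n k).toLinearMap) LinearMap.id (fun v => by
        rw [LinearMap.comp_apply, tpowMap_tpure, tpowMap_tpure]
        simp [transpose_transpose]) t)
    (LinearMap.ext fun t => tpow_linearMap_ext (tpowMap a (Sh.transpose n k).toLinearMap ∘ₗ
      tpowMap a (Sh.transpose k n).toLinearMap) LinearMap.id (fun v => by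
        rw [LinearMap.comp_apply, tpowMap_tpure, tpowMap_tpure]
        simp [transpose_transpose]) t)

theorem tpowTranspose_tpure {a : ℕ} (v : Fin a → Sh k n) :
    tpowTranspose k n a (tpure v) = tpure fun j => Sh.transpose k n (v j) := tpowMap_tpure _ _

theorem transpose_Psi (t : TPow (Sh 1 n) k) :
    Sh.transpose k n (Sh.Psi k n t) = Sh.Phi n k (tpowTranspose 1 n k t) := by
  refine tpow_linearMap_ext ((Sh.transpose k n).toLinearMap ∘ₗ Sh.Psi k n)
    (Sh.Phi n k ∘ₗ (tpowTranspose 1 n k).toLinearMap) (fun v => ?_) t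
  rw [LinearMap.comp_apply, LinearMap.comp_apply, LinearEquiv.coe_coe, tpowTranspose_tpure, Psi_eq,
    Phi_eq, tprodMap_tpure, tprodMap_tpure, AlgHom.toLinearMap_apply, map_list_prod, List.map_ofFn]
  congr 2
  ext1 i
  have : (Sh.transpose k n).comp (Sh.row n i) = (Sh.col n i).comp (Sh.transpose 1 n) :=
    Sh.algHom_ext fun e j => by
      rw [AlgHom.comp_apply, AlgHom.comp_apply, row_X, transpose_X, transpose_X, col_X]
  exact DFunLike.congr_fun this (v i)

variable (k n) in
/-- The isomorphism `Ψ`. -/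
def PsiEquiv : TPow (Sh 1 n) k ≃ₗ[Rh] Sh k n :=
  (tpowTranspose 1 n k).trans ((PhiEquiv n k).trans (transposeEquiv n k))

theorem PsiEquiv_apply (t : TPow (Sh 1 n) k) : PsiEquiv k n t = Sh.Psi k n t := by
  rw [← transpose_transpose (Sh.Psi k n t), transpose_Psi]
  rfl

theorem Psi_bijective (k n : ℕ) : Function.Bijective (Sh.Psi k n) := by
  have : ⇑(Sh.Psi k n) = PsiEquiv k n := funext fun t => (PsiEquiv_apply t).symm
  rw [this]
  exact (PsiEquiv k n).bijective

theorem homog_map_transpose (k n d : ℕ) :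
    (Sh.homog k n d).map (Sh.transpose k n).toLinearMap = Sh.homog n k d := by
  refine le_antisymm ?_ fun f hf => ⟨_, transpose_mem_homog hf, transpose_transpose f⟩
  rintro _ ⟨f, hf, rfl⟩
  exact transpose_mem_homog hf

theorem tensorHomog_map_transpose (k n a d : ℕ) :
    (Sh.tensorHomog k n a d).map (tpowTranspose k n a).toLinearMap = Sh.tensorHomog n k a d := by
  have key : ∀ k n : ℕ, (Sh.tensorHomog k n a d).map (tpowTranspose k n a).toLinearMap ≤
      Sh.tensorHomog n k a d := by
    intro k n
    rw [Sh.tensorHomog, Submodule.map_span_le]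
    rintro _ ⟨e, v, rfl, hv, rfl⟩
    exact Submodule.subset_span ⟨e, _, rfl, fun j => transpose_mem_homog (hv j),
      tpowTranspose_tpure v⟩
  refine le_antisymm (key k n) fun t ht => ⟨(tpowTranspose k n a).symm t, ?_,
    (tpowTranspose k n a).apply_symm_apply t⟩
  exact key n k ⟨t, ht, rfl⟩

theorem map_tensorHomog_Psi (k n d : ℕ) :
    (Sh.tensorHomog 1 n k d).map (Sh.Psi k n) = Sh.homog k n d := by
  have : Sh.Psi k n = (Sh.transpose n k).toLinearMap ∘ₗ Sh.Phi n k ∘ₗ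
      (tpowTranspose 1 n k).toLinearMap := by
    refine LinearMap.ext fun t => ?_
    rw [← transpose_transpose (Sh.Psi k n t), transpose_Psi]
    rfl
  rw [this, Submodule.map_comp, Submodule.map_comp, tensorHomog_map_transpose, map_tensorHomog_Phi,
    homog_map_transpose]

/-- Substitutions of the rows commute with the right action. -/
theorem actR_map {k' : ℕ} (φ : Fin k → Fin k') (g : Sh k n →ₐ[Rh] Sh k' n)
    (hg : ∀ i j, g (Sh.X i j) = Sh.X (φ i) j) (y : Uh n) (f : Sh k n) :
    actR k' n y (g f) = g (actR k n y f) := by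
  have : (coactR k' n).comp g = (Conv.map n g).comp (coactR k n) :=
    Sh.algHom_ext fun i j => Conv.ext fun y => by
      rw [AlgHom.comp_apply, hg, coactR_X_lin, AlgHom.comp_apply, Conv.map_lin, coactR_X_lin,
        map_sum]
      simp only [map_smul, hg]
  have h := congrArg (fun c : Conv n (Sh k' n) => c.lin y) (DFunLike.congr_fun this f)
  exact h

theorem actR_zero (y : Uh n) (f : Sh 0 n) : actR 0 n y f = counit n y • f :=
  LinearMap.mem_eqLocus.mp <| Sh.induction
    (LinearMap.eqLocus (actR 0 n y) (counit n y • LinearMap.id))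
    (isClosedSub_eqLocus _ _) (LinearMap.mem_eqLocus.mpr (actR_one y)) (fun i => i.elim0) f

variable (k n) in
/-- The inclusion of the first `k` rows. -/
def initRow : Sh k n →ₐ[Rh] Sh (k + 1) n :=
  (Sh.transpose n (k + 1)).comp ((initCol n k).comp (Sh.transpose k n))

theorem initRow_X (i : Fin k) (j : Fin n) : initRow k n (Sh.X i j) = Sh.X i.castSucc j := by
  rw [initRow, AlgHom.comp_apply, AlgHom.comp_apply, transpose_X, initCol, colMap_X, transpose_X]

theorem exists_tensorPowerAction_Psi (n : ℕ) :
    ∃ T : ∀ a : ℕ, Uh n →ₐ[Rh] Module.End Rh (TPow (Sh 1 n) a),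
      IsTensorPowerAction (Delta n) (counit n) ((act 1 n).comp (inclR (Uh 1) (Uh n))) T ∧
      ∀ a y t, Sh.Psi a n (T a y t) = actR a n y (Sh.Psi a n t) := by
  have h := isTensorPowerAction_conj (S := fun a => Sh a n) (Delta n) (counit n)
    ((act 1 n).comp (inclR (Uh 1) (Uh n)))
    (fun a => actR a n) (fun a => PsiEquiv a n) (fun a => initRow a n)
    (fun a => (Sh.row n (Fin.last a)).toLinearMap) (fun a t v => ?_) (fun a x f => ?_)
    (fun a x v => ?_) (fun a x f g => actR_mul x f g) actR_zero
  · simpa only [PsiEquiv_apply] using h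
  · rw [PsiEquiv_apply, PsiEquiv_apply, Psi_eq, Psi_eq]
    refine tprodMap_snocC _ _ _ (fun j v => ?_) t v
    have : Sh.row n j.castSucc = (initRow a n).comp (Sh.row n j) :=
      Sh.algHom_ext fun i e => by
        rw [AlgHom.comp_apply, row_X, row_X, initRow_X]
    rw [this]
    rfl
  · exact actR_map Fin.castSucc _ initRow_X x f
  · change actR (a + 1) n x (Sh.row n (Fin.last a) v) =
      Sh.row n (Fin.last a) (act 1 n (ctmul 1 x) v)
    rw [act_right]
    exact actR_map (fun _ => Fin.last a) _ (fun i e => row_X _ _ i) x v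

end Psi

/-! ### Row-ordered monomials -/

section Rows

variable {k n : ℕ}

/-- Two ordered products can be interleaved if the later factors of the first commute with the
earlier factors of the second. -/
theorem ofFn_prod_mul_prod {B : Type} [Monoid B] {n : ℕ} (f g : Fin n → B)
    (h : ∀ j b, b < j → Commute (f j) (g b)) :
    (List.ofFn f).prod * (List.ofFn g).prod = (List.ofFn fun j => f j * g j).prod := by
  induction n with
  | zero => simp
  | succ n ih =>
    have hc : Commute (List.ofFn fun j : Fin n => f j.succ).prod (g 0) :=
      Commute.list_prod_left _ _ fun x hx => by
        obtain ⟨j, rfl⟩ := List.mem_ofFn.mp hx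
        exact h _ _ (Fin.succ_pos j)
    rw [List.ofFn_succ, List.ofFn_succ, List.ofFn_succ, List.prod_cons, List.prod_cons,
      List.prod_cons, mul_assoc, ← mul_assoc _ (g 0), hc.eq, mul_assoc (g 0),
      ih _ _ fun j b hb => h _ _ (Fin.succ_lt_succ_iff.mpr hb), mul_assoc]

theorem ofFn_prod_comm {B : Type} [Monoid B] {k n : ℕ} (f : Fin k → Fin n → B)
    (h : ∀ i a j b, i < a → b < j → Commute (f i j) (f a b)) :
    (List.ofFn fun i => (List.ofFn fun j => f i j).prod).prod =
      (List.ofFn fun j => (List.ofFn fun i => f i j).prod).prod := by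
  induction k with
  | zero => simp
  | succ k ih =>
    rw [List.ofFn_succ, List.prod_cons,
      ih (fun i j => f i.succ j) fun i a j b hi hb => h _ _ _ _ (Fin.succ_lt_succ_iff.mpr hi) hb,
      ofFn_prod_mul_prod]
    · simp only [List.ofFn_succ, List.prod_cons]
    · intro j b hb
      refine Commute.list_prod_right _ _ fun x hx => ?_
      obtain ⟨i, rfl⟩ := List.mem_ofFn.mp hx
      exact h _ _ _ _ (Fin.succ_pos i) hb

/-- The monomial `∏ X_{ij}^{m j}` of the `i`-th row. -/
def rowMonomial (i : Fin k) (m : Fin n → ℕ) : Sh k n := (List.ofFn fun j => Sh.X i j ^ m j).prod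

/-- The monomials may also be formed row by row, because `X_{ij}` and `X_{ab}` commute for `i < a` and
`b < j`. -/
theorem monomial_eq_row (m : Matrix (Fin k) (Fin n) ℕ) :
    Sh.monomial m = (List.ofFn fun i => rowMonomial i (m i)).prod :=
  (ofFn_prod_comm (fun i j => Sh.X i j ^ m i j) fun _ _ _ _ hi hb =>
    Commute.pow_pow ((Sh.rtt_X k n).comm hi hb) _ _).symm

theorem transpose_monomial (m : Matrix (Fin k) (Fin n) ℕ) :
    Sh.transpose k n (Sh.monomial m) = Sh.monomial m.transpose := by
  rw [monomial_eq, map_list_prod, List.map_ofFn, monomial_eq_row]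
  congr 2
  ext1 j
  rw [Function.comp_apply, colMonomial, map_list_prod, List.map_ofFn, rowMonomial]
  congr 2
  ext1 i
  rw [Function.comp_apply, map_pow, transpose_X, Matrix.transpose_apply]

end Rows

/-! ### Skew derivations on ordered products -/

/-- An ordered product depends on two adjacent factors through their product only. -/
theorem prod_congr_adjacent {B : Type} [Monoid B] {n : ℕ} (f g : Fin n → B) (i : ℕ) (hi : i + 1 < n)
    (h : ∀ j : Fin n, (j : ℕ) ≠ i → (j : ℕ) ≠ i + 1 → f j = g j)
    (h2 : f ⟨i, by omega⟩ * f ⟨i + 1, hi⟩ = g ⟨i, by omega⟩ * g ⟨i + 1, hi⟩) :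
    (List.ofFn f).prod = (List.ofFn g).prod := by
  induction n generalizing i with
  | zero => omega
  | succ n ih =>
    rw [List.ofFn_succ, List.prod_cons, List.ofFn_succ, List.prod_cons]
    cases i with
    | zero =>
      obtain ⟨n, rfl⟩ : ∃ n', n = n' + 1 := ⟨n - 1, by omega⟩
      rw [List.ofFn_succ, List.prod_cons, List.ofFn_succ, List.prod_cons, ← mul_assoc, ← mul_assoc]
      congr 1
      congr 2
      ext1 j
      exact h _ (by simp) (by simp)
    | succ i =>
      rw [h 0 (by simp) (by simp)]
      congr 1
      exact ih _ _ i (by omega) (fun j hj hj' => h _ (by simpa using hj) (by simpa using hj')) h2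

section Skew

variable {B : Type} [Ring B] [Algebra Rh B] {n : ℕ}

/-- An ordered product, as a linear function of one of its factors. -/
def prodAt (f : Fin n → B) (i : Fin n) : B →ₗ[Rh] B :=
  (MultilinearMap.mkPiAlgebraFin Rh n B).toLinearMap f i

theorem prodAt_apply (f : Fin n → B) (i : Fin n) (x : B) :
    prodAt f i x = (List.ofFn (Function.update f i x)).prod :=
  MultilinearMap.mkPiAlgebraFin_apply (R := Rh) (A := B) _

theorem prodAt_zero (f : Fin (n + 1) → B) (x : B) :
    prodAt f 0 x = x * (List.ofFn fun j => f j.succ).prod := by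
  rw [prodAt_apply, List.ofFn_succ, List.prod_cons, Function.update_self]
  simp

theorem prodAt_succ (f : Fin (n + 1) → B) (i : Fin n) (x : B) :
    prodAt f i.succ x = f 0 * prodAt (fun j => f j.succ) i x := by
  rw [prodAt_apply, List.ofFn_succ, List.prod_cons, prodAt_apply,
    Function.update_of_ne (Fin.succ_ne_zero i).symm]
  congr 3
  ext1 j
  by_cases h : j = i
  · rw [h, Function.update_self, Function.update_self]
  · rw [Function.update_of_ne h, Function.update_of_ne fun h' => h (Fin.succ_injective _ h')]

theorem prodAt_last (f : Fin (n + 1) → B) (x : B) :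
    prodAt f (Fin.last n) x = (List.ofFn fun j => f j.castSucc).prod * x := by
  rw [prodAt_apply, List.ofFn_succ', List.concat_eq_append, List.prod_append, List.prod_singleton,
    Function.update_self]
  congr 3
  ext1 j
  rw [Function.update_of_ne (Fin.castSucc_lt_last j).ne]

theorem prodAt_castSucc (f : Fin (n + 1) → B) (i : Fin n) (x : B) :
    prodAt f i.castSucc x = prodAt (fun j => f j.castSucc) i x * f (Fin.last n) := by
  rw [prodAt_apply, List.ofFn_succ', List.concat_eq_append, List.prod_append, List.prod_singleton,
    prodAt_apply, Function.update_of_ne (Fin.castSucc_lt_last i).ne']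
  congr 3
  ext1 j
  by_cases h : j = i
  · rw [h, Function.update_self, Function.update_self]
  · rw [Function.update_of_ne h, Function.update_of_ne fun h' => h (Fin.castSucc_injective _ h')]

/-- A multiplicative map, such as the action of a group-like element, on a product of
eigenvectors. -/
theorem eigen_prod (K : B →ₗ[Rh] B) (hK : ∀ f g, K (f * g) = K f * K g) (hK1 : K 1 = 1)
    (f : Fin n → B) (c : Fin n → Rh) (hc : ∀ i, K (f i) = c i • f i) :
    K (List.ofFn f).prod = (∏ i, c i) • (List.ofFn f).prod := by
  induction n with
  | zero => simp [hK1]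
  | succ n ih =>
    rw [List.ofFn_succ, List.prod_cons, hK, hc, ih _ _ fun i => hc i.succ, smul_mul_smul_comm,
      Fin.prod_univ_succ]

theorem eigen_pow (K : B →ₗ[Rh] B) (hK : ∀ f g, K (f * g) = K f * K g) (hK1 : K 1 = 1)
    (f : B) (c : Rh) (hc : K f = c • f) (r : ℕ) : K (f ^ r) = c ^ r • f ^ r := by
  have := eigen_prod K hK hK1 (fun _ : Fin r => f) (fun _ => c) fun _ => hc
  simpa using this

/-- A derivation on a product of eigenvectors. -/
theorem derivation_prod (D : B →ₗ[Rh] B) (hD : ∀ f g, D (f * g) = D f * g + f * D g) (hD1 : D 1 = 0)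
    (f : Fin n → B) (c : Fin n → Rh) (hc : ∀ i, D (f i) = c i • f i) :
    D (List.ofFn f).prod = (∑ i, c i) • (List.ofFn f).prod := by
  induction n with
  | zero => simp [hD1]
  | succ n ih =>
    rw [List.ofFn_succ, List.prod_cons, hD, hc, ih _ _ fun i => hc i.succ, smul_mul_assoc,
      mul_smul_comm, ← add_smul, Fin.sum_univ_succ]

theorem derivation_pow (D : B →ₗ[Rh] B) (hD : ∀ f g, D (f * g) = D f * g + f * D g) (hD1 : D 1 = 0)
    (f : B) (c : Rh) (hc : D f = c • f) (r : ℕ) : D (f ^ r) = (r * c) • f ^ r := by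
  have := derivation_prod D hD hD1 (fun _ : Fin r => f) (fun _ => c) fun _ => hc
  simpa using this

/-- The iterated Leibniz rule for an operator with coproduct `E ⊗ K + 1 ⊗ E`. -/
theorem skew_prod_right (E K : B →ₗ[Rh] B) (hE : ∀ f g, E (f * g) = E f * K g + f * E g)
    (hE1 : E 1 = 0) (hK : ∀ f g, K (f * g) = K f * K g) (hK1 : K 1 = 1)
    (f : Fin n → B) (c : Fin n → Rh) (hc : ∀ i, K (f i) = c i • f i) :
    E (List.ofFn f).prod = ∑ i, (∏ j ∈ Finset.Ioi i, c j) • prodAt f i (E (f i)) := by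
  induction n with
  | zero => simp [hE1]
  | succ n ih =>
    rw [List.ofFn_succ, List.prod_cons, hE, eigen_prod K hK hK1 _ _ fun i => hc i.succ,
      ih _ _ fun i => hc i.succ, Fin.sum_univ_succ, Fin.prod_Ioi_zero, prodAt_zero, mul_smul_comm,
      Finset.mul_sum]
    congr 1
    refine Finset.sum_congr rfl fun i _ => ?_
    rw [Fin.prod_Ioi_succ, prodAt_succ, mul_smul_comm]

/-- The iterated Leibniz rule for an operator with coproduct `F ⊗ 1 + K ⊗ F`. -/
theorem skew_prod_left (F K : B →ₗ[Rh] B) (hF : ∀ f g, F (f * g) = F f * g + K f * F g)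
    (hF1 : F 1 = 0) (hK : ∀ f g, K (f * g) = K f * K g) (hK1 : K 1 = 1)
    (f : Fin n → B) (c : Fin n → Rh) (hc : ∀ i, K (f i) = c i • f i) :
    F (List.ofFn f).prod = ∑ i, (∏ j ∈ Finset.Iio i, c j) • prodAt f i (F (f i)) := by
  induction n with
  | zero => simp [hF1]
  | succ n ih =>
    have h : (∏ j ∈ Finset.Iio (Fin.last n), c j) = ∏ j : Fin n, c j.castSucc := by
      rw [Fin.Iio_last_eq_map, Finset.prod_map]; rfl
    rw [List.ofFn_succ', List.concat_eq_append, List.prod_append, List.prod_singleton, hF,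
      eigen_prod K hK hK1 _ _ fun i => hc i.castSucc, ih _ _ fun i => hc i.castSucc,
      Fin.sum_univ_castSucc, h, prodAt_last, smul_mul_assoc, Finset.sum_mul]
    congr 1
    refine Finset.sum_congr rfl fun i _ => ?_
    rw [Fin.prod_Iio_castSucc, prodAt_castSucc, smul_mul_assoc]

end Skew

/-! ### The action on the monomials -/

section Formulas

variable {k n : ℕ}

theorem expH_sum {ι : Type} (s : Finset ι) (c : ι → ℂ) :
    ∏ i ∈ s, (expH (c i) : Rh) = expH (∑ i ∈ s, c i) := by
  classical
  induction s using Finset.induction with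
  | empty => simp [expH_zero]
  | insert i s hi ih => rw [Finset.prod_insert hi, Finset.sum_insert hi, ih, expH_add_complex]

theorem expH_pow (c : ℂ) (r : ℕ) : (expH c : Rh) ^ r = expH (r * c) := by
  have := expH_sum (Finset.range r) fun _ => c
  simpa using this

theorem sum_wt (l : Fin (n - 1)) (m : Fin n → ℕ) :
    ∑ j, (m j : ℂ) * wt l j = (m (lo l) : ℂ) - m (up l) := by
  have h : ∀ j, (m j : ℂ) * wt l j = (if j = lo l then (m j : ℂ) else 0) -
      if j = up l then (m j : ℂ) else 0 := by
    intro j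
    by_cases h1 : j = lo l
    · rw [h1, wt_lo, if_pos rfl, if_neg (lo_ne_up l)]; ring
    · by_cases h2 : j = up l
      · rw [h2, wt_up, if_pos rfl, if_neg (lo_ne_up l).symm]; ring
      · rw [wt_of_ne h1 h2, if_neg h1, if_neg h2]; ring
  simp only [h, Finset.sum_sub_distrib, Finset.sum_ite_eq', Finset.mem_univ, if_true]

theorem actR_D_mul (j : Fin n) (f g : Sh k n) : actR k n (Uh.D j) (f * g) =
    actR k n (Uh.D j) f * g + f * actR k n (Uh.D j) g := by
  rw [actR_mul, isCoproduct_Delta.D, map_add, evalTensor_ctmul, evalTensor_ctmul]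
  simp

theorem actR_E_mul (l : Fin (n - 1)) (f g : Sh k n) : actR k n (Uh.E l) (f * g) =
    actR k n (Uh.E l) f * actR k n (Uh.K l) g + f * actR k n (Uh.E l) g := by
  rw [actR_mul, isCoproduct_Delta.E, map_add, evalTensor_ctmul, evalTensor_ctmul]
  simp

theorem actR_F_mul (l : Fin (n - 1)) (f g : Sh k n) : actR k n (Uh.F l) (f * g) =
    actR k n (Uh.F l) f * g + actR k n (Uh.Kinv l) f * actR k n (Uh.F l) g := by
  rw [actR_mul, isCoproduct_Delta.F, map_add, evalTensor_ctmul, evalTensor_ctmul]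
  simp

theorem actR_K_mul (l : Fin (n - 1)) (f g : Sh k n) : actR k n (Uh.K l) (f * g) =
    actR k n (Uh.K l) f * actR k n (Uh.K l) g := by
  rw [actR_mul, Delta_K, evalTensor_ctmul]
  simp

theorem actR_Kinv_mul (l : Fin (n - 1)) (f g : Sh k n) : actR k n (Uh.Kinv l) (f * g) =
    actR k n (Uh.Kinv l) f * actR k n (Uh.Kinv l) g := by
  rw [actR_mul, Delta_Kinv, evalTensor_ctmul]
  simp

theorem actR_D_one (j : Fin n) : actR k n (Uh.D j) 1 = 0 := by
  rw [actR_one, isCounit_counit.D, zero_smul]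

theorem actR_E_one (l : Fin (n - 1)) : actR k n (Uh.E l) 1 = 0 := by
  rw [actR_one, isCounit_counit.E, zero_smul]

theorem actR_F_one (l : Fin (n - 1)) : actR k n (Uh.F l) 1 = 0 := by
  rw [actR_one, isCounit_counit.F, zero_smul]

theorem actR_K_one (l : Fin (n - 1)) : actR k n (Uh.K l) 1 = 1 := by
  rw [actR_one, counit_K, one_smul]

theorem actR_Kinv_one (l : Fin (n - 1)) : actR k n (Uh.Kinv l) 1 = 1 := by
  rw [actR_one, counit_Kinv, one_smul]

theorem actR_D_X (l : Fin n) (i : Fin k) (j : Fin n) :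
    actR k n (Uh.D l) (Sh.X i j) = (if j = l then 1 else 0 : Rh) • Sh.X i j := by
  rw [actR_X, isVectorRep_vectorRep.D, Finset.sum_eq_single j]
  · rw [Matrix.single_apply]
    congr 1
    simp only [and_self, eq_comm]
  · intro a _ ha
    rw [Matrix.single_apply, if_neg fun h => ha (h.1.symm.trans h.2), zero_smul]
  · simp

theorem actR_E_X (l : Fin (n - 1)) (i : Fin k) (j : Fin n) :
    actR k n (Uh.E l) (Sh.X i j) = if j = up l then Sh.X i (lo l) else 0 := by
  rw [actR_X, isVectorRep_vectorRep.E, Finset.sum_eq_single (lo l)]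
  · rw [Matrix.single_apply]
    simp only [true_and, eq_comm (a := up l), ite_smul, one_smul, zero_smul]
  · intro a _ ha
    rw [Matrix.single_apply, if_neg fun h => ha h.1.symm, zero_smul]
  · simp

theorem actR_F_X (l : Fin (n - 1)) (i : Fin k) (j : Fin n) :
    actR k n (Uh.F l) (Sh.X i j) = if j = lo l then Sh.X i (up l) else 0 := by
  rw [actR_X, isVectorRep_vectorRep.F, Finset.sum_eq_single (up l)]
  · rw [Matrix.single_apply]
    simp only [true_and, eq_comm (a := lo l), ite_smul, one_smul, zero_smul]
  · intro a _ ha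
    rw [Matrix.single_apply, if_neg fun h => ha h.1.symm, zero_smul]
  · simp

theorem actR_diagonal_X {y : Uh n} {c : Fin n → Rh} (h : vectorRep n y = Matrix.diagonal c)
    (i : Fin k) (j : Fin n) : actR k n y (Sh.X i j) = c j • Sh.X i j := by
  rw [actR_X, h, Finset.sum_eq_single j]
  · rw [Matrix.diagonal_apply_eq]
  · intro a _ ha
    rw [Matrix.diagonal_apply_ne _ ha, zero_smul]
  · simp

theorem actR_K_X_pow (l : Fin (n - 1)) (i : Fin k) (j : Fin n) (r : ℕ) :
    actR k n (Uh.K l) (Sh.X i j ^ r) = (expH (r * wt l j) : Rh) • Sh.X i j ^ r := by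
  rw [eigen_pow _ (actR_K_mul l) (actR_K_one l) _ _ (actR_diagonal_X (vectorRep_K l) i j), expH_pow]

theorem actR_Kinv_X_pow (l : Fin (n - 1)) (i : Fin k) (j : Fin n) (r : ℕ) :
    actR k n (Uh.Kinv l) (Sh.X i j ^ r) = (expH (r * -wt l j) : Rh) • Sh.X i j ^ r := by
  rw [eigen_pow _ (actR_Kinv_mul l) (actR_Kinv_one l) _ _
    (actR_diagonal_X (vectorRep_Kinv l) i j), expH_pow]

theorem actR_K_rowMonomial (l : Fin (n - 1)) (i : Fin k) (m : Fin n → ℕ) :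
    actR k n (Uh.K l) (rowMonomial i m) =
      (expH ((m (lo l) : ℂ) - m (up l)) : Rh) • rowMonomial i m := by
  rw [rowMonomial, eigen_prod _ (actR_K_mul l) (actR_K_one l) _ _
    (fun j => actR_K_X_pow l i j (m j)), expH_sum, sum_wt]

theorem actR_Kinv_rowMonomial (l : Fin (n - 1)) (i : Fin k) (m : Fin n → ℕ) :
    actR k n (Uh.Kinv l) (rowMonomial i m) =
      (expH (-((m (lo l) : ℂ) - m (up l))) : Rh) • rowMonomial i m := by
  rw [rowMonomial, eigen_prod _ (actR_Kinv_mul l) (actR_Kinv_one l) _ _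
    (fun j => actR_Kinv_X_pow l i j (m j)), expH_sum]
  simp only [mul_neg, Finset.sum_neg_distrib, sum_wt]

theorem lo_lt_up (l : Fin (n - 1)) : lo l < up l := by simp [lo, up, Fin.lt_def]

theorem X_up_mul_X_lo (l : Fin (n - 1)) (i : Fin k) :
    Sh.X i (up l) * Sh.X i (lo l) = qq • (Sh.X i (lo l) * Sh.X i (up l)) := by
  rw [(Sh.rtt_X k n).row i (lo_lt_up l), smul_smul, qq_mul_qi, one_smul]

theorem actR_E_X_pow_of_ne {l : Fin (n - 1)} {j : Fin n} (h : j ≠ up l) (i : Fin k) (r : ℕ) :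
    actR k n (Uh.E l) (Sh.X i j ^ r) = 0 := by
  induction r with
  | zero => rw [pow_zero, actR_E_one]
  | succ r ih => rw [pow_succ', actR_E_mul, ih, actR_E_X, if_neg h, zero_mul, mul_zero, add_zero]

theorem actR_F_X_pow_of_ne {l : Fin (n - 1)} {j : Fin n} (h : j ≠ lo l) (i : Fin k) (r : ℕ) :
    actR k n (Uh.F l) (Sh.X i j ^ r) = 0 := by
  induction r with
  | zero => rw [pow_zero, actR_F_one]
  | succ r ih => rw [pow_succ', actR_F_mul, ih, actR_F_X, if_neg h, zero_mul, mul_zero, add_zero]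

/-- For `r = 0` the truncated exponent does not matter, since `[0] = 0`. -/
theorem actR_E_X_pow (l : Fin (n - 1)) (i : Fin k) (r : ℕ) :
    actR k n (Uh.E l) (Sh.X i (up l) ^ r) =
      qInt r • (Sh.X i (lo l) * Sh.X i (up l) ^ (r - 1)) := by
  induction r with
  | zero => rw [pow_zero, actR_E_one, qInt_zero, zero_smul]
  | succ r ih =>
    rw [pow_succ', actR_E_mul, ih, actR_E_X, if_pos rfl, actR_K_X_pow, wt_up, mul_neg_one,
      mul_smul_comm, mul_smul_comm, qInt_succ, add_smul, add_comm, ← mul_assoc, X_up_mul_X_lo,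
      smul_mul_assoc, smul_smul, Nat.add_sub_cancel]
    congr 1
    cases r with
    | zero => rw [qInt_zero, zero_mul, zero_smul, zero_smul]
    | succ r => rw [Nat.add_sub_cancel, mul_assoc, ← pow_succ']

theorem actR_F_X_pow (l : Fin (n - 1)) (i : Fin k) (r : ℕ) :
    actR k n (Uh.F l) (Sh.X i (lo l) ^ r) =
      qInt r • (Sh.X i (lo l) ^ (r - 1) * Sh.X i (up l)) := by
  induction r with
  | zero => rw [pow_zero, actR_F_one, qInt_zero, zero_smul]
  | succ r ih =>
    rw [pow_succ, actR_F_mul, ih, actR_F_X, if_pos rfl, actR_Kinv_X_pow, wt_lo, mul_neg_one,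
      smul_mul_assoc, smul_mul_assoc, qInt_succ, add_smul, mul_assoc, X_up_mul_X_lo,
      mul_smul_comm, smul_smul, Nat.add_sub_cancel]
    congr 1
    cases r with
    | zero => rw [qInt_zero, zero_mul, zero_smul, zero_smul]
    | succ r => rw [Nat.add_sub_cancel, ← mul_assoc, ← pow_succ]

/-- Only the power of `X_{i,l+1}` contributes in the Leibniz rule.  The new factor `X_{i,l}` stands
next to the power of `X_{i,l}` and is absorbed by it; the factors to the right of `X_{i,l+1}` have
weight zero. -/
theorem actR_E_rowMonomial (l : Fin (n - 1)) (i : Fin k) (m : Fin n → ℕ) :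
    actR k n (Uh.E l) (rowMonomial i m) =
      qInt (m (up l)) • rowMonomial i (m + Pi.single (lo l) 1 - Pi.single (up l) 1) := by
  rw [rowMonomial, skew_prod_right _ _ (actR_E_mul l) (actR_E_one l) (actR_K_mul l) (actR_K_one l)
    _ _ (fun j => actR_K_X_pow l i j (m j)), Finset.sum_eq_single (up l)]
  · rw [Finset.prod_eq_one, one_smul, actR_E_X_pow, map_smul, prodAt_apply]
    · congr 1
      refine prod_congr_adjacent _ _ l (by omega) (fun j hj hj' => ?_) ?_
      · have h1 : j ≠ lo l := fun h => hj (by rw [h]; rfl)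
        have h2 : j ≠ up l := fun h => hj' (by rw [h]; rfl)
        simp [h1, h2]
      · change Function.update (fun j => Sh.X i j ^ m j : Fin n → Sh k n) (up l) _ (lo l) *
          Function.update (fun j => Sh.X i j ^ m j : Fin n → Sh k n) (up l) _ (up l) =
          Sh.X i (lo l) ^ (m + Pi.single (lo l) 1 - Pi.single (up l) 1 : Fin n → ℕ) (lo l) *
            Sh.X i (up l) ^ (m + Pi.single (lo l) 1 - Pi.single (up l) 1 : Fin n → ℕ) (up l)
        rw [Function.update_self, Function.update_of_ne (lo_ne_up l), ← mul_assoc, ← pow_succ]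
        simp [lo_ne_up l, (lo_ne_up l).symm]
    · intro j hj
      have h2 := Finset.mem_Ioi.mp hj
      rw [wt_of_ne ((lo_lt_up l).trans h2).ne' h2.ne', mul_zero, expH_zero]
  · intro j _ hj
    rw [actR_E_X_pow_of_ne hj, map_zero, smul_zero]
  · simp

theorem actR_F_rowMonomial (l : Fin (n - 1)) (i : Fin k) (m : Fin n → ℕ) :
    actR k n (Uh.F l) (rowMonomial i m) =
      qInt (m (lo l)) • rowMonomial i (m + Pi.single (up l) 1 - Pi.single (lo l) 1) := by
  rw [rowMonomial, skew_prod_left _ _ (actR_F_mul l) (actR_F_one l) (actR_Kinv_mul l)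
    (actR_Kinv_one l) _ _ (fun j => actR_Kinv_X_pow l i j (m j)), Finset.sum_eq_single (lo l)]
  · rw [Finset.prod_eq_one, one_smul, actR_F_X_pow, map_smul, prodAt_apply]
    · congr 1
      refine prod_congr_adjacent _ _ l (by omega) (fun j hj hj' => ?_) ?_
      · have h1 : j ≠ lo l := fun h => hj (by rw [h]; rfl)
        have h2 : j ≠ up l := fun h => hj' (by rw [h]; rfl)
        simp [h1, h2]
      · change Function.update (fun j => Sh.X i j ^ m j : Fin n → Sh k n) (lo l) _ (lo l) *
          Function.update (fun j => Sh.X i j ^ m j : Fin n → Sh k n) (lo l) _ (up l) =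
          Sh.X i (lo l) ^ (m + Pi.single (up l) 1 - Pi.single (lo l) 1 : Fin n → ℕ) (lo l) *
            Sh.X i (up l) ^ (m + Pi.single (up l) 1 - Pi.single (lo l) 1 : Fin n → ℕ) (up l)
        rw [Function.update_self, Function.update_of_ne (lo_ne_up l).symm, mul_assoc, ← pow_succ']
        simp [lo_ne_up l, (lo_ne_up l).symm]
    · intro j hj
      have h2 := Finset.mem_Iio.mp hj
      rw [wt_of_ne h2.ne (h2.trans (lo_lt_up l)).ne, neg_zero, mul_zero, expH_zero]
  · intro j _ hj
    rw [actR_F_X_pow_of_ne hj, map_zero, smul_zero]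
  · simp

theorem prodAt_rowMonomial (m : Matrix (Fin k) (Fin n) ℕ) (i : Fin k) (a b : Fin n) :
    prodAt (fun i => rowMonomial i (m i)) i (rowMonomial i (m i + Pi.single a 1 - Pi.single b 1)) =
      Sh.monomial (m + Matrix.single i a 1 - Matrix.single i b 1) := by
  rw [prodAt_apply, monomial_eq_row]
  congr 2
  ext1 i'
  by_cases h : i' = i
  · subst h
    rw [Function.update_self]
    congr 1
    ext j
    simp [Matrix.single_apply, Pi.single_apply, eq_comm]
  · rw [Function.update_of_ne h]
    congr 1
    ext j
    simp [Ne.symm h]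

theorem actR_D_monomial (m : Matrix (Fin k) (Fin n) ℕ) (l : Fin n) :
    actR k n (Uh.D l) (Sh.monomial m) = (∑ i, (m i l : Rh)) • Sh.monomial m := by
  rw [monomial_eq_row]
  refine derivation_prod _ (actR_D_mul l) (actR_D_one l) _ _ fun i => ?_
  rw [rowMonomial, derivation_prod _ (actR_D_mul l) (actR_D_one l) _ _ fun j =>
    derivation_pow _ (actR_D_mul l) (actR_D_one l) _ _ (actR_D_X l i j) (m i j)]
  congr 1
  simp

theorem actR_E_monomial (m : Matrix (Fin k) (Fin n) ℕ) (l : Fin (n - 1)) :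
    actR k n (Uh.E l) (Sh.monomial m) =
      ∑ i, (qInt (m i (up l)) *
        ∏ i' ∈ Finset.Ioi i, expH ((m i' (lo l) : ℂ) - (m i' (up l) : ℂ))) •
        Sh.monomial (m + Matrix.single i (lo l) 1 - Matrix.single i (up l) 1) := by
  rw [monomial_eq_row, skew_prod_right _ _ (actR_E_mul l) (actR_E_one l) (actR_K_mul l)
    (actR_K_one l) _ _ (fun i => actR_K_rowMonomial l i (m i))]
  refine Finset.sum_congr rfl fun i _ => ?_
  rw [actR_E_rowMonomial, map_smul, prodAt_rowMonomial, smul_smul, mul_comm]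

theorem actR_F_monomial (m : Matrix (Fin k) (Fin n) ℕ) (l : Fin (n - 1)) :
    actR k n (Uh.F l) (Sh.monomial m) =
      ∑ i, (qInt (m i (lo l)) *
        ∏ i' ∈ Finset.Iio i, expH (-((m i' (lo l) : ℂ) - (m i' (up l) : ℂ)))) •
        Sh.monomial (m + Matrix.single i (up l) 1 - Matrix.single i (lo l) 1) := by
  rw [monomial_eq_row, skew_prod_left _ _ (actR_F_mul l) (actR_F_one l) (actR_Kinv_mul l)
    (actR_Kinv_one l) _ _ (fun i => actR_Kinv_rowMonomial l i (m i))]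
  refine Finset.sum_congr rfl fun i _ => ?_
  rw [actR_F_rowMonomial, map_smul, prodAt_rowMonomial, smul_smul, mul_comm]

theorem actL_monomial (x : Uh k) (m : Matrix (Fin k) (Fin n) ℕ) : actL k n x (Sh.monomial m) =
    Sh.transpose n k (actR n k x (Sh.monomial m.transpose)) := by
  rw [actL_apply, transpose_monomial]

theorem transpose_monomial_shift (m : Matrix (Fin k) (Fin n) ℕ) (a b : Fin k) (j : Fin n) :
    Sh.transpose n k (Sh.monomial (m.transpose + Matrix.single j a 1 - Matrix.single j b 1)) =
      Sh.monomial (m + Matrix.single a j 1 - Matrix.single b j 1) := by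
  rw [transpose_monomial, Matrix.transpose_sub, Matrix.transpose_add, Matrix.transpose_transpose,
    Matrix.transpose_single, Matrix.transpose_single]

theorem actL_D_monomial (m : Matrix (Fin k) (Fin n) ℕ) (i : Fin k) :
    actL k n (Uh.D i) (Sh.monomial m) = (∑ j, (m i j : Rh)) • Sh.monomial m := by
  rw [actL_monomial, actR_D_monomial, map_smul, transpose_monomial, Matrix.transpose_transpose]
  rfl

theorem actL_E_monomial (m : Matrix (Fin k) (Fin n) ℕ) (l : Fin (k - 1)) :
    actL k n (Uh.E l) (Sh.monomial m) =
      ∑ j, (qInt (m (up l) j) *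
        ∏ j' ∈ Finset.Ioi j, expH ((m (lo l) j' : ℂ) - (m (up l) j' : ℂ))) •
        Sh.monomial (m + Matrix.single (lo l) j 1 - Matrix.single (up l) j 1) := by
  rw [actL_monomial, actR_E_monomial, map_sum]
  refine Finset.sum_congr rfl fun j _ => ?_
  rw [map_smul, transpose_monomial_shift]
  rfl

theorem actL_F_monomial (m : Matrix (Fin k) (Fin n) ℕ) (l : Fin (k - 1)) :
    actL k n (Uh.F l) (Sh.monomial m) =
      ∑ j, (qInt (m (lo l) j) *
        ∏ j' ∈ Finset.Iio j, expH (-((m (lo l) j' : ℂ) - (m (up l) j' : ℂ)))) •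
        Sh.monomial (m + Matrix.single (up l) j 1 - Matrix.single (lo l) j 1) := by
  rw [actL_monomial, actR_F_monomial, map_sum]
  refine Finset.sum_congr rfl fun j _ => ?_
  rw [map_smul, transpose_monomial_shift]
  rfl

end Formulas

end QHowe

end

open QHowe

theorem mainTheorem6 :
    ∃ (Δ : ∀ p : ℕ, Uh p →ₐ[Rh] CTensor (Uh p) (Uh p))
      (ε : ∀ p : ℕ, Uh p →ₐ[Rh] Rh)
      (ρ : ∀ p : ℕ, Uh p →ₐ[Rh] Matrix (Fin p) (Fin p) Rh)
      (δ : ∀ k l n : ℕ, Sh k n →ₐ[Rh] CTensor (Sh k l) (Sh l n))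
      (η : ∀ p : ℕ, Sh p p →ₐ[Rh] Rh)
      (κ : ∀ p : ℕ, Sh p p →ₗ[Rh] Module.Dual Rh (Uh p))
      (act : ∀ k n : ℕ, CTensor (Uh k) (Uh n) →ₐ[Rh] Module.End Rh (Sh k n)),
      (∀ p, IsCoproduct (Δ p)) ∧ (∀ p, IsCounit (ε p)) ∧ (∀ p, IsVectorRep (ρ p)) ∧
      (∀ k l n, IsMatCoproduct (δ k l n)) ∧ (∀ p, IsMatCounit (η p)) ∧
      (∀ p, IsKappa (Δ p) (ε p) (ρ p) (δ p p p) (η p) (κ p)) ∧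
      ∀ k n : ℕ,
        ((∀ (x : Uh k) (f : Sh k n),
            act k n (ctmul x 1) f = leftPairing (κ k) (δ k k n) x f) ∧
          (∀ (y : Uh n) (f : Sh k n),
            act k n (ctmul 1 y) f = rightPairing (κ n) (δ k n n) y f) ∧
          IsModuleAlgebra (tensorComul (Δ k) (Δ n)) (tensorCounit (ε k) (ε n)) (act k n) ∧
          (∀ (d : ℕ) (z : CTensor (Uh k) (Uh n)), ∀ f ∈ Sh.homog k n d,
            act k n z f ∈ Sh.homog k n d)) ∧
        ((∃ T : ∀ a : ℕ, Uh k →ₐ[Rh] Module.End Rh (TPow (Sh k 1) a),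
            IsTensorPowerAction (Δ k) (ε k) ((act k 1).comp (inclL (Uh k) (Uh 1))) T ∧
            Function.Bijective (Sh.Phi k n) ∧
            (∀ (x : Uh k) (t : TPow (Sh k 1) n),
              Sh.Phi k n (T n x t) = act k n (ctmul x 1) (Sh.Phi k n t)) ∧
            (∀ d : ℕ, (Sh.tensorHomog k 1 n d).map (Sh.Phi k n) = Sh.homog k n d)) ∧
          (∃ T : ∀ a : ℕ, Uh n →ₐ[Rh] Module.End Rh (TPow (Sh 1 n) a),
            IsTensorPowerAction (Δ n) (ε n) ((act 1 n).comp (inclR (Uh 1) (Uh n))) T ∧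
            Function.Bijective (Sh.Psi k n) ∧
            (∀ (y : Uh n) (t : TPow (Sh 1 n) k),
              Sh.Psi k n (T k y t) = act k n (ctmul 1 y) (Sh.Psi k n t)) ∧
            (∀ d : ℕ, (Sh.tensorHomog 1 n k d).map (Sh.Psi k n) = Sh.homog k n d))) ∧
        (∀ m : Matrix (Fin k) (Fin n) ℕ,
          (∀ i : Fin k, act k n (ctmul (Uh.D i) 1) (Sh.monomial m) =
            (∑ j, (m i j : Rh)) • Sh.monomial m) ∧
          (∀ i : Fin (k - 1), act k n (ctmul (Uh.E i) 1) (Sh.monomial m) =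
            ∑ j, (qInt (m (up i) j) *
              ∏ j' ∈ Finset.Ioi j, expH ((m (lo i) j' : ℂ) - (m (up i) j' : ℂ))) •
              Sh.monomial (m + Matrix.single (lo i) j 1 - Matrix.single (up i) j 1)) ∧
          (∀ i : Fin (k - 1), act k n (ctmul (Uh.F i) 1) (Sh.monomial m) =
            ∑ j, (qInt (m (lo i) j) *
              ∏ j' ∈ Finset.Iio j, expH (-((m (lo i) j' : ℂ) - (m (up i) j' : ℂ)))) •
              Sh.monomial (m + Matrix.single (up i) j 1 - Matrix.single (lo i) j 1)) ∧
          (∀ j : Fin n, act k n (ctmul 1 (Uh.D j)) (Sh.monomial m) =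
            (∑ i, (m i j : Rh)) • Sh.monomial m) ∧
          (∀ j : Fin (n - 1), act k n (ctmul 1 (Uh.E j)) (Sh.monomial m) =
            ∑ i, (qInt (m i (up j)) *
              ∏ i' ∈ Finset.Ioi i, expH ((m i' (lo j) : ℂ) - (m i' (up j) : ℂ))) •
              Sh.monomial (m + Matrix.single i (lo j) 1 - Matrix.single i (up j) 1)) ∧
          (∀ j : Fin (n - 1), act k n (ctmul 1 (Uh.F j)) (Sh.monomial m) =
            ∑ i, (qInt (m i (lo j)) *
              ∏ i' ∈ Finset.Iio i, expH (-((m i' (lo j) : ℂ) - (m i' (up j) : ℂ)))) •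
              Sh.monomial (m + Matrix.single i (up j) 1 - Matrix.single i (lo j) 1))) := by
  refine ⟨Delta, counit, vectorRep, matDelta, matCounit, kappaDual, act,
    fun _ => isCoproduct_Delta, fun _ => isCounit_counit, fun _ => isVectorRep_vectorRep,
    isMatCoproduct_matDelta, isMatCounit_matCounit, isKappa_kappaDual, fun k n =>
    ⟨⟨fun x f => (act_left x f).trans (leftPairing_eq x f).symm,
      fun y f => (act_right y f).trans (rightPairing_eq y f).symm,
      isModuleAlgebra_act, fun d z f hf => act_mem_homog d z f hf⟩, ⟨?_, ?_⟩, fun m => ?_⟩⟩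
  · obtain ⟨T, hT, hPhi⟩ := exists_tensorPowerAction_Phi k
    exact ⟨T, hT, ⟨Phi_injective k n, Phi_surjective k n⟩,
      fun x t => (hPhi n x t).trans (act_left x _).symm, map_tensorHomog_Phi k n⟩
  · obtain ⟨T, hT, hPsi⟩ := exists_tensorPowerAction_Psi n
    exact ⟨T, hT, Psi_bijective k n,
      fun y t => (hPsi k y t).trans (act_right y _).symm, map_tensorHomog_Psi k n⟩
  · simp only [act_left, act_right]
    exact ⟨actL_D_monomial m, actL_E_monomial m, actL_F_monomial m,
      actR_D_monomial m, actR_E_monomial m, actR_F_monomial m⟩
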